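/- Let $\theta\in(0,\pi/2)$ and let $$\Omega_\theta=\Big\{(x_1,x_2)\in\mathbb R^2:\ x_1\tan\theta<|x_2|<\Big(x_1+\frac{\pi}{\sin\theta}\Big)\tan\theta\Big\}$$ be the broken guide of half-opening $\theta$. Let $A=\Delta^{\mathsf{Dir}}_{\Omega_\theta}$ be the positive Dirichlet Laplacian on $L^2(\Omega_\theta)=L^2(\Omega_\theta;\mathbb C)$, that is, $A\psi=-\Delta\psi$ (in the sense of distributions) with domain $\mathrm{Dom}(A)=\{\psi\in H^1_0(\Omega_\theta):\ \Delta\psi\in L^2(\Omega_\theta)\}$. Its essential spectrum is the set $\sigma_{\mathsf{ess}}(A)$ of the real $\mu$ for which $A-\mu$ is not Fredholm from $\mathrm{Dom}(A)$ into $L^2(\Omega_\theta)$ (finite-dimensional kernel, closed range of finite codimension). For $j\ge1$ let $$\lambda_j=\inf_{\substack{u_1,\dots,u_j\in\mathrm{Dom}(A)\\ \text{independent}}}\ \ \sup_{0\neq u\in\mathrm{span}(u_1,\dots,u_j)}\ \frac{\langle Au,u\rangle}{\langle u,u\rangle}$$ be the $j$-th Rayleigh quotient of $A$, and let $\mathcal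 N(A,1)$ be the largest index $j\ge1$ with $\lambda_j<1$ ($0$ if there is none, $\infty$ if there are arbitrarily large ones). Then $\mathcal N(A,1)$ is finite and nonzero. Moreover, the set of the eigenvalues of $A$ lying strictly below $\sigma_{\mathsf{ess}}(A)$ coincides with the set of the eigenvalues of $A$ that are $<1$; it is finite and nonempty, each of these eigenvalues has finite multiplicity, and $\mathcal N(A,1)$ is the sum of their multiplicities. In particular, the number of bound states (eigenvalues below the essential spectrum, counted with multiplicity) is nonzero and finite. -/

import Mathlib

open MeasureTheory Filter Topology
open scoped ContDiff ENNReal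

noncomputable section

namespace Waveguide

/-! ### Unbounded operators on a complex Hilbert space -/

section Operators

variable {H : Type*} [NormedAddCommGroup H] [InnerProductSpace ℂ H]

/-- The linear map `A - z` from the domain of `A` into `H`. -/
def shift (A : H →ₗ.[ℂ] H) (z : ℂ) : A.domain →ₗ[ℂ] H :=
  A.toFun - z • A.domain.subtype

/-- The space of all `u` in the domain of `A` with `A u = z u`. -/
def eigenspace (A : H →ₗ.[ℂ] H) (z : ℂ) : Submodule ℂ A.domain :=
  LinearMap.ker (shift A z)

/-- A linear map defined on a subspace of `H` is Fredholm if its kernel is finite dimensional and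
its range is closed and of finite codimension. -/
def IsFredholmOn {D : Submodule ℂ H} (T : D →ₗ[ℂ] H) : Prop :=
  FiniteDimensional ℂ (LinearMap.ker T) ∧
    IsClosed (LinearMap.range T : Set H) ∧
    FiniteDimensional ℂ (H ⧸ LinearMap.range T)

/-- The (real) essential spectrum: those `μ` for which `A - μ`, from the domain of `A` into `H`,
is not Fredholm. -/
def essentialSpectrum (A : H →ₗ.[ℂ] H) : Set ℝ :=
  {μ | ¬ IsFredholmOn (shift A (μ : ℂ))}

/-- The real eigenvalues lying strictly below the whole essential spectrum. -/
def eigenvaluesBelowEss (A : H →ₗ.[ℂ] H) : Set ℝ :=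
  {r | eigenspace A (r : ℂ) ≠ ⊥ ∧ ∀ μ ∈ essentialSpectrum A, r < μ}

/-- The `j`-th Rayleigh quotient (meaningful for `j ≥ 1`): the infimum, over independent
`u₁, …, uⱼ` in the domain of `A`, of the supremum of `⟨A w, w⟩ / ⟨w, w⟩` over the nonzero `w` in
the span of `u₁, …, uⱼ`. Infimum and supremum are taken in the extended reals. -/
def rayleighQuotient (A : H →ₗ.[ℂ] H) (j : ℕ) : EReal :=
  ⨅ (u : Fin j → A.domain) (_ : LinearIndependent ℂ u),
    ⨆ (w : A.domain) (_ : w ∈ Submodule.span ℂ (Set.range u)) (_ : w ≠ 0),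
      (((inner ℂ (A w) (w : H)).re / ‖(w : H)‖ ^ 2 : ℝ) : EReal)

/-- The largest index `j ≥ 1` such that the `j`-th Rayleigh quotient of `A` is `< r`: it is `0` if
there is no such index, and `⊤` if there are arbitrarily large ones. -/
def countBelow (A : H →ₗ.[ℂ] H) (r : ℝ) : ℕ∞ :=
  ⨆ (j : ℕ) (_ : 1 ≤ j ∧ rayleighQuotient A j < (r : EReal)), (j : ℕ∞)

end Operators

/-! ### The Dirichlet Laplacian on an open subset of the plane

The plane is `ℝ × ℝ` with its Lebesgue (product) measure. Only partial derivatives are used, so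
the choice of a norm on `ℝ × ℝ` plays no role. -/

/-- The derivative of `φ` in the direction `v`. -/
def dirDeriv (v : ℝ × ℝ) (φ : ℝ × ℝ → ℂ) : ℝ × ℝ → ℂ :=
  fun x => fderiv ℝ φ x v

/-- The Laplacian `∂₁² φ + ∂₂² φ`. -/
def laplacian (φ : ℝ × ℝ → ℂ) : ℝ × ℝ → ℂ :=
  fun x => dirDeriv (1, 0) (dirDeriv (1, 0) φ) x + dirDeriv (0, 1) (dirDeriv (0, 1) φ) x

/-- Smooth functions with compact support in `Ω`. -/
structure IsTest (Ω : TopologicalSpace.Opens (ℝ × ℝ)) (φ : ℝ × ℝ → ℂ) : Prop where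
  smooth : ContDiff ℝ ∞ φ
  compact : HasCompactSupport φ
  support : tsupport φ ⊆ (Ω : Set (ℝ × ℝ))

/-- The complex Hilbert space `L²(Ω)`. -/
abbrev L2 (Ω : TopologicalSpace.Opens (ℝ × ℝ)) : Type :=
  Lp ℂ 2 ((volume : Measure (ℝ × ℝ)).restrict (Ω : Set (ℝ × ℝ)))

/-- `g` is the weak derivative of `u` in the direction `v`. -/
def HasWeakDeriv {Ω : TopologicalSpace.Opens (ℝ × ℝ)} (v : ℝ × ℝ) (u g : L2 Ω) : Prop :=
  ∀ φ, IsTest Ω φ → ∫ x in (Ω : Set (ℝ × ℝ)), u x * dirDeriv v φ x =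
    -∫ x in (Ω : Set (ℝ × ℝ)), g x * φ x

/-- `f` is the Laplacian of `u` in the sense of distributions on `Ω`. -/
def HasWeakLaplacian {Ω : TopologicalSpace.Opens (ℝ × ℝ)} (u f : L2 Ω) : Prop :=
  ∀ φ, IsTest Ω φ → ∫ x in (Ω : Set (ℝ × ℝ)), u x * laplacian φ x =
    ∫ x in (Ω : Set (ℝ × ℝ)), f x * φ x

/-- Convergence in `L²(Ω)` of a sequence of functions on the plane. -/
def TendstoL2 {Ω : TopologicalSpace.Opens (ℝ × ℝ)} (φ : ℕ → ℝ × ℝ → ℂ) (u : L2 Ω) : Prop :=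
  Tendsto (fun n => eLpNorm (fun x => φ n x - u x) 2
    ((volume : Measure (ℝ × ℝ)).restrict (Ω : Set (ℝ × ℝ)))) atTop (𝓝 0)

/-- Membership in `H¹₀(Ω)`, the closure of the test functions in `H¹(Ω)`: the function `u` of
`L²(Ω)` has weak first derivatives in `L²(Ω)`, and some sequence of test functions converges to
`u` in `L²(Ω)` together with its first derivatives. -/
def MemH10 {Ω : TopologicalSpace.Opens (ℝ × ℝ)} (u : L2 Ω) : Prop :=
  ∃ g₁ g₂ : L2 Ω, HasWeakDeriv (1, 0) u g₁ ∧ HasWeakDeriv (0, 1) u g₂ ∧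
    ∃ φ : ℕ → ℝ × ℝ → ℂ, (∀ n, IsTest Ω (φ n)) ∧ TendstoL2 φ u ∧
      TendstoL2 (fun n => dirDeriv (1, 0) (φ n)) g₁ ∧
      TendstoL2 (fun n => dirDeriv (0, 1) (φ n)) g₂

variable {Ω : TopologicalSpace.Opens (ℝ × ℝ)}

theorem IsTest.zero : IsTest Ω (fun _ => 0) :=
  ⟨contDiff_const, HasCompactSupport.zero, by
    have : tsupport (fun _ : ℝ × ℝ => (0 : ℂ)) = ∅ := tsupport_eq_empty_iff.2 rfl
    simp [this]⟩

theorem IsTest.add {φ ψ : ℝ × ℝ → ℂ} (hφ : IsTest Ω φ) (hψ : IsTest Ω ψ) :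
    IsTest Ω (fun x => φ x + ψ x) :=
  ⟨hφ.smooth.add hψ.smooth, hφ.compact.add hψ.compact,
    (tsupport_add φ ψ).trans (Set.union_subset hφ.support hψ.support)⟩

theorem IsTest.const_mul {φ : ℝ × ℝ → ℂ} (hφ : IsTest Ω φ) (c : ℂ) :
    IsTest Ω (fun x => c * φ x) :=
  ⟨contDiff_const.mul hφ.smooth, hφ.compact.mul_left,
    (tsupport_mul_subset_right (f := fun _ => c) (g := φ)).trans hφ.support⟩

theorem IsTest.dirDeriv {φ : ℝ × ℝ → ℂ} (hφ : IsTest Ω φ) (v : ℝ × ℝ) :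
    IsTest Ω (dirDeriv v φ) where
  smooth := (hφ.smooth.fderiv_right (m := ∞) (by simp)).clm_apply contDiff_const
  compact := hφ.compact.fderiv_apply ℝ v
  support := (tsupport_fderiv_apply_subset ℝ v).trans hφ.support

theorem IsTest.laplacian {φ : ℝ × ℝ → ℂ} (hφ : IsTest Ω φ) : IsTest Ω (laplacian φ) :=
  ((hφ.dirDeriv _).dirDeriv _).add ((hφ.dirDeriv _).dirDeriv _)

theorem IsTest.memLp {φ : ℝ × ℝ → ℂ} (hφ : IsTest Ω φ) (p : ℝ≥0∞) :
    MemLp φ p ((volume : Measure (ℝ × ℝ)).restrict (Ω : Set (ℝ × ℝ))) :=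
  hφ.smooth.continuous.memLp_of_hasCompactSupport hφ.compact

theorem IsTest.integrable_mul {φ : ℝ × ℝ → ℂ} (hφ : IsTest Ω φ) (u : L2 Ω) :
    IntegrableOn (fun x => u x * φ x) (Ω : Set (ℝ × ℝ)) :=
  (Lp.memLp u).integrable_mul (hφ.memLp 2)

theorem integral_add_mul {φ : ℝ × ℝ → ℂ} (hφ : IsTest Ω φ) (u v : L2 Ω) :
    ∫ x in (Ω : Set (ℝ × ℝ)), (u + v : L2 Ω) x * φ x =
      (∫ x in (Ω : Set (ℝ × ℝ)), u x * φ x) + ∫ x in (Ω : Set (ℝ × ℝ)), v x * φ x := by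
  rw [← integral_add (hφ.integrable_mul u) (hφ.integrable_mul v)]
  refine integral_congr_ae ?_
  filter_upwards [Lp.coeFn_add u v] with x hx
  rw [hx, Pi.add_apply, add_mul]

theorem integral_smul_mul (φ : ℝ × ℝ → ℂ) (c : ℂ) (u : L2 Ω) :
    ∫ x in (Ω : Set (ℝ × ℝ)), (c • u : L2 Ω) x * φ x =
      c * ∫ x in (Ω : Set (ℝ × ℝ)), u x * φ x := by
  rw [← integral_const_mul]
  refine integral_congr_ae ?_
  filter_upwards [Lp.coeFn_smul c u] with x hx
  rw [hx, Pi.smul_apply, smul_eq_mul, mul_assoc]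

theorem integral_zero_mul (φ : ℝ × ℝ → ℂ) :
    ∫ x in (Ω : Set (ℝ × ℝ)), (0 : L2 Ω) x * φ x = 0 := by
  have := integral_smul_mul φ 0 (0 : L2 Ω)
  simpa using this

theorem HasWeakDeriv.add {v : ℝ × ℝ} {u u' g g' : L2 Ω} (h : HasWeakDeriv v u g)
    (h' : HasWeakDeriv v u' g') : HasWeakDeriv v (u + u') (g + g') := fun φ hφ => by
  rw [integral_add_mul (hφ.dirDeriv v), integral_add_mul hφ, h φ hφ, h' φ hφ, neg_add]

theorem HasWeakDeriv.smul {v : ℝ × ℝ} {u g : L2 Ω} (c : ℂ) (h : HasWeakDeriv v u g) :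
    HasWeakDeriv v (c • u) (c • g) := fun φ hφ => by
  rw [integral_smul_mul, integral_smul_mul, h φ hφ, mul_neg]

theorem HasWeakLaplacian.add {u u' f f' : L2 Ω} (h : HasWeakLaplacian u f)
    (h' : HasWeakLaplacian u' f') : HasWeakLaplacian (u + u') (f + f') := fun φ hφ => by
  rw [integral_add_mul hφ.laplacian, integral_add_mul hφ, h φ hφ, h' φ hφ]

theorem HasWeakLaplacian.smul {u f : L2 Ω} (c : ℂ) (h : HasWeakLaplacian u f) :
    HasWeakLaplacian (c • u) (c • f) := fun φ hφ => by
  rw [integral_smul_mul, integral_smul_mul, h φ hφ]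

/-- The distributional Laplacian is unique. -/
theorem HasWeakLaplacian.unique {u f f' : L2 Ω} (h : HasWeakLaplacian u f)
    (h' : HasWeakLaplacian u f') : f = f' := by
  have hloc : ∀ w : L2 Ω, LocallyIntegrableOn (fun x => w x) (Ω : Set (ℝ × ℝ)) := fun w =>
    locallyIntegrableOn_of_locallyIntegrable_restrict
      ((Lp.memLp w).locallyIntegrable (by norm_num))
  have key := Ω.isOpen.ae_eq_zero_of_integral_contDiff_smul_eq_zero
    ((hloc f).sub (hloc f')) (fun g hg hgc hgs => by
      have ht : IsTest Ω (fun x => (g x : ℂ)) :=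
        ⟨Complex.ofRealCLM.contDiff.comp hg, hgc.comp_left (g := fun r : ℝ => (r : ℂ)) rfl,
          (tsupport_comp_subset (g := fun r : ℝ => (r : ℂ)) rfl g).trans hgs⟩
      have e : ∫ x in (Ω : Set (ℝ × ℝ)), (f x * (g x : ℂ) - f' x * (g x : ℂ)) = 0 := by
        rw [integral_sub (ht.integrable_mul f) (ht.integrable_mul f'), ← h _ ht, ← h' _ ht,
          sub_self]
      rw [← setIntegral_eq_integral_of_forall_compl_eq_zero (s := (Ω : Set (ℝ × ℝ)))
        (fun x hx => by
          rw [image_eq_zero_of_notMem_tsupport (fun hx' => hx (hgs hx')), zero_smul]), ← e]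
      refine integral_congr_ae (Eventually.of_forall fun x => ?_)
      simp only [Pi.sub_apply, Complex.real_smul]
      ring)
  refine Lp.ext ?_
  rw [Filter.EventuallyEq, ae_restrict_iff' Ω.isOpen.measurableSet]
  filter_upwards [key] with x hx hxΩ
  exact sub_eq_zero.1 (hx hxΩ)

theorem TendstoL2.add {φ ψ : ℕ → ℝ × ℝ → ℂ} {u v : L2 Ω} (hφ : ∀ n, IsTest Ω (φ n))
    (hψ : ∀ n, IsTest Ω (ψ n)) (h : TendstoL2 φ u) (h' : TendstoL2 ψ v) :
    TendstoL2 (fun n x => φ n x + ψ n x) (u + v) := by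
  have hs := Tendsto.add h h'
  rw [add_zero] at hs
  refine tendsto_of_tendsto_of_tendsto_of_le_of_le tendsto_const_nhds hs
    (fun _ => bot_le) fun n => ?_
  refine le_trans (le_of_eq (eLpNorm_congr_ae ?_)) (eLpNorm_add_le
    (((hφ n).memLp 2).sub (Lp.memLp u)).aestronglyMeasurable
    (((hψ n).memLp 2).sub (Lp.memLp v)).aestronglyMeasurable (by norm_num))
  filter_upwards [Lp.coeFn_add u v] with x hx
  simp only [hx, Pi.add_apply]
  ring

theorem TendstoL2.smul {φ : ℕ → ℝ × ℝ → ℂ} {u : L2 Ω} (c : ℂ) (h : TendstoL2 φ u) :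
    TendstoL2 (fun n x => c * φ n x) (c • u) := by
  have hs := ENNReal.Tendsto.const_mul (a := ‖c‖ₑ) h (Or.inr enorm_ne_top)
  rw [mul_zero] at hs
  refine hs.congr fun n => ?_
  rw [← eLpNorm_const_smul]
  refine eLpNorm_congr_ae ?_
  filter_upwards [Lp.coeFn_smul c u] with x hx
  simp only [hx, Pi.smul_apply, smul_eq_mul]
  ring

theorem dirDeriv_add {φ ψ : ℝ × ℝ → ℂ} (hφ : IsTest Ω φ) (hψ : IsTest Ω ψ) (v : ℝ × ℝ) :
    dirDeriv v (fun x => φ x + ψ x) = fun x => dirDeriv v φ x + dirDeriv v ψ x := by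
  funext x
  have h1 := hφ.smooth.differentiable (by simp) x
  have h2 := hψ.smooth.differentiable (by simp) x
  simp only [dirDeriv]
  rw [fderiv_fun_add h1 h2]
  rfl

theorem dirDeriv_const_mul {φ : ℝ × ℝ → ℂ} (hφ : IsTest Ω φ) (c : ℂ) (v : ℝ × ℝ) :
    dirDeriv v (fun x => c * φ x) = fun x => c * dirDeriv v φ x := by
  funext x
  have h1 := hφ.smooth.differentiable (by simp) x
  simp only [dirDeriv]
  rw [fderiv_const_mul h1]
  rfl

theorem MemH10.add {u u' : L2 Ω} (h : MemH10 u) (h' : MemH10 u') : MemH10 (u + u') := by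
  obtain ⟨g₁, g₂, hg₁, hg₂, φ, hφ, hu, hu₁, hu₂⟩ := h
  obtain ⟨k₁, k₂, hk₁, hk₂, ψ, hψ, hv, hv₁, hv₂⟩ := h'
  refine ⟨g₁ + k₁, g₂ + k₂, hg₁.add hk₁, hg₂.add hk₂, fun n x => φ n x + ψ n x,
    fun n => (hφ n).add (hψ n), hu.add hφ hψ hv, ?_, ?_⟩
  · simp only [dirDeriv_add (hφ _) (hψ _)]
    exact hu₁.add (fun n => (hφ n).dirDeriv _) (fun n => (hψ n).dirDeriv _) hv₁
  · simp only [dirDeriv_add (hφ _) (hψ _)]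
    exact hu₂.add (fun n => (hφ n).dirDeriv _) (fun n => (hψ n).dirDeriv _) hv₂

theorem MemH10.smul {u : L2 Ω} (c : ℂ) (h : MemH10 u) : MemH10 (c • u) := by
  obtain ⟨g₁, g₂, hg₁, hg₂, φ, hφ, hu, hu₁, hu₂⟩ := h
  refine ⟨c • g₁, c • g₂, hg₁.smul c, hg₂.smul c, fun n x => c * φ n x,
    fun n => (hφ n).const_mul c, hu.smul c, ?_, ?_⟩
  · simp only [dirDeriv_const_mul (hφ _)]
    exact hu₁.smul c
  · simp only [dirDeriv_const_mul (hφ _)]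
    exact hu₂.smul c

theorem MemH10.zero : MemH10 (0 : L2 Ω) := by
  have hd : ∀ v : ℝ × ℝ, HasWeakDeriv v (0 : L2 Ω) 0 := fun v φ _ => by
    rw [integral_zero_mul, integral_zero_mul, neg_zero]
  have ht : TendstoL2 (fun _ _ => (0 : ℂ)) (0 : L2 Ω) := by
    refine tendsto_const_nhds.congr fun n => ?_
    rw [eq_comm, ← eLpNorm_zero (ε := ℂ) (p := 2)
      (μ := (volume : Measure (ℝ × ℝ)).restrict (Ω : Set (ℝ × ℝ)))]
    refine eLpNorm_congr_ae ?_
    filter_upwards [Lp.coeFn_zero ℂ 2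
      ((volume : Measure (ℝ × ℝ)).restrict (Ω : Set (ℝ × ℝ)))] with x hx
    rw [hx]
    simp
  have h0 : ∀ v : ℝ × ℝ, dirDeriv v (fun _ => (0 : ℂ)) = fun _ => 0 := fun v => by
    funext x
    simp [dirDeriv]
  refine ⟨0, 0, hd _, hd _, fun _ _ => 0, fun _ => IsTest.zero, ht, ?_, ?_⟩
  · simpa only [h0] using ht
  · simpa only [h0] using ht

/-- The domain of the Dirichlet Laplacian: the `u` in `H¹₀(Ω)` with `Δ u` in `L²(Ω)`. -/
def dirichletDomain (Ω : TopologicalSpace.Opens (ℝ × ℝ)) : Submodule ℂ (L2 Ω) where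
  carrier := {u | MemH10 u ∧ ∃ f : L2 Ω, HasWeakLaplacian u f}
  add_mem' := fun ⟨h, f, hf⟩ ⟨h', f', hf'⟩ => ⟨h.add h', f + f', hf.add hf'⟩
  zero_mem' := ⟨MemH10.zero, 0, fun φ _ => by rw [integral_zero_mul, integral_zero_mul]⟩
  smul_mem' := fun c _ ⟨h, f, hf⟩ => ⟨h.smul c, c • f, hf.smul c⟩

/-- The positive Dirichlet Laplacian on `Ω`, as an unbounded operator of `L²(Ω)`: it sends `u` to
`-Δ u`. -/
def dirichletLaplacian (Ω : TopologicalSpace.Opens (ℝ × ℝ)) : L2 Ω →ₗ.[ℂ] L2 Ω where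
  domain := dirichletDomain Ω
  toFun :=
    { toFun := fun u => -u.2.2.choose
      map_add' := fun u v => by
        rw [← neg_add]
        exact congrArg _ ((u + v).2.2.choose_spec.unique
          (u.2.2.choose_spec.add v.2.2.choose_spec))
      map_smul' := fun c u => by
        rw [RingHom.id_apply, smul_neg]
        exact congrArg _ ((c • u).2.2.choose_spec.unique (u.2.2.choose_spec.smul c)) }

/-- The broken guide with half-opening `θ`. -/
def brokenGuide (θ : ℝ) : TopologicalSpace.Opens (ℝ × ℝ) where
  carrier := {x | x.1 * Real.tan θ < |x.2| ∧ |x.2| < (x.1 + Real.pi / Real.sin θ) * Real.tan θ}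
  is_open' := by
    have h₁ : IsOpen {x : ℝ × ℝ | x.1 * Real.tan θ < |x.2|} :=
      isOpen_lt (by fun_prop) (by fun_prop)
    have h₂ : IsOpen {x : ℝ × ℝ | |x.2| < (x.1 + Real.pi / Real.sin θ) * Real.tan θ} :=
      isOpen_lt (by fun_prop) (by fun_prop)
    exact h₁.inter h₂

end Waveguide

end

/-! The number 1 is the lowest Dirichlet eigenvalue of the cross-section: each arm of the guide is a
half-strip of width `π`, with transverse ground state `sin`. The theorem combines a lower bound for
the energy, valid up to finite rank, with two constructions of test functions.

Finiteness. The guide splits into two half-strips and a bounded convex kite at the corner. Across a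
half-strip the one-dimensional Dirichlet inequality gives `∫ |φ|² ≤ ∫ |∇φ|²`. The kite is cut into
finitely many convex cells, so small that the Poincaré–Wirtinger inequality has the same constant 1,
up to the squares of the mean values. Hence the form of `A` is at least 1 on functions orthogonal to
finitely many indicators (`exists_boundedBelowOn`). It follows that `A - m` is Fredholm for every `m
< 1` (`isFredholmOn_shift`) and that the sum `lowSpace` of the eigenspaces below 1 is finite
dimensional.

Counting. That `A` is at least 1 on the complement of `lowSpace` (`quad_ge_of_mem_orthogonal`) rests
on `gap`, which does the work of the spectral theorem: on the complement of a stable finite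
dimensional space, a lower bound `m` of the form can be improved as soon as `A - m` has closed range
and no kernel there. The min-max principle then equates `countBelow A 1` with the dimension of
`lowSpace`.

Threshold. Wide bumps along an arm, multiplied by the transverse ground state, have disjoint
supports and Rayleigh quotients as close to 1 as desired (`exists_high`). So 1 belongs to the
essential spectrum, and lying below that spectrum means being less than 1.

Existence. Take `κ(x₁) sin(t)`, where `t` is the transverse coordinate extended evenly in `x₂` to
the whole guide. For constant `κ` the energy excess over the threshold integrates formally to 0, but
the function has a kink on the axis inside the corner, so it is not critical. A perturbation in the
corner gains at first order, while a plateau of length `r` that truncates `κ` along the arms costs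
only `O(1 / r)` (`exists_plateau_integral_neg`). -/

open MeasureTheory Filter Topology
open scoped ContDiff ENNReal

noncomputable section

namespace Waveguide

/-! ### Nonnegative self-adjoint operators: Fredholm shifts and the gap lemma -/

section Abstract

variable {H : Type*} [NormedAddCommGroup H] [InnerProductSpace ℂ H]

/-- A nonnegative symmetric operator `A` such that `A + 1` is onto. -/
structure IsNonnegSelfAdjoint (A : H →ₗ.[ℂ] H) : Prop where
  symm : ∀ u v : A.domain, inner ℂ (A u) (v : H) = inner ℂ (u : H) (A v)
  surj : ∀ f : H, ∃ u : A.domain, A u + (u : H) = f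
  nonneg : ∀ u : A.domain, 0 ≤ (inner ℂ (A u) (u : H)).re

/-- The quadratic form of `A`. -/
def quad (A : H →ₗ.[ℂ] H) (u : A.domain) : ℝ := (inner ℂ (A u) (u : H)).re

theorem shift_apply (A : H →ₗ.[ℂ] H) (z : ℂ) (u : A.domain) :
    shift A z u = A u - z • (u : H) := rfl

theorem mem_eigenspace {A : H →ₗ.[ℂ] H} {z : ℂ} {u : A.domain} :
    u ∈ eigenspace A z ↔ A u = z • (u : H) := by
  rw [eigenspace, LinearMap.mem_ker, shift_apply, sub_eq_zero]

variable {A : H →ₗ.[ℂ] H}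

theorem re_inner_self (x : H) : (inner ℂ x x).re = ‖x‖ ^ 2 :=
  (norm_sq_eq_re_inner (𝕜 := ℂ) x).symm

theorem quad_eigen {r : ℝ} {u : A.domain} (hu : u ∈ eigenspace A (r : ℂ)) :
    quad A u = r * ‖(u : H)‖ ^ 2 := by
  rw [quad, mem_eigenspace.1 hu, inner_smul_left, Complex.conj_ofReal, Complex.re_ofReal_mul,
    re_inner_self]

namespace IsNonnegSelfAdjoint

variable (hA : IsNonnegSelfAdjoint A)
include hA

theorem norm_le_norm_add (u : A.domain) : ‖(u : H)‖ ≤ ‖A u + (u : H)‖ := by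
  have h : ‖(u : H)‖ ^ 2 ≤ ‖A u + (u : H)‖ ^ 2 := by
    rw [← re_inner_self (A u + (u : H)), inner_add_left, inner_add_right, inner_add_right,
      ← hA.symm u u]
    simp only [Complex.add_re, re_inner_self]
    nlinarith [hA.nonneg u, sq_nonneg ‖A u‖]
  exact le_of_sq_le_sq h (norm_nonneg _)

/-- This is closedness of `A`: the preimage of `y + x` under `A + 1` is the limit of the `u n`,
because `A + 1` does not decrease norms. -/
theorem exists_of_tendsto {u : ℕ → A.domain} {x y : H}
    (hx : Tendsto (fun n => (u n : H)) atTop (𝓝 x)) (hy : Tendsto (fun n => A (u n)) atTop (𝓝 y)) :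
    ∃ w : A.domain, (w : H) = x ∧ A w = y := by
  obtain ⟨w, hw⟩ := hA.surj (y + x)
  have h0 : Tendsto (fun n => ‖A (u n - w) + ((u n - w : A.domain) : H)‖) atTop (𝓝 0) := by
    have : Tendsto (fun n => ‖A (u n) + (u n : H) - (y + x)‖) atTop (𝓝 ‖y + x - (y + x)‖) :=
      ((hy.add hx).sub_const _).norm
    rw [sub_self, norm_zero] at this
    refine this.congr fun n => ?_
    rw [← hw, LinearPMap.map_sub, Submodule.coe_sub]
    congr 1
    abel
  have h1 : Tendsto (fun n => (u n : H) - w) atTop (𝓝 0) :=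
    squeeze_zero_norm (fun n => hA.norm_le_norm_add (u n - w)) h0
  have h2 : x = w := by
    have := tendsto_nhds_unique h1 (hx.sub_const _)
    exact (sub_eq_zero.1 this.symm)
  refine ⟨w, h2.symm, ?_⟩
  rw [h2] at hw
  exact add_right_cancel hw

/-- The hypothesis puts `y` in the kernel of the adjoint of `A - m`; surjectivity of `A + 1` shows
that the adjoint is no larger than `A`. One solves `(A + 1) w = (m + 1) y`, then `(A + 1) v = y -
w`, and symmetry gives `⟨y - w, y - w⟩ = 0`. -/
theorem eigen_of_orthogonal (m : ℝ) {y : H}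
    (hy : ∀ u : A.domain, inner ℂ (shift A (m : ℂ) u) y = 0) :
    ∃ w : A.domain, (w : H) = y ∧ w ∈ eigenspace A (m : ℂ) := by
  obtain ⟨w, hw⟩ := hA.surj (((m : ℂ) + 1) • y)
  have hwy : (w : H) = y := by
    obtain ⟨v, hv⟩ := hA.surj (y - w)
    have h1 : inner ℂ (A v + (v : H)) (w : H) = inner ℂ (v : H) (A w + w) := by
      rw [inner_add_left, inner_add_right, hA.symm]
    have h2 : inner ℂ (A v + (v : H)) y = inner ℂ (v : H) (((m : ℂ) + 1) • y) := by
      have := hy v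
      rw [shift_apply, inner_sub_left, sub_eq_zero, inner_smul_left, Complex.conj_ofReal] at this
      rw [inner_add_left, this, inner_smul_right]
      ring
    have h3 : inner ℂ (y - (w : H)) (y - (w : H)) = 0 := by
      nth_rewrite 1 [← hv]
      rw [inner_sub_right, h1, h2, hw, sub_self]
    exact (sub_eq_zero.1 (inner_self_eq_zero.1 h3)).symm
  refine ⟨w, hwy, mem_eigenspace.2 ?_⟩
  rw [← hwy, add_smul, one_smul] at hw
  exact add_right_cancel hw

theorem inner_shift (m : ℝ) (u v : A.domain) :
    inner ℂ (shift A (m : ℂ) u) (v : H) = inner ℂ (u : H) (shift A (m : ℂ) v) := by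
  rw [shift_apply, shift_apply, inner_sub_left, inner_sub_right, hA.symm, inner_smul_left,
    inner_smul_right, Complex.conj_ofReal]

theorem inner_eigen {r s : ℝ} (hrs : r ≠ s) {u v : A.domain} (hu : u ∈ eigenspace A (r : ℂ))
    (hv : v ∈ eigenspace A (s : ℂ)) : inner ℂ (u : H) (v : H) = 0 := by
  have h := hA.symm u v
  rw [mem_eigenspace.1 hu, mem_eigenspace.1 hv, inner_smul_left, inner_smul_right,
    Complex.conj_ofReal, ← sub_eq_zero, ← sub_mul] at h
  refine (mul_eq_zero.1 h).resolve_left ?_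
  exact sub_ne_zero.2 (by exact_mod_cast hrs)

theorem orthogonalFamily :
    OrthogonalFamily ℂ (fun r : ℝ => eigenspace A (r : ℂ))
      (fun r => (eigenspace A (r : ℂ)).subtypeₗᵢ) :=
  fun _ _ hrs u v => hA.inner_eigen hrs u.2 v.2

end IsNonnegSelfAdjoint

theorem quad_sub_mul (m : ℝ) (u : A.domain) :
    (inner ℂ (shift A (m : ℂ) u) (u : H)).re = quad A u - m * ‖(u : H)‖ ^ 2 := by
  rw [shift_apply, inner_sub_left, inner_smul_left, Complex.conj_ofReal, Complex.sub_re,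
    Complex.re_ofReal_mul, re_inner_self, quad]

theorem finiteDimensional_of_inf_eq_bot {V : Type*} [AddCommGroup V] [Module ℂ V]
    {E s : Submodule ℂ V} (hs : s.CoFG) (h : Disjoint s E) : FiniteDimensional ℂ E := by
  have := Submodule.CoFG.fg_of_disjoint h.symm hs
  exact Module.Finite.of_fg this

/-- `A` is at least `1` on a subspace of finite codimension. -/
def BoundedBelowOn (A : H →ₗ.[ℂ] H) (F : Submodule ℂ H) : Prop :=
  ∀ u : A.domain, (u : H) ∈ Fᗮ → ‖(u : H)‖ ^ 2 ≤ quad A u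

theorem cofg_comap_orthogonal (D : Submodule ℂ H) (F : Submodule ℂ H) [FiniteDimensional ℂ F] :
    (Fᗮ.comap D.subtype).CoFG := by
  have : Fᗮ.comap D.subtype =
      LinearMap.ker ((F.orthogonalProjectionOnto : H →ₗ[ℂ] F) ∘ₗ D.subtype) := by
    ext u
    simp
  rw [this]
  exact Submodule.CoFG.ker _

/-- On the vectors orthogonal to `F`, a space of finite codimension in the domain, `A - m` is
coercive with constant `1 - m`. This bounds the dimension of the kernel and makes the range closed;
the orthogonal complement of the range is the kernel again. -/
theorem isFredholmOn_shift [CompleteSpace H] (hA : IsNonnegSelfAdjoint A) {F : Submodule ℂ H}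
    [FiniteDimensional ℂ F] (hF : BoundedBelowOn A F) {m : ℝ} (hm : m < 1) :
    IsFredholmOn (shift A (m : ℂ)) := by
  have hco := cofg_comap_orthogonal A.domain F
  have hdisj : Disjoint (Fᗮ.comap A.domain.subtype) (eigenspace A (m : ℂ)) := by
    rw [Submodule.disjoint_def]
    intro u hu hu'
    have h1 := hF u hu
    rw [quad_eigen hu'] at h1
    have h2 : ‖(u : H)‖ ^ 2 = 0 := by nlinarith [sq_nonneg ‖(u : H)‖]
    simpa using h2
  have hker : FiniteDimensional ℂ (eigenspace A (m : ℂ)) :=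
    finiteDimensional_of_inf_eq_bot hco hdisj
  have hclosed : IsClosed (LinearMap.range (shift A (m : ℂ)) : Set H) := by
    -- Finitely many extra directions do not affect closedness, so it suffices to treat the image of
    -- the part orthogonal to `F`, where coercivity turns convergent images into Cauchy sequences of
    -- preimages.
    refine LinearMap.isClosed_range_of_isClosed_map_of_finiteDimensional_quotient
      (s := Fᗮ.comap A.domain.subtype) (IsSeqClosed.isClosed ?_)
    intro y x hy hyx
    choose u hu hushift using hy
    have hbound : ∀ w : A.domain, (w : H) ∈ Fᗮ → (1 - m) * ‖(w : H)‖ ≤ ‖shift A (m : ℂ) w‖ := by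
      intro w hw
      have h1 : (1 - m) * ‖(w : H)‖ ^ 2 ≤ ‖shift A (m : ℂ) w‖ * ‖(w : H)‖ := by
        calc _ ≤ quad A w - m * ‖(w : H)‖ ^ 2 := by linarith [hF w hw]
          _ = (inner ℂ (shift A (m : ℂ) w) (w : H)).re := (quad_sub_mul m w).symm
          _ ≤ ‖inner ℂ (shift A (m : ℂ) w) (w : H)‖ := Complex.re_le_norm _
          _ ≤ _ := norm_inner_le_norm _ _
      rcases (norm_nonneg (w : H)).eq_or_lt with h0 | h0
      · rw [← h0, mul_zero]
        exact norm_nonneg _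
      · exact le_of_mul_le_mul_right (by linarith [h1]) h0
    have hcau : CauchySeq (fun n => (u n : H)) := by
      have hyc := hyx.cauchySeq
      rw [Metric.cauchySeq_iff'] at hyc ⊢
      intro ε hε
      obtain ⟨N, hN⟩ := hyc ((1 - m) * ε) (mul_pos (by linarith) hε)
      refine ⟨N, fun n hn => ?_⟩
      have h1 := hN n hn
      have h2 := hbound (u n - u N) (Fᗮ.sub_mem (hu n) (hu N))
      rw [map_sub, hushift, hushift, Submodule.coe_sub] at h2
      rw [dist_eq_norm] at h1 ⊢
      exact lt_of_mul_lt_mul_left (h2.trans_lt h1) (by linarith)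
    obtain ⟨x0, hx0⟩ := cauchySeq_tendsto_of_complete hcau
    have hAu : Tendsto (fun n => A (u n)) atTop (𝓝 (x + (m : ℂ) • x0)) := by
      refine (hyx.add (hx0.const_smul (m : ℂ))).congr fun n => ?_
      rw [← hushift n, shift_apply, sub_add_cancel]
    obtain ⟨w, hw, hAw⟩ := hA.exists_of_tendsto hx0 hAu
    refine ⟨w, ?_, ?_⟩
    · change (w : H) ∈ Fᗮ
      rw [hw]
      exact (Submodule.isClosed_orthogonal F).mem_of_tendsto hx0 (Eventually.of_forall hu)
    · rw [shift_apply, hAw, hw, add_sub_cancel_right]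
  refine ⟨hker, hclosed, ?_⟩
  have : CompleteSpace (LinearMap.range (shift A (m : ℂ))) := hclosed.completeSpace_coe
  have e := Submodule.quotientEquivOfIsCompl _ _
    (Submodule.isCompl_orthogonal (LinearMap.range (shift A (m : ℂ))))
  have hle : (LinearMap.range (shift A (m : ℂ)))ᗮ ≤
      (eigenspace A (m : ℂ)).map A.domain.subtype := by
    intro y hy
    obtain ⟨w, hw, hw'⟩ := hA.eigen_of_orthogonal m (y := y)
      (fun u => (Submodule.mem_orthogonal _ _).1 hy _ (LinearMap.mem_range_self _ u))
    exact ⟨w, hw', hw⟩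
  have : FiniteDimensional ℂ (LinearMap.range (shift A (m : ℂ)))ᗮ :=
    Submodule.finiteDimensional_of_le hle
  exact Module.Finite.equiv e.symm

/-- A finite dimensional subspace of the domain which is stable under `A`. -/
def Stable (A : H →ₗ.[ℂ] H) (E : Submodule ℂ A.domain) : Prop :=
  ∀ e ∈ E, ∃ e' ∈ E, A e = (e' : H)

theorem Stable.shift {E : Submodule ℂ A.domain} (hE : Stable A E) (m : ℝ) {e : A.domain}
    (he : e ∈ E) : ∃ e' ∈ E, shift A (m : ℂ) e = ((e' : A.domain) : H) := by
  obtain ⟨e', he', h⟩ := hE e he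
  exact ⟨e' - (m : ℂ) • e, E.sub_mem he' (E.smul_mem _ he), by rw [shift_apply, h]; rfl⟩

theorem mem_orthogonal_coe {E : Submodule ℂ A.domain} {u : A.domain} :
    u ∈ Eᗮ ↔ ∀ e ∈ E, inner ℂ (e : H) (u : H) = 0 := Submodule.mem_orthogonal _ _

/-- Here `Eᗮ` is taken inside the domain with the inner product of `H`. The domain need not be
complete, but the finite dimension of `E` is enough for the splitting. -/
theorem exists_add_orthogonal (E : Submodule ℂ A.domain) [FiniteDimensional ℂ E] (u : A.domain) :
    ∃ e ∈ E, ∃ g ∈ Eᗮ, u = e + g := by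
  have : u ∈ E ⊔ Eᗮ := by rw [Submodule.sup_orthogonal_of_hasOrthogonalProjection]; trivial
  obtain ⟨e, he, g, hg, h⟩ := Submodule.mem_sup.1 this
  exact ⟨e, he, g, hg, h.symm⟩

/-- `A - m` is a bijection from `Eᗮ` onto the orthogonal complement `G` of `E` in `H`, and its
inverse is bounded by the closed graph theorem. A nonnegative symmetric operator whose inverse has
norm at most `C` is bounded below by `1 / C`. -/
theorem gap [CompleteSpace H] (hA : IsNonnegSelfAdjoint A) {E : Submodule ℂ A.domain}
    [FiniteDimensional ℂ E] (hE : Stable A E) {m : ℝ}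
    (hcl : IsClosed (LinearMap.range (shift A (m : ℂ)) : Set H))
    (hker : ∀ u ∈ Eᗮ, u ∈ eigenspace A (m : ℂ) → u = 0)
    (hlow : ∀ u ∈ Eᗮ, m * ‖(u : H)‖ ^ 2 ≤ quad A u) :
    ∃ c > 0, ∀ u ∈ Eᗮ, (m + c) * ‖(u : H)‖ ^ 2 ≤ quad A u := by
  set S := shift A (m : ℂ) with hS
  -- `S` preserves the orthogonal complement of `E`
  have horth : ∀ e ∈ E, ∀ g ∈ Eᗮ, inner ℂ (e : H) (S g) = 0 := by
    intro e he g hg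
    obtain ⟨e', he', h⟩ := hE.shift m he
    rw [hS, ← hA.inner_shift, h]
    exact mem_orthogonal_coe.1 hg e' he'
  have hsplit : ∀ y : H, (∀ e ∈ E, inner ℂ (e : H) y = 0) → ∀ u : A.domain, S u = y →
      ∃ g ∈ Eᗮ, S g = y ∧ ∃ e ∈ E, u = e + g := by
    intro y hy u hu
    obtain ⟨e, he, g, hg, rfl⟩ := exists_add_orthogonal E u
    refine ⟨g, hg, ?_, e, he, rfl⟩
    obtain ⟨e', he', h⟩ := hE.shift m he
    -- `S e` lies in `E` by stability, and equals `y - S g`, which is orthogonal to `E`.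
    have h1 : S e = 0 := by
      rw [← inner_self_eq_zero (𝕜 := ℂ)]
      have : S e = y - S g := by rw [← hu, map_add, add_sub_cancel_right]
      nth_rewrite 2 [this]
      rw [hS, h, inner_sub_right, hy e' he', horth e' he' g hg, sub_zero]
    rw [map_add, h1, zero_add] at hu
    exact hu
  let G : Submodule ℂ H := (E.map A.domain.subtype)ᗮ
  have hG : ∀ y, y ∈ G ↔ ∀ e ∈ E, inner ℂ (e : H) y = 0 := by
    intro y
    rw [Submodule.mem_orthogonal]
    constructor
    · intro h e he
      exact h _ ⟨e, he, rfl⟩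
    · rintro h _ ⟨e, he, rfl⟩
      exact h e he
  have hex : ∀ y : G, ∃ g : A.domain, g ∈ Eᗮ ∧ S g = y := by
    rintro ⟨y, hy⟩
    rw [hG] at hy
    have : CompleteSpace (LinearMap.range S) := hcl.completeSpace_coe
    have hy' : y ∈ LinearMap.range S ⊔ (LinearMap.range S)ᗮ := by
      rw [Submodule.sup_orthogonal_of_hasOrthogonalProjection]; trivial
    obtain ⟨r, hr, z, hz, hrz⟩ := Submodule.mem_sup.1 hy'
    obtain ⟨w, hw, hwe⟩ := hA.eigen_of_orthogonal m (y := z)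
      (fun u => (Submodule.mem_orthogonal _ _).1 hz _ (LinearMap.mem_range_self _ u))
    have hSw : S w = 0 := hwe
    obtain ⟨g, hg, hSg, e, he, rfl⟩ := hsplit 0 (by simp) w hSw
    have hg0 : g = 0 := hker g hg hSg
    have hz0 : z = 0 := by
      rw [← inner_self_eq_zero (𝕜 := ℂ)]
      have h1 : inner ℂ z y = 0 := by
        rw [← hw, hg0, add_zero]
        exact hy e he
      have h2 : inner ℂ z r = 0 := by
        rw [← inner_conj_symm, (Submodule.mem_orthogonal _ _).1 hz r hr, map_zero]
      rw [← hrz, inner_add_right, h2, zero_add] at h1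
      exact h1
    rw [hz0, add_zero] at hrz
    obtain ⟨u, hu⟩ := hr
    obtain ⟨g, hg, hSg, -⟩ := hsplit y hy u (hu.trans hrz)
    exact ⟨g, hg, hSg⟩
  choose T hTE hT using hex
  have huniq : ∀ g ∈ Eᗮ, ∀ g' ∈ Eᗮ, S g = S g' → g = g' := by
    intro g hg g' hg' h
    refine sub_eq_zero.1 (hker _ (Eᗮ.sub_mem hg hg') ?_)
    change S (g - g') = 0
    rw [map_sub, h, sub_self]
  let T' : G →ₗ[ℂ] H :=
    { toFun := fun y => (T y : H)
      map_add' := fun y z => by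
        rw [huniq (T (y + z)) (hTE _) (T y + T z) (Eᗮ.add_mem (hTE _) (hTE _))
          (by rw [map_add, hT, hT, hT]; rfl)]
        rfl
      map_smul' := fun c y => by
        rw [huniq (T (c • y)) (hTE _) (c • T y) (Eᗮ.smul_mem _ (hTE _))
          (by rw [map_smul, hT, hT]; rfl)]
        rfl }
  have hGc : IsClosed (G : Set H) := Submodule.isClosed_orthogonal _
  have : CompleteSpace G := hGc.completeSpace_coe
  have hcont : Continuous T' := by
    refine LinearMap.continuous_of_seq_closed_graph T' fun y x z hyx hTz => ?_
    have hx' : Tendsto (fun n => (y n : H)) atTop (𝓝 (x : H)) :=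
      (continuous_subtype_val.tendsto x).comp hyx
    have hz' : Tendsto (fun n => (T (y n) : H)) atTop (𝓝 z) := hTz
    obtain ⟨w, hw, hAw⟩ := hA.exists_of_tendsto (u := fun n => T (y n)) hz'
      (y := (x : H) + (m : ℂ) • z) ((hx'.add (hz'.const_smul (m : ℂ))).congr fun n => by
        rw [← hT (y n), hS, shift_apply, sub_add_cancel])
    have hwE : w ∈ Eᗮ := by
      have hzG : z ∈ G := hGc.mem_of_tendsto hz'
        (Eventually.of_forall fun n => (hG _).2 (mem_orthogonal_coe.1 (hTE (y n))))
      rw [mem_orthogonal_coe, hw]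
      exact (hG z).1 hzG
    have : w = T x := huniq w hwE (T x) (hTE x) (by
      rw [hT, hS, shift_apply, hAw, hw, add_sub_cancel_right])
    rw [← hw, this]
    rfl
  obtain ⟨C, hC, hTC⟩ := (⟨T', hcont⟩ : G →L[ℂ] H).bound
  refine ⟨1 / C, by positivity, fun u hu => ?_⟩
  let y : G := ⟨(u : H), (hG _).2 (mem_orthogonal_coe.1 hu)⟩
  set g := T y with hg
  have hSg : S g = (u : H) := hT y
  have hgu : (inner ℂ (u : H) (g : H)).re ≤ C * ‖(u : H)‖ ^ 2 := by
    calc (inner ℂ (u : H) (g : H)).re ≤ ‖inner ℂ (u : H) (g : H)‖ := Complex.re_le_norm _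
      _ ≤ ‖(u : H)‖ * ‖(g : H)‖ := norm_inner_le_norm _ _
      _ ≤ ‖(u : H)‖ * (C * ‖(u : H)‖) :=
          mul_le_mul_of_nonneg_left (hTC y) (norm_nonneg _)
      _ = _ := by ring
  -- With `S g = u`, nonnegativity at `u - t g` reads `0 ≤ ⟨S u, u⟩ - 2 t ‖u‖² + t² ⟨u, g⟩`, and
  -- `⟨u, g⟩ ≤ C ‖u‖²`. The choice `t = 1 / C` optimises the resulting bound and leaves `⟨S u, u⟩ ≥
  -- ‖u‖² / C`.
  have hpos := hlow (u - ((1 / C : ℝ) : ℂ) • g)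
    (Eᗮ.sub_mem hu (Eᗮ.smul_mem _ (hTE y)))
  rw [← sub_nonneg, ← quad_sub_mul] at hpos
  have hexp : (inner ℂ (shift A (m : ℂ) (u - ((1 / C : ℝ) : ℂ) • g))
      ((u - ((1 / C : ℝ) : ℂ) • g : A.domain) : H)).re =
      (quad A u - m * ‖(u : H)‖ ^ 2) - 2 * (1 / C) * ‖(u : H)‖ ^ 2 +
        (1 / C) ^ 2 * (inner ℂ (u : H) (g : H)).re := by
    have e1 : inner ℂ (shift A (m : ℂ) u) (g : H) = inner ℂ (u : H) (u : H) := by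
      rw [hA.inner_shift, ← hS, hSg]
    rw [← quad_sub_mul, map_sub, map_smul, ← hS, hSg, Submodule.coe_sub, Submodule.coe_smul,
      inner_sub_left, inner_sub_right, inner_sub_right, inner_smul_left, inner_smul_right,
      inner_smul_left, inner_smul_right, Complex.conj_ofReal, hS, e1]
    simp only [Complex.sub_re, Complex.re_ofReal_mul, re_inner_self]
    ring
  rw [hexp] at hpos
  have h3 : (1 / C) ^ 2 * (inner ℂ (u : H) (g : H)).re ≤ (1 / C) * ‖(u : H)‖ ^ 2 := by
    calc _ ≤ (1 / C) ^ 2 * (C * ‖(u : H)‖ ^ 2) := mul_le_mul_of_nonneg_left hgu (by positivity)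
      _ = _ := by field_simp
  linarith

end Abstract

/-! ### The min-max principle and the count of eigenvalues below 1 -/

section Counting

theorem finrank_biSup_eq_sum {V ι : Type*} [AddCommGroup V] [Module ℂ V] {p : ι → Submodule ℂ V}
    (hp : iSupIndep p) [∀ i, FiniteDimensional ℂ (p i)] (S : Finset ι) :
    Module.finrank ℂ (⨆ i ∈ S, p i : Submodule ℂ V) = ∑ i ∈ S, Module.finrank ℂ (p i) := by
  classical
  induction S using Finset.induction_on with
  | empty =>
    have : (⨆ i ∈ (∅ : Finset ι), p i) = ⊥ := by simp
    rw [this, finrank_bot, Finset.sum_empty]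
  | insert a s ha ih =>
    have hfd : FiniteDimensional ℂ (⨆ i ∈ s, p i : Submodule ℂ V) :=
      Submodule.finiteDimensional_finset_sup s p |> fun h => by
        rwa [Finset.sup_eq_iSup] at h
    have hd : p a ⊓ (⨆ i ∈ s, p i) = ⊥ :=
      (hp.disjoint_biSup (x := a) (y := (s : Set ι)) (by simpa using ha)).eq_bot
    have h := Submodule.finrank_sup_add_finrank_inf_eq (p a) (⨆ i ∈ s, p i)
    rw [hd, finrank_bot, add_zero] at h
    rw [Finset.iSup_insert, Finset.sum_insert ha, h, ih]

theorem finite_ne_bot_of_le {V ι : Type*} [AddCommGroup V] [Module ℂ V] {p : ι → Submodule ℂ V}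
    (hp : iSupIndep p) (E : Submodule ℂ V) [FiniteDimensional ℂ E] (hE : ∀ i, p i ≤ E) :
    {i | p i ≠ ⊥}.Finite := by
  have hex : ∀ i : {i // p i ≠ ⊥}, ∃ x : V, x ∈ p i ∧ x ≠ 0 := fun i =>
    (Submodule.ne_bot_iff _).1 i.2
  choose v hv hv0 using hex
  have hli : LinearIndependent ℂ v :=
    (hp.comp Subtype.val_injective).linearIndependent _ hv hv0
  have hli' : LinearIndependent ℂ (fun i => (⟨v i, hE i (hv i)⟩ : E)) :=
    LinearIndependent.of_comp E.subtype hli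
  have : Finite {i // p i ≠ ⊥} := hli'.finite
  exact Set.finite_coe_iff.1 this

theorem exists_ne_zero_of_finrank_lt {V W : Type*} [AddCommGroup V] [Module ℂ V] [AddCommGroup W]
    [Module ℂ W] [FiniteDimensional ℂ V] [FiniteDimensional ℂ W] (f : V →ₗ[ℂ] W)
    (h : Module.finrank ℂ W < Module.finrank ℂ V) : ∃ v ≠ 0, f v = 0 := by
  obtain ⟨v, hv, hv0⟩ := (Submodule.ne_bot_iff _).1 (LinearMap.ker_ne_bot_of_finrank_lt (f := f) h)
  exact ⟨v, hv0, hv⟩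

variable {H : Type*} [NormedAddCommGroup H] [InnerProductSpace ℂ H] {A : H →ₗ.[ℂ] H}

/-- The sum of the eigenspaces with eigenvalue less than `1`. -/
def lowSpace (A : H →ₗ.[ℂ] H) : Submodule ℂ A.domain :=
  ⨆ r : Set.Iio (1 : ℝ), eigenspace A ((r : ℝ) : ℂ)

theorem eigenspace_le_lowSpace {r : ℝ} (hr : r < 1) : eigenspace A (r : ℂ) ≤ lowSpace A :=
  le_iSup (fun r : Set.Iio (1 : ℝ) => eigenspace A ((r : ℝ) : ℂ)) ⟨r, hr⟩

theorem stable_eigenspace (r : ℝ) : Stable A (eigenspace A (r : ℂ)) := fun e he =>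
  ⟨(r : ℂ) • e, Submodule.smul_mem _ _ he, mem_eigenspace.1 he⟩

theorem Stable.sup {E E' : Submodule ℂ A.domain} (hE : Stable A E) (hE' : Stable A E') :
    Stable A (E ⊔ E') := by
  intro x hx
  obtain ⟨e, he, e', he', rfl⟩ := Submodule.mem_sup.1 hx
  obtain ⟨f, hf, h⟩ := hE e he
  obtain ⟨f', hf', h'⟩ := hE' e' he'
  exact ⟨f + f', Submodule.add_mem_sup hf hf', by rw [LinearPMap.map_add, h, h']; rfl⟩

theorem stable_lowSpace : Stable A (lowSpace A) := by
  intro e he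
  induction he using Submodule.iSup_induction' with
  | mem r x hx =>
    obtain ⟨f, hf, h⟩ := stable_eigenspace (r : ℝ) x hx
    exact ⟨f, eigenspace_le_lowSpace r.2 hf, h⟩
  | zero => exact ⟨0, Submodule.zero_mem _, LinearPMap.map_zero A⟩
  | add x y _ _ hx hy =>
    obtain ⟨f, hf, h⟩ := hx
    obtain ⟨g, hg, h'⟩ := hy
    exact ⟨f + g, Submodule.add_mem _ hf hg, by rw [LinearPMap.map_add, h, h']; rfl⟩

/-- Eigenvectors for different eigenvalues are orthogonal, so the norm and the form are diagonal in
the same decomposition. -/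
theorem IsNonnegSelfAdjoint.exists_eigen_decomposition (hA : IsNonnegSelfAdjoint A)
    {w : A.domain} (hw : w ∈ lowSpace A) :
    ∃ f : Set.Iio (1 : ℝ) →₀ A.domain, (∀ r : Set.Iio (1 : ℝ), f r ∈ eigenspace A ((r : ℝ) : ℂ)) ∧
      ‖(w : H)‖ ^ 2 = ∑ r ∈ f.support, ‖((f r : A.domain) : H)‖ ^ 2 ∧
      quad A w = ∑ r ∈ f.support, ((r : Set.Iio (1 : ℝ)) : ℝ) * ‖((f r : A.domain) : H)‖ ^ 2 := by
  obtain ⟨f, hf, hfw⟩ := (Submodule.mem_iSup_iff_exists_finsupp _ _).1 hw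
  have hV : OrthogonalFamily ℂ (fun r : Set.Iio (1 : ℝ) => eigenspace A ((r : ℝ) : ℂ))
      (fun r => (eigenspace A ((r : ℝ) : ℂ)).subtypeₗᵢ) :=
    hA.orthogonalFamily.comp Subtype.val_injective
  refine ⟨f, hf, ?_, ?_⟩
  · have := hV.norm_sum (fun r => ⟨f r, hf r⟩) f.support
    rw [← hfw]
    exact this
  · have h := hV.inner_sum (fun r => ((r : ℝ) : ℂ) • ⟨f r, hf r⟩) (fun r => ⟨f r, hf r⟩) f.support
    have hAw : A w = ((∑ r ∈ f.support, (((r : Set.Iio (1 : ℝ)) : ℝ) : ℂ) •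
        f r : A.domain) : H) := by
      rw [← hfw, Finsupp.sum]
      change A.toFun _ = _
      rw [map_sum, Submodule.coe_sum]
      exact Finset.sum_congr rfl fun r _ => mem_eigenspace.1 (hf r)
    have h' : inner ℂ (A w) (w : H) =
        ∑ r ∈ f.support, (((r : Set.Iio (1 : ℝ)) : ℝ) : ℂ) * ‖((f r : A.domain) : H)‖ ^ 2 := by
      rw [hAw, ← hfw]
      refine h.trans (Finset.sum_congr rfl fun r _ => ?_)
      have h1 : inner ℂ ((((r : ℝ) : ℂ) • f r : A.domain) : H) (f r : H) =
          ((r : ℝ) : ℂ) * ‖((f r : A.domain) : H)‖ ^ 2 := by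
        rw [Submodule.coe_smul, inner_smul_left, Complex.conj_ofReal, inner_self_eq_norm_sq_to_K]
        rfl
      exact h1
    rw [quad, h', Complex.re_sum]
    refine Finset.sum_congr rfl fun r _ => ?_
    rw [Complex.re_ofReal_mul]
    norm_cast

theorem IsNonnegSelfAdjoint.quad_lt_of_mem_lowSpace (hA : IsNonnegSelfAdjoint A)
    {w : A.domain} (hw : w ∈ lowSpace A) (h0 : w ≠ 0) : quad A w < ‖(w : H)‖ ^ 2 := by
  obtain ⟨f, hf, hn, hq⟩ := hA.exists_eigen_decomposition hw
  have hpos : 0 < ‖(w : H)‖ ^ 2 := by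
    have : (w : H) ≠ 0 := by simpa using h0
    positivity
  have hne : f.support.Nonempty := by
    rw [Finset.nonempty_iff_ne_empty]
    intro h
    rw [hn, h, Finset.sum_empty] at hpos
    exact lt_irrefl _ hpos
  rw [hn, hq]
  refine Finset.sum_lt_sum_of_nonempty hne fun r hr => ?_
  have hfr : (f r : H) ≠ 0 := by simpa using Finsupp.mem_support_iff.1 hr
  have : 0 < ‖((f r : A.domain) : H)‖ ^ 2 := by positivity
  have hr1 : (r : ℝ) < 1 := r.2
  nlinarith

/-- The form is strictly below the squared norm on `lowSpace` and at least equal to it on a space of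
finite codimension, so the two meet only in 0. -/
theorem finiteDimensional_lowSpace (hA : IsNonnegSelfAdjoint A) {F : Submodule ℂ H}
    [FiniteDimensional ℂ F] (hF : BoundedBelowOn A F) : FiniteDimensional ℂ (lowSpace A) := by
  refine finiteDimensional_of_inf_eq_bot (cofg_comap_orthogonal A.domain F) ?_
  rw [Submodule.disjoint_def]
  intro u hu hu'
  by_contra h0
  exact absurd (hF u hu) (not_le.2 (hA.quad_lt_of_mem_lowSpace hu' h0))

/-- Let `m` be the infimum of the Rayleigh quotients on the complement of `lowSpace`. If `m < 1`,
then `A - m` has closed range and no kernel on that complement, since such a kernel would lie in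
`lowSpace`. So `gap` produces a lower bound greater than the infimum. -/
theorem quad_ge_of_mem_orthogonal [CompleteSpace H] (hA : IsNonnegSelfAdjoint A)
    {F : Submodule ℂ H} [FiniteDimensional ℂ F] (hF : BoundedBelowOn A F) {u : A.domain}
    (hu : u ∈ (lowSpace A)ᗮ) : ‖(u : H)‖ ^ 2 ≤ quad A u := by
  have := finiteDimensional_lowSpace hA hF
  set R : Set ℝ := {q | ∃ u ∈ (lowSpace A)ᗮ, u ≠ 0 ∧ q = quad A u / ‖(u : H)‖ ^ 2} with hR
  have hbdd : BddBelow R := by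
    refine ⟨0, ?_⟩
    rintro q ⟨v, -, -, rfl⟩
    exact div_nonneg (hA.nonneg v) (sq_nonneg _)
  have hsq : ∀ v : A.domain, v ≠ 0 → 0 < ‖(v : H)‖ ^ 2 := fun v hv => by
    have : (v : H) ≠ 0 := by simpa using hv
    positivity
  have hle : ∀ v ∈ (lowSpace A)ᗮ, sInf R * ‖(v : H)‖ ^ 2 ≤ quad A v := by
    intro v hv
    rcases eq_or_ne v 0 with rfl | hv0
    · simp [quad]
    · exact (le_div_iff₀ (hsq v hv0)).1 (csInf_le hbdd ⟨v, hv, hv0, rfl⟩)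
  by_contra! hlt
  have hu0 : u ≠ 0 := by
    rintro rfl
    simp [quad] at hlt
  have hm : sInf R < 1 :=
    (csInf_le hbdd ⟨u, hu, hu0, rfl⟩).trans_lt ((div_lt_one (hsq u hu0)).2 hlt)
  have hker : ∀ v ∈ (lowSpace A)ᗮ, v ∈ eigenspace A ((sInf R : ℝ) : ℂ) → v = 0 := by
    intro v hv hv'
    exact inner_self_eq_zero.1 ((Submodule.mem_orthogonal _ _).1 hv v
      (eigenspace_le_lowSpace hm hv'))
  obtain ⟨c, hc, h⟩ := gap hA stable_lowSpace (isFredholmOn_shift hA hF hm).2.1 hker hle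
  have : sInf R + c ≤ sInf R := by
    refine le_csInf ⟨_, u, hu, hu0, rfl⟩ ?_
    rintro q ⟨v, hv, hv0, rfl⟩
    exact (le_div_iff₀ (hsq v hv0)).2 (h v hv)
  linarith

/-- By dimension, the span of `j` independent vectors contains a nonzero vector orthogonal to
`lowSpace`. -/
theorem rayleighQuotient_ge [CompleteSpace H] (hA : IsNonnegSelfAdjoint A)
    {F : Submodule ℂ H} [FiniteDimensional ℂ F] (hF : BoundedBelowOn A F) {j : ℕ}
    (hj : Module.finrank ℂ (lowSpace A) < j) : 1 ≤ rayleighQuotient A j := by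
  have := finiteDimensional_lowSpace hA hF
  refine le_iInf₂ fun u hu => ?_
  have : FiniteDimensional ℂ (Submodule.span ℂ (Set.range u)) :=
    FiniteDimensional.span_of_finite ℂ (Set.finite_range u)
  let f : Submodule.span ℂ (Set.range u) →ₗ[ℂ] lowSpace A :=
    ((lowSpace A).orthogonalProjectionOnto : A.domain →ₗ[ℂ] lowSpace A).domRestrict _
  obtain ⟨w, hw0, hw⟩ := exists_ne_zero_of_finrank_lt f (by
    rw [finrank_span_eq_card hu, Fintype.card_fin]; exact hj)
  have hwo : (w : A.domain) ∈ (lowSpace A)ᗮ :=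
    Submodule.orthogonalProjectionOnto_eq_zero_iff.1 hw
  have hw0' : (w : A.domain) ≠ 0 := by simpa using hw0
  refine le_trans ?_ (le_iSup_of_le (w : A.domain) (le_iSup_of_le w.2 (le_iSup_of_le hw0' le_rfl)))
  have hpos : 0 < ‖((w : A.domain) : H)‖ ^ 2 := by
    have : ((w : A.domain) : H) ≠ 0 := by simpa using hw0
    positivity
  have := (one_le_div hpos).2 (quad_ge_of_mem_orthogonal hA hF hwo)
  exact_mod_cast this

/-- The supremum in a Rayleigh quotient could turn pointwise strict inequalities into equality with
1. A bound `ρ < 1` uniform on `lowSpace` prevents this; it exists because only finitely many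
eigenvalues lie below 1. -/
theorem exists_quad_le_of_mem_lowSpace (hA : IsNonnegSelfAdjoint A)
    [FiniteDimensional ℂ (lowSpace A)] :
    ∃ ρ : ℝ, ρ < 1 ∧ ∀ w ∈ lowSpace A, quad A w ≤ ρ * ‖(w : H)‖ ^ 2 := by
  have hS : {r : Set.Iio (1 : ℝ) | eigenspace A ((r : ℝ) : ℂ) ≠ ⊥}.Finite :=
    finite_ne_bot_of_le (hA.orthogonalFamily.independent.comp
      (f := fun r : Set.Iio (1 : ℝ) => (r : ℝ)) Subtype.val_injective) (lowSpace A)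
      fun r => eigenspace_le_lowSpace r.2
  -- The point 0 only shows that the index type is inhabited, so that `M` exists even when there is
  -- no eigenvalue below 1.
  have : Nonempty (Set.Iio (1 : ℝ)) := ⟨⟨0, by simp⟩⟩
  obtain ⟨M, hM⟩ := Finset.exists_le hS.toFinset
  refine ⟨M, M.2, fun w hw => ?_⟩
  obtain ⟨f, hf, hn, hq⟩ := hA.exists_eigen_decomposition hw
  rw [hn, hq, Finset.mul_sum]
  refine Finset.sum_le_sum fun r hr => mul_le_mul_of_nonneg_right ?_ (sq_nonneg _)
  refine hM r (hS.mem_toFinset.2 ?_)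
  exact (Submodule.ne_bot_iff _).2 ⟨f r, hf r, Finsupp.mem_support_iff.1 hr⟩

theorem rayleighQuotient_lt (hA : IsNonnegSelfAdjoint A)
    [FiniteDimensional ℂ (lowSpace A)] {j : ℕ}
    (hj : j ≤ Module.finrank ℂ (lowSpace A)) : rayleighQuotient A j < 1 := by
  obtain ⟨ρ, hρ, h⟩ := exists_quad_le_of_mem_lowSpace hA
  obtain ⟨f, hf⟩ := exists_linearIndependent_of_le_finrank hj
  have hf' : LinearIndependent ℂ (fun i => (f i : A.domain)) :=
    hf.map' (lowSpace A).subtype (Submodule.ker_subtype _)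
  refine lt_of_le_of_lt (iInf₂_le_of_le _ hf' (iSup_le fun w => iSup₂_le fun hw hw0 => ?_))
    (show (ρ : EReal) < 1 by exact_mod_cast hρ)
  have hwE : w ∈ lowSpace A := by
    refine Submodule.span_le.2 ?_ hw
    rintro _ ⟨i, rfl⟩
    exact (f i).2
  have hpos : 0 < ‖(w : H)‖ ^ 2 := by
    have : (w : H) ≠ 0 := by simpa using hw0
    positivity
  exact EReal.coe_le_coe_iff.2 ((div_le_iff₀ hpos).2 (h w hwE))

theorem countBelow_eq_finrank [CompleteSpace H] (hA : IsNonnegSelfAdjoint A)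
    {F : Submodule ℂ H} [FiniteDimensional ℂ F] (hF : BoundedBelowOn A F) :
    countBelow A 1 = Module.finrank ℂ (lowSpace A) := by
  have := finiteDimensional_lowSpace hA hF
  refine le_antisymm (iSup₂_le fun j hj => ?_) ?_
  · by_contra! hlt
    have h1 := rayleighQuotient_ge hA hF (j := j) (by exact_mod_cast hlt)
    exact absurd hj.2 (not_lt.2 (by simpa using h1))
  · rcases Nat.eq_zero_or_pos (Module.finrank ℂ (lowSpace A)) with h0 | h0
    · rw [h0]
      exact bot_le
    · exact le_iSup₂_of_le (Module.finrank ℂ (lowSpace A))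
        ⟨h0, by simpa using rayleighQuotient_lt hA le_rfl⟩ le_rfl

/-- If `A - 1` were Fredholm, `gap` applied to `lowSpace` plus the eigenspace of 1, a finite
dimensional space `E`, would give `A ≥ 1 + c` on its complement. Among `dim E + 1` orthogonal
vectors with quotients below `1 + c`, some nonzero combination is orthogonal to `E`; its quotient is
still below `1 + c`, because the vectors are orthogonal for the form as well. -/
theorem one_mem_essentialSpectrum [CompleteSpace H] (hA : IsNonnegSelfAdjoint A)
    {F : Submodule ℂ H} [FiniteDimensional ℂ F] (hF : BoundedBelowOn A F)
    (high : ∀ c > 1, ∀ N : ℕ, ∃ u : Fin N → A.domain,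
      (∀ i j, i ≠ j → inner ℂ (u i : H) (u j : H) = 0 ∧ inner ℂ (A (u i)) (u j : H) = 0) ∧
      ∀ i, quad A (u i) < c * ‖(u i : H)‖ ^ 2) :
    (1 : ℝ) ∈ essentialSpectrum A := by
  intro hfred
  have := finiteDimensional_lowSpace hA hF
  have : FiniteDimensional ℂ (eigenspace A ((1 : ℝ) : ℂ)) := hfred.1
  set E := lowSpace A ⊔ eigenspace A ((1 : ℝ) : ℂ) with hE
  obtain ⟨c, hc, h⟩ := gap hA (E := E) (stable_lowSpace.sup (stable_eigenspace 1)) hfred.2.1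
    (fun u hu hu' => inner_self_eq_zero.1
      ((Submodule.mem_orthogonal _ _).1 hu u ((le_sup_right : _ ≤ E) hu')))
    (fun u hu => by
      rw [one_mul]
      exact quad_ge_of_mem_orthogonal hA hF (Submodule.orthogonal_le le_sup_left hu))
  obtain ⟨u, hu, hq⟩ := high (1 + c) (by linarith) (Module.finrank ℂ E + 1)
  let f : (Fin (Module.finrank ℂ E + 1) → ℂ) →ₗ[ℂ] E :=
    (E.orthogonalProjectionOnto : A.domain →ₗ[ℂ] E) ∘ₗ Fintype.linearCombination ℂ u
  obtain ⟨a, ha0, ha⟩ := exists_ne_zero_of_finrank_lt f (by simp)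
  have hmem : (∑ i, a i • u i) ∈ Eᗮ :=
    Submodule.orthogonalProjectionOnto_eq_zero_iff.1
      (by simpa [f, Fintype.linearCombination_apply] using ha)
  have hle := h _ hmem
  have hn : ‖((∑ i, a i • u i : A.domain) : H)‖ ^ 2 = ∑ i, ‖a i‖ ^ 2 * ‖(u i : H)‖ ^ 2 := by
    rw [← re_inner_self, Submodule.coe_sum, sum_inner, Complex.re_sum]
    refine Finset.sum_congr rfl fun i _ => ?_
    rw [inner_sum, Finset.sum_eq_single i]
    · rw [re_inner_self, Submodule.coe_smul, norm_smul, mul_pow]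
    · intro j _ hj
      rw [Submodule.coe_smul, Submodule.coe_smul, inner_smul_left, inner_smul_right,
        (hu i j hj.symm).1, mul_zero, mul_zero]
    · simp
  have hquad : quad A (∑ i, a i • u i) = ∑ i, ‖a i‖ ^ 2 * quad A (u i) := by
    have hAs : A (∑ i, a i • u i) = ∑ i, a i • A (u i) := by
      change A.toFun _ = _
      rw [map_sum]
      exact Finset.sum_congr rfl fun i _ => LinearPMap.map_smul A _ _
    rw [quad, hAs, Submodule.coe_sum, sum_inner, Complex.re_sum]
    refine Finset.sum_congr rfl fun i _ => ?_
    rw [inner_sum, Finset.sum_eq_single i]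
    · rw [Submodule.coe_smul, inner_smul_left, inner_smul_right, ← mul_assoc,
        Complex.conj_mul', quad]
      norm_cast
      rw [Complex.re_ofReal_mul]
    · intro j _ hj
      rw [Submodule.coe_smul, inner_smul_left, inner_smul_right,
        (hu i j hj.symm).2, mul_zero, mul_zero]
    · simp
  have hlt : quad A (∑ i, a i • u i) < (1 + c) * ‖((∑ i, a i • u i : A.domain) : H)‖ ^ 2 := by
    rw [hquad, hn, Finset.mul_sum]
    obtain ⟨i, hi⟩ := Function.ne_iff.1 ha0
    refine Finset.sum_lt_sum (fun i _ => ?_) ⟨i, Finset.mem_univ _, ?_⟩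
    · have := mul_le_mul_of_nonneg_left (hq i).le (sq_nonneg ‖a i‖)
      linarith
    · have h2 : 0 < ‖a i‖ ^ 2 := by
        have : a i ≠ 0 := hi
        positivity
      have := mul_lt_mul_of_pos_left (hq i) h2
      linarith
  linarith

/-- This isolates what the geometry must supply: `hF` bounds the count, `high` puts 1 in the
essential spectrum, and `trial` makes `lowSpace` nonzero, since otherwise `A ≥ 1` on the whole
domain. -/
theorem spectral_conclusion [CompleteSpace H] (hA : IsNonnegSelfAdjoint A)
    {F : Submodule ℂ H} [FiniteDimensional ℂ F] (hF : BoundedBelowOn A F)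
    (high : ∀ c > 1, ∀ N : ℕ, ∃ u : Fin N → A.domain,
      (∀ i j, i ≠ j → inner ℂ (u i : H) (u j : H) = 0 ∧ inner ℂ (A (u i)) (u j : H) = 0) ∧
      ∀ i, quad A (u i) < c * ‖(u i : H)‖ ^ 2)
    (trial : ∃ u : A.domain, quad A u < ‖(u : H)‖ ^ 2) :
    (0 < countBelow A 1 ∧ countBelow A 1 < ⊤) ∧
    (eigenvaluesBelowEss A).Finite ∧
    (eigenvaluesBelowEss A).Nonempty ∧
    eigenvaluesBelowEss A = {r : ℝ | eigenspace A (r : ℂ) ≠ ⊥ ∧ r < 1} ∧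
    (∀ r ∈ eigenvaluesBelowEss A, FiniteDimensional ℂ (eigenspace A (r : ℂ))) ∧
    countBelow A 1 =
      ((∑ᶠ r ∈ eigenvaluesBelowEss A, Module.finrank ℂ (eigenspace A (r : ℂ)) : ℕ) : ℕ∞) := by
  have hfd := finiteDimensional_lowSpace hA hF
  have hess := one_mem_essentialSpectrum hA hF high
  have hset : eigenvaluesBelowEss A = {r : ℝ | eigenspace A (r : ℂ) ≠ ⊥ ∧ r < 1} := by
    ext r
    refine ⟨fun h => ⟨h.1, h.2 1 hess⟩, fun h => ⟨h.1, fun μ hμ => ?_⟩⟩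
    by_contra! hle
    exact hμ (isFredholmOn_shift hA hF (hle.trans_lt h.2))
  have hind : iSupIndep (fun r : Set.Iio (1 : ℝ) => eigenspace A ((r : ℝ) : ℂ)) :=
    hA.orthogonalFamily.independent.comp (f := fun r : Set.Iio (1 : ℝ) => (r : ℝ))
      Subtype.val_injective
  have hle : ∀ r : Set.Iio (1 : ℝ), eigenspace A ((r : ℝ) : ℂ) ≤ lowSpace A :=
    fun r => eigenspace_le_lowSpace r.2
  have hfdr : ∀ r : Set.Iio (1 : ℝ), FiniteDimensional ℂ (eigenspace A ((r : ℝ) : ℂ)) :=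
    fun r => Submodule.finiteDimensional_of_le (hle r)
  have hS := finite_ne_bot_of_le hind (lowSpace A) hle
  have himage : eigenvaluesBelowEss A =
      (fun r : Set.Iio (1 : ℝ) => (r : ℝ)) '' {r | eigenspace A ((r : ℝ) : ℂ) ≠ ⊥} := by
    rw [hset]
    ext r
    exact ⟨fun h => ⟨⟨r, h.2⟩, h.1, rfl⟩, by rintro ⟨s, hs, rfl⟩; exact ⟨hs, s.2⟩⟩
  have hfin : (eigenvaluesBelowEss A).Finite := by
    rw [himage]
    exact hS.image _
  have hpos : 0 < Module.finrank ℂ (lowSpace A) := by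
    rw [Module.finrank_pos_iff_exists_ne_zero]
    by_contra! h0
    obtain ⟨u, hu⟩ := trial
    have hbot : lowSpace A = ⊥ :=
      (Submodule.eq_bot_iff _).2 fun x hx => by simpa using h0 ⟨x, hx⟩
    have := quad_ge_of_mem_orthogonal hA hF (u := u)
      (by rw [hbot, Submodule.bot_orthogonal_eq_top]; trivial)
    linarith
  have hsum : Module.finrank ℂ (lowSpace A) =
      ∑ᶠ r ∈ eigenvaluesBelowEss A, Module.finrank ℂ (eigenspace A (r : ℂ)) := by
    have h1 : lowSpace A = ⨆ r ∈ hS.toFinset, eigenspace A ((r : ℝ) : ℂ) := by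
      refine le_antisymm (iSup_le fun r => ?_) (iSup₂_le fun r _ => hle r)
      rcases eq_or_ne (eigenspace A ((r : ℝ) : ℂ)) ⊥ with h | h
      · rw [h]
        exact bot_le
      · exact le_iSup₂_of_le r (hS.mem_toFinset.2 h) le_rfl
    rw [himage, finsum_mem_image Subtype.val_injective.injOn,
      finsum_mem_eq_finite_toFinset_sum _ hS, ← finrank_biSup_eq_sum hind, ← h1]
  refine ⟨?_, hfin, ?_, hset, ?_, ?_⟩
  · rw [countBelow_eq_finrank hA hF]
    exact ⟨by exact_mod_cast hpos, ENat.natCast_lt_top _⟩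
  · by_contra h
    rw [Set.not_nonempty_iff_eq_empty] at h
    rw [hsum, h, finsum_mem_empty] at hpos
    exact lt_irrefl _ hpos
  · intro r hr
    rw [hset] at hr
    exact hfdr ⟨r, hr.2⟩
  · rw [countBelow_eq_finrank hA hF, hsum]

end Counting

/-! ### The quadratic form and self-adjointness of the Dirichlet Laplacian -/

section Form

variable {Ω : TopologicalSpace.Opens (ℝ × ℝ)} {φ ψ : ℝ × ℝ → ℂ}

/-- A test function as an element of `L²(Ω)`. -/
def IsTest.toL2 (hφ : IsTest Ω φ) : L2 Ω := (hφ.memLp 2).toLp φ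

theorem IsTest.coeFn_toL2 (hφ : IsTest Ω φ) :
    hφ.toL2 =ᵐ[(volume : Measure (ℝ × ℝ)).restrict (Ω : Set (ℝ × ℝ))] φ :=
  MemLp.coeFn_toLp _

theorem tendstoL2_iff {φ : ℕ → ℝ × ℝ → ℂ} (hφ : ∀ n, IsTest Ω (φ n)) (u : L2 Ω) :
    TendstoL2 φ u ↔ Tendsto (fun n => (hφ n).toL2) atTop (𝓝 u) := by
  rw [Lp.tendsto_Lp_iff_tendsto_eLpNorm', TendstoL2]
  refine tendsto_congr fun n => eLpNorm_congr_ae ?_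
  filter_upwards [(hφ n).coeFn_toL2] with x hx
  simp [hx]

/-- The complex conjugate of a test function. -/
theorem IsTest.conj (hφ : IsTest Ω φ) : IsTest Ω (fun x => (starRingEnd ℂ) (φ x)) where
  smooth := Complex.conjCLE.contDiff.comp hφ.smooth
  compact := hφ.compact.comp_left (g := fun z : ℂ => (starRingEnd ℂ) z) (map_zero _)
  support := (tsupport_comp_subset (g := fun z : ℂ => (starRingEnd ℂ) z) (map_zero _) φ).trans
    hφ.support

theorem dirDeriv_conj (hφ : IsTest Ω φ) (v : ℝ × ℝ) :
    dirDeriv v (fun x => (starRingEnd ℂ) (φ x)) = fun x => (starRingEnd ℂ) (dirDeriv v φ x) := by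
  funext x
  have h := (Complex.conjCLE.toContinuousLinearMap.hasFDerivAt (x := φ x)).comp x
    (hφ.smooth.differentiable (by simp) x).hasFDerivAt
  have h' : HasFDerivAt (fun x => (starRingEnd ℂ) (φ x))
    (Complex.conjCLE.toContinuousLinearMap.comp (fderiv ℝ φ x)) x := h
  rw [dirDeriv, h'.fderiv]
  rfl

theorem laplacian_conj (hφ : IsTest Ω φ) :
    laplacian (fun x => (starRingEnd ℂ) (φ x)) = fun x => (starRingEnd ℂ) (laplacian φ x) := by
  funext x
  simp only [laplacian, dirDeriv_conj hφ, dirDeriv_conj (hφ.dirDeriv _), map_add]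

theorem integral_mul_eq_inner (hφ : IsTest Ω φ) (u : L2 Ω) :
    ∫ x in (Ω : Set (ℝ × ℝ)), u x * (starRingEnd ℂ) (φ x) = inner ℂ hφ.toL2 u := by
  rw [L2.inner_def]
  refine integral_congr_ae ?_
  filter_upwards [hφ.coeFn_toL2] with x hx
  rw [hx, RCLike.inner_apply]

/-- Weak derivatives are defined with a bilinear pairing; conjugating the test functions turns it
into the inner product of `L²`. -/
theorem hasWeakDeriv_iff {v : ℝ × ℝ} {u g : L2 Ω} :
    HasWeakDeriv v u g ↔ ∀ φ, ∀ hφ : IsTest Ω φ,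
      inner ℂ (hφ.dirDeriv v).toL2 u = -inner ℂ hφ.toL2 g := by
  constructor
  · intro h φ hφ
    have := h _ hφ.conj
    rw [dirDeriv_conj hφ, integral_mul_eq_inner (hφ.dirDeriv v), integral_mul_eq_inner hφ] at this
    exact this
  · intro h φ hφ
    have := h _ hφ.conj
    rw [← integral_mul_eq_inner, ← integral_mul_eq_inner, dirDeriv_conj hφ] at this
    simpa using this

theorem hasWeakLaplacian_iff {u f : L2 Ω} :
    HasWeakLaplacian u f ↔ ∀ φ, ∀ hφ : IsTest Ω φ,
      inner ℂ hφ.laplacian.toL2 u = inner ℂ hφ.toL2 f := by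
  constructor
  · intro h φ hφ
    have := h _ hφ.conj
    rw [laplacian_conj hφ, integral_mul_eq_inner hφ.laplacian, integral_mul_eq_inner hφ] at this
    exact this
  · intro h φ hφ
    have := h _ hφ.conj
    rw [← integral_mul_eq_inner, ← integral_mul_eq_inner, laplacian_conj hφ] at this
    simpa using this

theorem IsTest.toL2_laplacian (hφ : IsTest Ω φ) :
    hφ.laplacian.toL2 = ((hφ.dirDeriv (1, 0)).dirDeriv (1, 0)).toL2 +
      ((hφ.dirDeriv (0, 1)).dirDeriv (0, 1)).toL2 :=
  MemLp.toLp_add _ _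

theorem IsTest.eq_zero_of_notMem (hφ : IsTest Ω φ) {x : ℝ × ℝ} (hx : x ∉ (Ω : Set (ℝ × ℝ))) :
    φ x = 0 := image_eq_zero_of_notMem_tsupport fun h => hx (hφ.support h)

theorem IsTest.integrable_mul_test (hφ : IsTest Ω φ) (hψ : IsTest Ω ψ) :
    Integrable (fun x => φ x * ψ x) :=
  (hφ.smooth.continuous.mul hψ.smooth.continuous).integrable_of_hasCompactSupport
    hφ.compact.mul_right

theorem IsTest.inner_dirDeriv (hφ : IsTest Ω φ) (hψ : IsTest Ω ψ) (v : ℝ × ℝ) :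
    inner ℂ (hψ.dirDeriv v).toL2 hφ.toL2 = -inner ℂ hψ.toL2 (hφ.dirDeriv v).toL2 := by
  have key : ∀ {a b : ℝ × ℝ → ℂ} (ha : IsTest Ω a) (hb : IsTest Ω b),
      inner ℂ hb.toL2 ha.toL2 = ∫ x, a x * (starRingEnd ℂ) (b x) := by
    intro a b ha hb
    rw [← integral_mul_eq_inner hb, ← setIntegral_eq_integral_of_forall_compl_eq_zero
      (s := (Ω : Set (ℝ × ℝ))) (f := fun x => a x * (starRingEnd ℂ) (b x))
      (fun x hx => by rw [ha.eq_zero_of_notMem hx, zero_mul])]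
    refine integral_congr_ae ?_
    filter_upwards [ha.coeFn_toL2] with x hx
    rw [hx]
  rw [key hφ (hψ.dirDeriv v), key (hφ.dirDeriv v) hψ]
  have hd : ∀ x, (starRingEnd ℂ) (Waveguide.dirDeriv v ψ x) =
      fderiv ℝ (fun x => (starRingEnd ℂ) (ψ x)) x v := fun x =>
    (congrFun (dirDeriv_conj hψ v) x).symm
  simp only [hd]
  exact integral_mul_fderiv_eq_neg_fderiv_mul_of_integrable
    ((hφ.dirDeriv v).integrable_mul_test hψ.conj) (hφ.integrable_mul_test (hψ.conj.dirDeriv v))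
    (hφ.integrable_mul_test hψ.conj)
    (fun x _ => hφ.smooth.differentiable (by simp) x)
    (fun x _ => hψ.conj.smooth.differentiable (by simp) x)

/-- `(g₁, g₂)` is the gradient of the element `u` of `H¹₀(Ω)`. -/
def IsGrad (u g₁ g₂ : L2 Ω) : Prop :=
  ∃ φ : ℕ → ℝ × ℝ → ℂ, ∃ hφ : ∀ n, IsTest Ω (φ n),
    Tendsto (fun n => (hφ n).toL2) atTop (𝓝 u) ∧
    Tendsto (fun n => ((hφ n).dirDeriv (1, 0)).toL2) atTop (𝓝 g₁) ∧
    Tendsto (fun n => ((hφ n).dirDeriv (0, 1)).toL2) atTop (𝓝 g₂)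

theorem hasWeakDeriv_of_tendsto {v : ℝ × ℝ} {u g : L2 Ω} {φ : ℕ → ℝ × ℝ → ℂ}
    (hφ : ∀ n, IsTest Ω (φ n)) (hu : Tendsto (fun n => (hφ n).toL2) atTop (𝓝 u))
    (hg : Tendsto (fun n => ((hφ n).dirDeriv v).toL2) atTop (𝓝 g)) : HasWeakDeriv v u g := by
  rw [hasWeakDeriv_iff]
  intro ψ hψ
  refine tendsto_nhds_unique (tendsto_const_nhds.inner hu) ?_
  refine (tendsto_const_nhds.inner hg).neg.congr fun n => ?_
  rw [(hφ n).inner_dirDeriv hψ]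

theorem IsGrad.hasWeakDeriv {u g₁ g₂ : L2 Ω} (h : IsGrad u g₁ g₂) :
    HasWeakDeriv (1, 0) u g₁ ∧ HasWeakDeriv (0, 1) u g₂ := by
  obtain ⟨φ, hφ, h0, h1, h2⟩ := h
  exact ⟨hasWeakDeriv_of_tendsto hφ h0 h1, hasWeakDeriv_of_tendsto hφ h0 h2⟩

/-- Limits of the derivatives of test functions are automatically weak derivatives of the limit, so
the approximating sequence carries all the information. -/
theorem memH10_iff {u : L2 Ω} : MemH10 u ↔ ∃ g₁ g₂, IsGrad u g₁ g₂ := by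
  constructor
  · rintro ⟨g₁, g₂, -, -, φ, hφ, h0, h1, h2⟩
    exact ⟨g₁, g₂, φ, hφ, (tendstoL2_iff hφ _).1 h0,
      (tendstoL2_iff (fun n => (hφ n).dirDeriv _) _).1 h1,
      (tendstoL2_iff (fun n => (hφ n).dirDeriv _) _).1 h2⟩
  · rintro ⟨g₁, g₂, h⟩
    obtain ⟨φ, hφ, h0, h1, h2⟩ := id h
    exact ⟨g₁, g₂, h.hasWeakDeriv.1, h.hasWeakDeriv.2, φ, hφ, (tendstoL2_iff hφ _).2 h0,
      (tendstoL2_iff (fun n => (hφ n).dirDeriv _) _).2 h1,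
      (tendstoL2_iff (fun n => (hφ n).dirDeriv _) _).2 h2⟩

theorem IsGrad.inner_laplacian {u g₁ g₂ : L2 Ω} (h : IsGrad u g₁ g₂) (hψ : IsTest Ω ψ) :
    inner ℂ hψ.laplacian.toL2 u = -(inner ℂ (hψ.dirDeriv (1, 0)).toL2 g₁ +
      inner ℂ (hψ.dirDeriv (0, 1)).toL2 g₂) := by
  rw [hψ.toL2_laplacian, inner_add_left, hasWeakDeriv_iff.1 h.hasWeakDeriv.1 _ (hψ.dirDeriv _),
    hasWeakDeriv_iff.1 h.hasWeakDeriv.2 _ (hψ.dirDeriv _)]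
  ring

theorem hasWeakLaplacian_neg (u : (dirichletLaplacian Ω).domain) :
    HasWeakLaplacian (u : L2 Ω) (-(dirichletLaplacian Ω u)) := by
  have : dirichletLaplacian Ω u = -u.2.2.choose := rfl
  rw [this, neg_neg]
  exact u.2.2.choose_spec

theorem apply_eq_of_hasWeakLaplacian {u : (dirichletLaplacian Ω).domain} {f : L2 Ω}
    (h : HasWeakLaplacian (u : L2 Ω) f) : dirichletLaplacian Ω u = -f := by
  rw [h.unique (hasWeakLaplacian_neg u), neg_neg]

/-- Green's formula: true by definition of the weak Laplacian when `v` is a test function, then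
extended to `H¹₀` by passing to the limit. -/
theorem IsGrad.inner_apply {u : (dirichletLaplacian Ω).domain} {v g₁ g₂ h₁ h₂ : L2 Ω}
    (hu : IsGrad (u : L2 Ω) g₁ g₂) (hv : IsGrad v h₁ h₂) :
    inner ℂ v (dirichletLaplacian Ω u) = inner ℂ h₁ g₁ + inner ℂ h₂ g₂ := by
  obtain ⟨φ, hφ, h0, h1, h2⟩ := hv
  refine tendsto_nhds_unique (h0.inner tendsto_const_nhds) ?_
  refine ((h1.inner tendsto_const_nhds).add (h2.inner tendsto_const_nhds)).congr fun n => ?_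
  have h3 := hasWeakLaplacian_iff.1 (hasWeakLaplacian_neg u) _ (hφ n)
  rw [hu.inner_laplacian (hφ n), inner_neg_right, neg_inj] at h3
  exact h3

theorem IsGrad.quad_eq {u : (dirichletLaplacian Ω).domain} {g₁ g₂ : L2 Ω}
    (hu : IsGrad (u : L2 Ω) g₁ g₂) :
    quad (dirichletLaplacian Ω) u = ‖g₁‖ ^ 2 + ‖g₂‖ ^ 2 := by
  rw [quad, ← inner_conj_symm, Complex.conj_re, hu.inner_apply hu, Complex.add_re, re_inner_self,
    re_inner_self]

theorem exists_isGrad (u : (dirichletLaplacian Ω).domain) :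
    ∃ g₁ g₂, IsGrad (u : L2 Ω) g₁ g₂ := memH10_iff.1 u.2.1

/-- The triples `(φ, ∂₁ φ, ∂₂ φ)`, for `φ` a test function. -/
def testGraph (Ω : TopologicalSpace.Opens (ℝ × ℝ)) :
    Submodule ℂ (PiLp 2 fun _ : Fin 3 => L2 Ω) where
  carrier := {p | ∃ φ, ∃ hφ : IsTest Ω φ, p 0 = hφ.toL2 ∧ p 1 = (hφ.dirDeriv (1, 0)).toL2 ∧
    p 2 = (hφ.dirDeriv (0, 1)).toL2}
  add_mem' := by
    rintro p q ⟨φ, hφ, h0, h1, h2⟩ ⟨ψ, hψ, k0, k1, k2⟩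
    refine ⟨_, hφ.add hψ, ?_, ?_, ?_⟩
    · rw [PiLp.add_apply, h0, k0]
      exact (MemLp.toLp_add _ _).symm
    · rw [PiLp.add_apply, h1, k1]
      refine (MemLp.toLp_add _ _).symm.trans (MemLp.toLp_congr _ _ (ae_of_all _ fun x => ?_))
      exact (congrFun (dirDeriv_add hφ hψ _) x).symm
    · rw [PiLp.add_apply, h2, k2]
      refine (MemLp.toLp_add _ _).symm.trans (MemLp.toLp_congr _ _ (ae_of_all _ fun x => ?_))
      exact (congrFun (dirDeriv_add hφ hψ _) x).symm
  zero_mem' := by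
    have h0 : ∀ v : ℝ × ℝ, dirDeriv v (fun _ => (0 : ℂ)) = fun _ => 0 := fun v => by
      funext x
      simp [dirDeriv]
    refine ⟨_, IsTest.zero, ?_, ?_, ?_⟩
    · exact (MemLp.toLp_zero _).symm
    · exact ((MemLp.toLp_congr _ _ (ae_of_all _ fun x => congrFun (h0 _) x)).trans
        (MemLp.toLp_zero MemLp.zero')).symm
    · exact ((MemLp.toLp_congr _ _ (ae_of_all _ fun x => congrFun (h0 _) x)).trans
        (MemLp.toLp_zero MemLp.zero')).symm
  smul_mem' := by
    rintro c p ⟨φ, hφ, h0, h1, h2⟩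
    refine ⟨_, hφ.const_mul c, ?_, ?_, ?_⟩
    · rw [PiLp.smul_apply, h0]
      exact (MemLp.toLp_const_smul c _).symm
    · rw [PiLp.smul_apply, h1]
      refine (MemLp.toLp_const_smul c _).symm.trans
        (MemLp.toLp_congr _ _ (ae_of_all _ fun x => ?_))
      exact (congrFun (dirDeriv_const_mul hφ c _) x).symm
    · rw [PiLp.smul_apply, h2]
      refine (MemLp.toLp_const_smul c _).symm.trans
        (MemLp.toLp_congr _ _ (ae_of_all _ fun x => ?_))
      exact (congrFun (dirDeriv_const_mul hφ c _) x).symm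

theorem isGrad_of_mem_closure {p : PiLp 2 fun _ : Fin 3 => L2 Ω}
    (hp : p ∈ (testGraph Ω).topologicalClosure) : IsGrad (p 0) (p 1) (p 2) := by
  obtain ⟨q, hq, hqp⟩ := mem_closure_iff_seq_limit.1 hp
  choose φ hφ h0 h1 h2 using hq
  have hc : ∀ i : Fin 3, Tendsto (fun n => q n i) atTop (𝓝 (p i)) := fun i =>
    ((PiLp.continuous_apply 2 (fun _ : Fin 3 => L2 Ω) i).tendsto p).comp hqp
  exact ⟨φ, hφ, (hc 0).congr h0, (hc 1).congr h1, (hc 2).congr h2⟩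

/-- The Riesz argument for `-Δu + u = f`: project `(f, 0, 0)` orthogonally onto the closure of
`testGraph Ω`. The projection is some `(u, ∂₁u, ∂₂u)`, and orthogonality of the remainder to every
`(ψ, ∂₁ψ, ∂₂ψ)` is the weak form of the equation. -/
theorem dirichletLaplacian_surj (f : L2 Ω) :
    ∃ u : (dirichletLaplacian Ω).domain, dirichletLaplacian Ω u + (u : L2 Ω) = f := by
  set V := (testGraph Ω).topologicalClosure with hV
  have : CompleteSpace V := (Submodule.isClosed_topologicalClosure _).completeSpace_coe
  let x : PiLp 2 fun _ : Fin 3 => L2 Ω := WithLp.toLp 2 ![f, 0, 0]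
  set p := V.starProjection x with hp
  have hpV : p ∈ V := V.starProjection_apply_mem x
  have hg := isGrad_of_mem_closure hpV
  have hweak : HasWeakLaplacian (p 0) (p 0 - f) := by
    rw [hasWeakLaplacian_iff]
    intro ψ hψ
    let q : PiLp 2 fun _ : Fin 3 => L2 Ω :=
      WithLp.toLp 2 ![hψ.toL2, (hψ.dirDeriv (1, 0)).toL2, (hψ.dirDeriv (0, 1)).toL2]
    have hq : q ∈ V := Submodule.le_topologicalClosure _ ⟨ψ, hψ, rfl, rfl, rfl⟩
    have h := Submodule.starProjection_inner_eq_zero (K := V) x q hq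
    rw [inner_eq_zero_symm, ← hp, PiLp.inner_apply, Fin.sum_univ_three] at h
    have h' : inner ℂ hψ.toL2 (f - p 0) + inner ℂ (hψ.dirDeriv (1, 0)).toL2 (0 - p 1) +
      inner ℂ (hψ.dirDeriv (0, 1)).toL2 (0 - p 2) = 0 := h
    rw [hg.inner_laplacian hψ]
    simp only [inner_sub_right, inner_zero_right] at h' ⊢
    linear_combination h'
  refine ⟨⟨p 0, memH10_iff.2 ⟨_, _, hg⟩, _, hweak⟩, ?_⟩
  rw [apply_eq_of_hasWeakLaplacian (u := ⟨p 0, memH10_iff.2 ⟨_, _, hg⟩, _, hweak⟩) hweak]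
  simp

theorem isNonnegSelfAdjoint_dirichletLaplacian (Ω : TopologicalSpace.Opens (ℝ × ℝ)) :
    IsNonnegSelfAdjoint (dirichletLaplacian Ω) where
  symm := fun u v => by
    obtain ⟨g₁, g₂, hu⟩ := exists_isGrad u
    obtain ⟨h₁, h₂, hv⟩ := exists_isGrad v
    rw [hv.inner_apply hu, ← inner_conj_symm, hu.inner_apply hv, map_add, inner_conj_symm,
      inner_conj_symm]
  surj := dirichletLaplacian_surj
  nonneg := fun u => by
    obtain ⟨g₁, g₂, hu⟩ := exists_isGrad u
    exact (by positivity : 0 ≤ ‖g₁‖ ^ 2 + ‖g₂‖ ^ 2).trans_eq hu.quad_eq.symm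

/-- The inequality passes to limits of test functions in `H¹`, and the finite sum vanishes for a
limit orthogonal to the `f i`. -/
theorem boundedBelowOn_of_test {ι : Type*} [Fintype ι] (f : ι → L2 Ω)
    (h : ∀ φ, ∀ hφ : IsTest Ω φ, ‖hφ.toL2‖ ^ 2 ≤ ‖(hφ.dirDeriv (1, 0)).toL2‖ ^ 2 +
      ‖(hφ.dirDeriv (0, 1)).toL2‖ ^ 2 + ∑ i, ‖inner ℂ (f i) hφ.toL2‖ ^ 2) :
    BoundedBelowOn (dirichletLaplacian Ω) (Submodule.span ℂ (Set.range f)) := by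
  intro u hu
  obtain ⟨g₁, g₂, hg⟩ := exists_isGrad u
  obtain ⟨φ, hφ, h0, h1, h2⟩ := id hg
  have hlim := le_of_tendsto_of_tendsto' (h0.norm.pow 2)
    (((h1.norm.pow 2).add (h2.norm.pow 2)).add (tendsto_finsetSum Finset.univ fun i _ =>
      ((tendsto_const_nhds (x := f i)).inner (𝕜 := ℂ) h0).norm.pow 2)) (fun n => h _ (hφ n))
  have hz : ∀ i, inner ℂ (f i) (u : L2 Ω) = 0 := fun i =>
    (Submodule.mem_orthogonal _ _).1 hu _ (Submodule.subset_span ⟨i, rfl⟩)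
  rw [hg.quad_eq]
  simpa [hz] using hlim

theorem IsTest.isGrad (hφ : IsTest Ω φ) :
    IsGrad hφ.toL2 (hφ.dirDeriv (1, 0)).toL2 (hφ.dirDeriv (0, 1)).toL2 :=
  ⟨fun _ => φ, fun _ => hφ, tendsto_const_nhds, tendsto_const_nhds, tendsto_const_nhds⟩

theorem IsTest.hasWeakLaplacian (hφ : IsTest Ω φ) :
    HasWeakLaplacian hφ.toL2 hφ.laplacian.toL2 := by
  rw [hasWeakLaplacian_iff]
  intro ψ hψ
  rw [hφ.isGrad.inner_laplacian hψ, hφ.toL2_laplacian, inner_add_right,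
    (hφ.dirDeriv _).inner_dirDeriv hψ, (hφ.dirDeriv _).inner_dirDeriv hψ]
  ring

/-- A test function as an element of the domain of the Dirichlet Laplacian. -/
def IsTest.toDomain (hφ : IsTest Ω φ) : (dirichletLaplacian Ω).domain :=
  ⟨hφ.toL2, memH10_iff.2 ⟨_, _, hφ.isGrad⟩, _, hφ.hasWeakLaplacian⟩

theorem IsTest.quad_toDomain (hφ : IsTest Ω φ) :
    quad (dirichletLaplacian Ω) hφ.toDomain =
      ‖(hφ.dirDeriv (1, 0)).toL2‖ ^ 2 + ‖(hφ.dirDeriv (0, 1)).toL2‖ ^ 2 :=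
  IsGrad.quad_eq (u := hφ.toDomain) hφ.isGrad

theorem IsTest.apply_toDomain (hφ : IsTest Ω φ) :
    dirichletLaplacian Ω hφ.toDomain = -hφ.laplacian.toL2 :=
  apply_eq_of_hasWeakLaplacian (u := hφ.toDomain) hφ.hasWeakLaplacian

theorem IsTest.inner_toL2_eq_zero (hφ : IsTest Ω φ) (hψ : IsTest Ω ψ)
    (h : ∀ x, φ x = 0 ∨ ψ x = 0) : inner ℂ hφ.toL2 hψ.toL2 = 0 := by
  rw [L2.inner_def]
  refine integral_eq_zero_of_ae ?_
  filter_upwards [hφ.coeFn_toL2, hψ.coeFn_toL2] with x hx hx'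
  rw [hx, hx']
  rcases h x with h | h <;> simp [h]

theorem IsTest.norm_toL2_sq (hφ : IsTest Ω φ) : ‖hφ.toL2‖ ^ 2 = ∫ x, ‖φ x‖ ^ 2 := by
  rw [← re_inner_self, L2.inner_def, ← setIntegral_eq_integral_of_forall_compl_eq_zero
    (s := (Ω : Set (ℝ × ℝ))) (f := fun x => ‖φ x‖ ^ 2)
    (fun x hx => by rw [hφ.eq_zero_of_notMem hx]; simp)]
  have : ∀ᵐ x ∂(volume.restrict (Ω : Set (ℝ × ℝ))),
      inner ℂ (hφ.toL2 x) (hφ.toL2 x) = ((‖φ x‖ ^ 2 : ℝ) : ℂ) := by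
    filter_upwards [hφ.coeFn_toL2] with x hx
    rw [hx, inner_self_eq_norm_sq_to_K]
    norm_cast
  rw [integral_congr_ae this, integral_complex_ofReal, Complex.ofReal_re]

end Form

/-! ### The Poincaré–Wirtinger inequality on convex sets -/

section Poincare

variable {φ : ℝ × ℝ → ℂ}

/-- The squared length of the gradient. -/
def gradSq (φ : ℝ × ℝ → ℂ) (x : ℝ × ℝ) : ℝ :=
  ‖dirDeriv (1, 0) φ x‖ ^ 2 + ‖dirDeriv (0, 1) φ x‖ ^ 2

theorem gradSq_nonneg (φ : ℝ × ℝ → ℂ) (x : ℝ × ℝ) : 0 ≤ gradSq φ x := by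
  unfold gradSq
  positivity

theorem continuous_gradSq (hφ : ContDiff ℝ 1 φ) : Continuous (gradSq φ) := by
  have h : ∀ v : ℝ × ℝ, Continuous (dirDeriv v φ) := fun v =>
    (hφ.continuous_fderiv (by simp)).clm_apply continuous_const
  exact ((h _).norm.pow 2).add ((h _).norm.pow 2)

/-- Cauchy–Schwarz for the Euclidean length of `v`; the operator norm of the derivative is avoided
because it refers to the maximum norm of `ℝ × ℝ`. -/
theorem norm_sq_fderiv_le (φ : ℝ × ℝ → ℂ) (x v : ℝ × ℝ) :
    ‖fderiv ℝ φ x v‖ ^ 2 ≤ (v.1 ^ 2 + v.2 ^ 2) * gradSq φ x := by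
  have hv : v = v.1 • ((1, 0) : ℝ × ℝ) + v.2 • ((0, 1) : ℝ × ℝ) := by ext <;> simp
  have h1 : ‖fderiv ℝ φ x v‖ ≤ |v.1| * ‖dirDeriv (1, 0) φ x‖ + |v.2| * ‖dirDeriv (0, 1) φ x‖ := by
    conv_lhs => rw [hv, map_add, map_smul, map_smul]
    refine (norm_add_le _ _).trans_eq ?_
    rw [norm_smul, norm_smul]
    rfl
  refine (pow_le_pow_left₀ (norm_nonneg _) h1 2).trans ?_
  unfold gradSq
  rw [← sq_abs v.1, ← sq_abs v.2]
  nlinarith [sq_nonneg (|v.1| * ‖dirDeriv (0, 1) φ x‖ - |v.2| * ‖dirDeriv (1, 0) φ x‖)]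

/-- The fundamental theorem of calculus along the segment, followed by Jensen's inequality. The form
with `ℝ≥0∞` values lets the later exchanges of integrals rest on Tonelli alone. -/
theorem norm_sq_sub_le (hφ : ContDiff ℝ 1 φ) {h : ℝ} {x y : ℝ × ℝ} (h1 : |y.1 - x.1| ≤ h)
    (h2 : |y.2 - x.2| ≤ h) :
    ENNReal.ofReal (‖φ x - φ y‖ ^ 2) ≤
      ∫⁻ τ in Set.Ioc (0 : ℝ) 1, ENNReal.ofReal (2 * h ^ 2 * gradSq φ (x + τ • (y - x))) := by
  have hline : ∀ τ : ℝ, HasDerivAt (fun τ : ℝ => x + τ • (y - x)) (y - x) τ := fun τ => by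
    simpa using ((hasDerivAt_id τ).smul_const (y - x)).const_add x
  have hd : ∀ τ : ℝ, HasDerivAt (fun τ : ℝ => φ (x + τ • (y - x)))
      (fderiv ℝ φ (x + τ • (y - x)) (y - x)) τ := fun τ =>
    (hφ.differentiable (by simp) _).hasFDerivAt.comp_hasDerivAt τ (hline τ)
  have hcl : Continuous (fun τ : ℝ => x + τ • (y - x)) := by fun_prop
  have hc : Continuous (fun τ : ℝ => fderiv ℝ φ (x + τ • (y - x)) (y - x)) :=
    ((hφ.continuous_fderiv (by simp)).comp hcl).clm_apply continuous_const
  have hI := intervalIntegral.integral_eq_sub_of_hasDerivAt (a := 0) (b := 1)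
    (fun τ _ => hd τ) (hc.intervalIntegrable _ _)
  rw [intervalIntegral.integral_of_le zero_le_one] at hI
  simp only [one_smul, zero_smul, add_zero, add_sub_cancel] at hI
  have : IsProbabilityMeasure (volume.restrict (Set.Ioc (0 : ℝ) 1)) := ⟨by simp⟩
  have hint : ∀ {E : Type} [NormedAddCommGroup E] {f : ℝ → E}, Continuous f →
      Integrable f (volume.restrict (Set.Ioc (0 : ℝ) 1)) := fun hf =>
    (hf.integrableOn_Icc (a := 0) (b := 1)).mono_set Set.Ioc_subset_Icc_self
  have hJ := ConvexOn.map_integral_le (μ := volume.restrict (Set.Ioc (0 : ℝ) 1))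
    ((convexOn_univ_norm (E := ℂ)).pow (fun _ _ => norm_nonneg _) 2)
    (by fun_prop) isClosed_univ (ae_of_all _ fun _ => Set.mem_univ _) (hint hc)
    (hint (f := (fun z : ℂ => ‖z‖ ^ 2) ∘ fun τ : ℝ => fderiv ℝ φ (x + τ • (y - x)) (y - x))
      ((continuous_norm.pow 2).comp hc))
  rw [hI] at hJ
  have hg : Continuous fun τ : ℝ => 2 * h ^ 2 * gradSq φ (x + τ • (y - x)) :=
    continuous_const.mul ((continuous_gradSq hφ).comp hcl)
  rw [← ofReal_integral_eq_lintegral_ofReal (hint hg)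
    (ae_of_all _ fun τ => mul_nonneg (by positivity) (gradSq_nonneg _ _))]
  refine ENNReal.ofReal_le_ofReal ?_
  rw [norm_sub_rev]
  refine hJ.trans (integral_mono (hint ((continuous_norm.pow 2).comp hc)) (hint hg) fun τ => ?_)
  refine (norm_sq_fderiv_le φ _ _).trans (mul_le_mul_of_nonneg_right ?_ (gradSq_nonneg _ _))
  have e1 := sq_le_sq' (abs_le.1 h1).1 (abs_le.1 h1).2
  have e2 := sq_le_sq' (abs_le.1 h2).1 (abs_le.1 h2).2
  simp only [Prod.fst_sub, Prod.snd_sub]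
  linarith

/-- The homothety of centre `x` and ratio `τ` maps the convex set `Q` into itself, with Jacobian `τ²
≥ 1 / 4`. -/
theorem lintegral_homothety_le {Q : Set (ℝ × ℝ)} (hQ : Convex ℝ Q) (hQm : MeasurableSet Q)
    (G : ℝ × ℝ → ℝ≥0∞) {x : ℝ × ℝ} (hx : x ∈ Q) {τ : ℝ} (h1 : 1 / 2 ≤ τ) (h2 : τ ≤ 1) :
    ∫⁻ y in Q, G (x + τ • (y - x)) ≤ 4 * ∫⁻ z in Q, G z := by
  have hder : ∀ y ∈ Q, HasFDerivWithinAt (fun y => x + τ • (y - x))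
      (τ • ContinuousLinearMap.id ℝ (ℝ × ℝ)) Q y := fun y _ =>
    (((hasFDerivAt_id y).sub_const x).const_smul τ |>.const_add x).hasFDerivWithinAt
  have hinj : Set.InjOn (fun y => x + τ • (y - x)) Q := fun y _ z _ h => by
    have : τ ≠ 0 := by linarith
    have h' : τ • (y - x) = τ • (z - x) := add_left_cancel h
    exact sub_left_injective (smul_right_injective _ this h')
  have hdet : (τ • ContinuousLinearMap.id ℝ (ℝ × ℝ)).det = τ ^ 2 := by
    rw [ContinuousLinearMap.det, ContinuousLinearMap.toLinearMap_smul, LinearMap.det_smul]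
    simp
  have himg := lintegral_image_eq_lintegral_abs_det_fderiv_mul volume hQm hder hinj G
  have hsub : (fun y => x + τ • (y - x)) '' Q ⊆ Q := by
    rintro _ ⟨y, hy, rfl⟩
    exact hQ.add_smul_sub_mem hx hy ⟨by linarith, h2⟩
  have h4 : (1 : ℝ≥0∞) ≤ 4 * ENNReal.ofReal |τ ^ 2| := by
    rw [show (4 : ℝ≥0∞) = ENNReal.ofReal 4 by simp, ← ENNReal.ofReal_mul (by norm_num),
      ← ENNReal.ofReal_one]
    refine ENNReal.ofReal_le_ofReal ?_
    rw [abs_of_nonneg (sq_nonneg _)]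
    nlinarith
  calc ∫⁻ y in Q, G (x + τ • (y - x))
      ≤ ∫⁻ y in Q, 4 * (ENNReal.ofReal |τ ^ 2| * G (x + τ • (y - x))) := by
        refine lintegral_mono fun y => ?_
        rw [← mul_assoc]
        exact le_mul_of_one_le_left bot_le h4
    _ = 4 * ∫⁻ z in (fun y => x + τ • (y - x)) '' Q, G z := by
        rw [lintegral_const_mul' _ _ (by simp), himg, hdet]
    _ ≤ 4 * ∫⁻ z in Q, G z := by gcongr

/-- The homothety bound degenerates as `τ` tends to 0. Exchanging the roles of `x` and `y` replaces
`τ` by `1 - τ`, so one of the two ratios is always at least `1 / 2`. -/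
theorem lintegral_segment_le {Q : Set (ℝ × ℝ)} (hQ : Convex ℝ Q) (hQm : MeasurableSet Q)
    {G : ℝ × ℝ → ℝ≥0∞} (hG : Measurable G) {τ : ℝ} (h0 : 0 ≤ τ) (h1 : τ ≤ 1) :
    ∫⁻ x in Q, ∫⁻ y in Q, G (x + τ • (y - x)) ≤ 4 * volume Q * ∫⁻ z in Q, G z := by
  have key : ∀ τ : ℝ, 1 / 2 ≤ τ → τ ≤ 1 →
      ∫⁻ x in Q, ∫⁻ y in Q, G (x + τ • (y - x)) ≤ 4 * volume Q * ∫⁻ z in Q, G z := by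
    intro τ h0 h1
    calc ∫⁻ x in Q, ∫⁻ y in Q, G (x + τ • (y - x))
        ≤ ∫⁻ _ in Q, 4 * ∫⁻ z in Q, G z :=
          setLIntegral_mono measurable_const fun x hx => lintegral_homothety_le hQ hQm G hx h0 h1
      _ = 4 * volume Q * ∫⁻ z in Q, G z := by
          rw [setLIntegral_const]
          ring
  rcases le_total (1 / 2) τ with h | h
  · exact key τ h h1
  · rw [lintegral_lintegral_swap]
    · have : ∀ x y : ℝ × ℝ, y + τ • (x - y) = x + (1 - τ) • (y - x) := fun x y => by
        module
      simp only [this]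
      exact key (1 - τ) (by linarith) (by linarith)
    · exact (hG.comp (by fun_prop)).aemeasurable

theorem lintegral_sub_sq_le (hφ : ContDiff ℝ 1 φ) {Q : Set (ℝ × ℝ)} (hQ : Convex ℝ Q)
    (hQm : MeasurableSet Q) {h : ℝ}
    (hd : ∀ x ∈ Q, ∀ y ∈ Q, |y.1 - x.1| ≤ h ∧ |y.2 - x.2| ≤ h) :
    ∫⁻ x in Q, ∫⁻ y in Q, ENNReal.ofReal (‖φ x - φ y‖ ^ 2) ≤
      4 * volume Q * ∫⁻ z in Q, ENNReal.ofReal (2 * h ^ 2 * gradSq φ z) := by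
  set G : ℝ × ℝ → ℝ≥0∞ := fun z => ENNReal.ofReal (2 * h ^ 2 * gradSq φ z) with hGdef
  have hG : Measurable G :=
    (continuous_const.mul (continuous_gradSq hφ)).measurable.ennreal_ofReal
  have hm : Measurable fun p : ((ℝ × ℝ) × ℝ) × (ℝ × ℝ) => G (p.1.1 + p.1.2 • (p.2 - p.1.1)) :=
    hG.comp (by fun_prop)
  calc ∫⁻ x in Q, ∫⁻ y in Q, ENNReal.ofReal (‖φ x - φ y‖ ^ 2)
      ≤ ∫⁻ x in Q, ∫⁻ y in Q, ∫⁻ τ in Set.Ioc (0 : ℝ) 1, G (x + τ • (y - x)) :=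
        lintegral_mono_ae ((ae_restrict_iff' hQm).2 (ae_of_all _ fun x hx =>
          lintegral_mono_ae ((ae_restrict_iff' hQm).2 (ae_of_all _ fun y hy =>
            norm_sq_sub_le hφ (hd x hx y hy).1 (hd x hx y hy).2))))
    _ = ∫⁻ x in Q, ∫⁻ τ in Set.Ioc (0 : ℝ) 1, ∫⁻ y in Q, G (x + τ • (y - x)) := by
        refine lintegral_congr fun x => lintegral_lintegral_swap ?_
        exact (hG.comp (by fun_prop)).aemeasurable
    _ = ∫⁻ τ in Set.Ioc (0 : ℝ) 1, ∫⁻ x in Q, ∫⁻ y in Q, G (x + τ • (y - x)) := by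
        refine lintegral_lintegral_swap ?_
        exact hm.lintegral_prod_right'.aemeasurable
    _ ≤ ∫⁻ _ in Set.Ioc (0 : ℝ) 1, 4 * volume Q * ∫⁻ z in Q, G z :=
        setLIntegral_mono measurable_const fun τ hτ =>
          lintegral_segment_le hQ hQm hG hτ.1.le hτ.2
    _ = 4 * volume Q * ∫⁻ z in Q, G z := by simp

theorem integral_integral_norm_sub_sq {α : Type*} [MeasurableSpace α] (μ : Measure α)
    [IsFiniteMeasure μ] {f : α → ℂ} (hf : MemLp f 2 μ) :
    ∫ x, ∫ y, ‖f x - f y‖ ^ 2 ∂μ ∂μ =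
      2 * (μ.real Set.univ * ∫ x, ‖f x‖ ^ 2 ∂μ - ‖∫ x, f x ∂μ‖ ^ 2) := by
  have h1 : Integrable f μ := hf.integrable (by norm_num)
  have h2 : Integrable (fun x => ‖f x‖ ^ 2) μ := hf.integrable_norm_pow (by norm_num)
  have hin : ∀ x, ∫ y, ‖f x - f y‖ ^ 2 ∂μ = μ.real Set.univ * ‖f x‖ ^ 2 -
      2 * inner ℝ (∫ y, f y ∂μ) (f x) + ∫ y, ‖f y‖ ^ 2 ∂μ := by
    intro x
    simp only [norm_sub_sq_real]
    have h3 : Integrable (fun y => 2 * inner ℝ (f x) (f y)) μ :=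
      (h1.const_inner (𝕜 := ℝ) (f x)).const_mul 2
    have h4 : Integrable (fun y => ‖f x‖ ^ 2 - 2 * inner ℝ (f x) (f y)) μ :=
      (integrable_const _).sub h3
    rw [integral_add h4 h2, integral_sub (integrable_const _) h3, integral_const,
      integral_const_mul, integral_inner h1, real_inner_comm, smul_eq_mul]
  simp only [hin]
  have h3 : Integrable (fun x => 2 * inner ℝ (∫ y, f y ∂μ) (f x)) μ :=
    (h1.const_inner (𝕜 := ℝ) _).const_mul 2
  have h4 : Integrable
      (fun x => μ.real Set.univ * ‖f x‖ ^ 2 - 2 * inner ℝ (∫ y, f y ∂μ) (f x)) μ :=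
    (h2.const_mul _).sub h3
  rw [integral_add h4 (integrable_const _), integral_sub (h2.const_mul _) h3,
    integral_const, integral_const_mul, integral_const_mul, integral_inner h1,
    real_inner_self_eq_norm_sq, smul_eq_mul]
  ring

/-- The Poincaré–Wirtinger inequality on a small convex set. -/
theorem poincare_convex (hφ : ContDiff ℝ 1 φ) (hc : HasCompactSupport φ) {Q : Set (ℝ × ℝ)}
    (hQ : Convex ℝ Q) (hQm : MeasurableSet Q) (hfin : volume Q ≠ ⊤)
    (hd : ∀ x ∈ Q, ∀ y ∈ Q, |y.1 - x.1| ≤ 1 / 2 ∧ |y.2 - x.2| ≤ 1 / 2) :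
    ∫ x in Q, ‖φ x‖ ^ 2 ≤ (∫ x in Q, gradSq φ x) +
      (volume.real Q)⁻¹ * ‖∫ x in Q, φ x‖ ^ 2 := by
  have : IsFiniteMeasure (volume.restrict Q) := ⟨by simpa using hfin.lt_top⟩
  have hgi : Integrable (gradSq φ) (volume.restrict Q) := by
    refine ((continuous_gradSq hφ).integrable_of_hasCompactSupport ?_).restrict
    have h : ∀ v : ℝ × ℝ, HasCompactSupport (dirDeriv v φ) := fun v => hc.fderiv_apply ℝ v
    exact ((h _).comp_left (g := fun z : ℂ => ‖z‖ ^ 2) (by simp)).add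
      ((h _).comp_left (g := fun z : ℂ => ‖z‖ ^ 2) (by simp))
  rcases eq_or_ne (volume Q) 0 with h0 | h0
  · simp [Measure.restrict_eq_zero.2 h0]
  have hV : 0 < volume.real Q := ENNReal.toReal_pos h0 hfin
  have h1 := integral_integral_norm_sub_sq (volume.restrict Q)
    ((hφ.continuous.memLp_of_hasCompactSupport hc (p := 2)).restrict Q)
  have h2 : ENNReal.ofReal (∫ x in Q, ∫ y in Q, ‖φ x - φ y‖ ^ 2) ≤
      ∫⁻ x in Q, ∫⁻ y in Q, ENNReal.ofReal (‖φ x - φ y‖ ^ 2) := by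
    have h3 : ∀ x, 0 ≤ ∫ y in Q, ‖φ x - φ y‖ ^ 2 := fun x =>
      integral_nonneg fun y => sq_nonneg _
    rw [← Real.enorm_of_nonneg (integral_nonneg h3)]
    refine (enorm_integral_le_lintegral_enorm _).trans (lintegral_mono fun x => ?_)
    refine (enorm_integral_le_lintegral_enorm _).trans_eq (lintegral_congr fun y => ?_)
    exact Real.enorm_of_nonneg (sq_nonneg _)
  have h3 := h2.trans (lintegral_sub_sq_le hφ hQ hQm hd)
  -- The side `1 / 2` is chosen here: `4 * (1 / 2) = 2` matches the factor 2 of the variance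
  -- identity, so the gradient term ends with constant exactly 1.
  have h4 : ∀ z, 2 * (1 / 2 : ℝ) ^ 2 * gradSq φ z = 1 / 2 * gradSq φ z := fun z => by ring
  simp only [h4] at h3
  rw [← ofReal_integral_eq_lintegral_ofReal (hgi.const_mul _)
      (ae_of_all _ fun z => mul_nonneg (by norm_num) (gradSq_nonneg _ _)), h1,
    integral_const_mul, ← ENNReal.ofReal_toReal hfin,
    show (4 : ℝ≥0∞) = ENNReal.ofReal 4 by simp, ← ENNReal.ofReal_mul (by norm_num),
    ← ENNReal.ofReal_mul (by positivity), ENNReal.ofReal_le_ofReal_iff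
      (mul_nonneg (by positivity) (mul_nonneg (by norm_num)
        (integral_nonneg fun z => gradSq_nonneg _ _)))] at h3
  have h5 : (volume.restrict Q).real Set.univ = volume.real Q := by simp [Measure.real]
  rw [h5] at h3
  change 2 * (volume.real Q * _ - _) ≤ 4 * volume.real Q * _ at h3
  have h6 : volume.real Q * ∫ x in Q, ‖φ x‖ ^ 2 ≤
      volume.real Q * ((∫ x in Q, gradSq φ x) + (volume.real Q)⁻¹ * ‖∫ x in Q, φ x‖ ^ 2) := by
    rw [mul_add, ← mul_assoc, mul_inv_cancel₀ hV.ne', one_mul]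
    linarith
  exact le_of_mul_le_mul_left h6 hV

end Poincare

/-! ### Lower bound for the energy: arms, kite and cells -/

section Guide

open Real in
/-- The one-dimensional Dirichlet–Poincaré inequality on `(0, π)`. -/
theorem wirtinger {ψ ψ' : ℝ → ℂ} (hψ : ∀ t, HasDerivAt ψ (ψ' t) t) (hψ' : Continuous ψ')
    (h0 : ψ =ᶠ[𝓝 0] 0) (hπ : ψ =ᶠ[𝓝 π] 0) :
    ∫ t in Set.Ioo 0 π, ‖ψ t‖ ^ 2 ≤ ∫ t in Set.Ioo 0 π, ‖ψ' t‖ ^ 2 := by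
  have hψc : Continuous ψ := continuous_iff_continuousAt.2 fun t => (hψ t).continuousAt
  -- The factor `cot` is the logarithmic derivative of the ground state `sin`, and `cot' = -1 -
  -- cot²`. Hence `|ψ'|² - |ψ|² - g' = |ψ' - cot · ψ|² ≥ 0`, while `g` vanishes at both ends because
  -- `ψ` does so nearby.
  set g : ℝ → ℝ := fun t => cos t / sin t * ‖ψ t‖ ^ 2 with hg
  have hend : ∀ a, ψ =ᶠ[𝓝 a] 0 → ContinuousAt g a := fun a ha => by
    have : g =ᶠ[𝓝 a] fun _ => 0 := by
      filter_upwards [ha] with t ht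
      simp [hg, ht]
    exact continuousAt_const.congr this.symm
  have hder : ∀ t ∈ Set.Ioo 0 π, HasDerivAt g ((-sin t * sin t - cos t * cos t) / sin t ^ 2 *
      ‖ψ t‖ ^ 2 + cos t / sin t * (2 * inner ℝ (ψ t) (ψ' t))) t := fun t ht =>
    ((hasDerivAt_cos t).div (hasDerivAt_sin t) (sin_pos_of_mem_Ioo ht).ne').mul (hψ t).norm_sq
  have hcont : ContinuousOn g (Set.Icc 0 π) := by
    intro t ht
    rcases eq_or_lt_of_le ht.1 with rfl | h1
    · exact (hend 0 h0).continuousWithinAt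
    rcases eq_or_lt_of_le ht.2 with rfl | h2
    · exact (hend _ hπ).continuousWithinAt
    · exact (hder t ⟨h1, h2⟩).continuousAt.continuousWithinAt
  have hi1 : IntegrableOn (fun t => ‖ψ' t‖ ^ 2) (Set.Icc 0 π) :=
    (hψ'.norm.pow 2).integrableOn_Icc
  have hi2 : IntegrableOn (fun t => ‖ψ t‖ ^ 2) (Set.Icc 0 π) :=
    (hψc.norm.pow 2).integrableOn_Icc
  have h := intervalIntegral.sub_le_integral_of_hasDeriv_right_of_le (φ := fun t =>
    ‖ψ' t‖ ^ 2 - ‖ψ t‖ ^ 2) pi_pos.le hcont (fun t ht => (hder t ht).hasDerivWithinAt)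
    (hi1.sub hi2) (fun t ht => by
      have hs := (sin_pos_of_mem_Ioo ht).ne'
      have e1 : (-sin t * sin t - cos t * cos t) / sin t ^ 2 = -1 - (cos t / sin t) ^ 2 := by
        field_simp
      have e2 := norm_sub_sq_real (ψ' t) ((cos t / sin t) • ψ t)
      rw [inner_smul_right, norm_smul, mul_pow, Real.norm_eq_abs, sq_abs,
        real_inner_comm] at e2
      rw [e1]
      nlinarith [sq_nonneg ‖ψ' t - (cos t / sin t) • ψ t‖])
  have hg0 : g 0 = 0 := by simp [hg]
  have hgπ : g π = 0 := by simp [hg]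
  rw [hg0, hgπ, sub_zero, intervalIntegral.integral_of_le pi_pos.le,
    ← integral_Icc_eq_integral_Ioc, integral_sub hi1 hi2, integral_Icc_eq_integral_Ioo,
    integral_Icc_eq_integral_Ioo] at h
  linarith

variable {θ : ℝ}

theorem cos_pos_of_mem (hθ : θ ∈ Set.Ioo 0 (Real.pi / 2)) : 0 < Real.cos θ :=
  Real.cos_pos_of_mem_Ioo ⟨by linarith [hθ.1, Real.pi_pos], hθ.2⟩

theorem sin_pos_of_mem (hθ : θ ∈ Set.Ioo 0 (Real.pi / 2)) : 0 < Real.sin θ :=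
  Real.sin_pos_of_mem_Ioo ⟨hθ.1, by linarith [hθ.2, Real.pi_pos]⟩

/-- The distance to the inner boundary line, in the arms. -/
def transverse (θ : ℝ) (x : ℝ × ℝ) : ℝ := |x.2| * Real.cos θ - x.1 * Real.sin θ

theorem mem_brokenGuide_iff (hθ : θ ∈ Set.Ioo 0 (Real.pi / 2)) {x : ℝ × ℝ} :
    x ∈ (brokenGuide θ : Set (ℝ × ℝ)) ↔ 0 < transverse θ x ∧ transverse θ x < Real.pi := by
  have hc := cos_pos_of_mem hθ
  have hs := sin_pos_of_mem hθ
  have h1 : x.1 * Real.tan θ < |x.2| ↔ 0 < transverse θ x := by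
    rw [Real.tan_eq_sin_div_cos, ← mul_div_assoc, div_lt_iff₀ hc, transverse, sub_pos]
  have h2 : |x.2| < (x.1 + Real.pi / Real.sin θ) * Real.tan θ ↔ transverse θ x < Real.pi := by
    have : (x.1 + Real.pi / Real.sin θ) * Real.tan θ =
        (x.1 * Real.sin θ + Real.pi) / Real.cos θ := by
      rw [Real.tan_eq_sin_div_cos]
      field_simp
    rw [this, lt_div_iff₀ hc, transverse, sub_lt_iff_lt_add']
  exact and_congr h1 h2

/-- Orthonormal coordinates along (`σ = 1`: upper, `σ = -1`: lower) an arm of the guide. -/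
def armEquiv (θ σ : ℝ) (hσ : σ ^ 2 = 1) : (ℝ × ℝ) ≃ₗ[ℝ] (ℝ × ℝ) where
  toFun p := (p.1 * Real.cos θ - p.2 * Real.sin θ, σ * (p.1 * Real.sin θ + p.2 * Real.cos θ))
  invFun x := (x.1 * Real.cos θ + σ * x.2 * Real.sin θ, σ * x.2 * Real.cos θ - x.1 * Real.sin θ)
  map_add' p q := by ext <;> simp <;> ring
  map_smul' a p := by ext <;> simp <;> ring
  left_inv p := by
    have h := Real.sin_sq_add_cos_sq θ
    ext <;> simp only []
    · linear_combination p.1 * h + Real.sin θ * (p.1 * Real.sin θ + p.2 * Real.cos θ) * hσ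
    · linear_combination p.2 * h + Real.cos θ * (p.1 * Real.sin θ + p.2 * Real.cos θ) * hσ
  right_inv x := by
    have h := Real.sin_sq_add_cos_sq θ
    ext <;> simp only []
    · linear_combination x.1 * h
    · linear_combination σ ^ 2 * x.2 * h + x.2 * hσ

theorem abs_det_armEquiv (θ σ : ℝ) (hσ : σ ^ 2 = 1) :
    |LinearMap.det (armEquiv θ σ hσ : (ℝ × ℝ) →ₗ[ℝ] (ℝ × ℝ))| = 1 := by
  have h : LinearMap.det (armEquiv θ σ hσ : (ℝ × ℝ) →ₗ[ℝ] (ℝ × ℝ)) = σ := by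
    rw [← LinearMap.det_toMatrix (Module.Basis.finTwoProd ℝ), Matrix.det_fin_two]
    simp [LinearMap.toMatrix_apply, armEquiv]
    linear_combination σ * Real.sin_sq_add_cos_sq θ
  rw [h, ← sq_eq_sq₀ (abs_nonneg _) zero_le_one, sq_abs, hσ, one_pow]

theorem measurePreserving_armEquiv (θ σ : ℝ) (hσ : σ ^ 2 = 1) :
    MeasurePreserving (armEquiv θ σ hσ) := by
  refine ⟨(armEquiv θ σ hσ).toContinuousLinearEquiv.continuous.measurable, ?_⟩
  have hdet := abs_det_armEquiv θ σ hσ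
  have := Measure.map_linearMap_addHaar_eq_smul_addHaar (volume : Measure (ℝ × ℝ))
    (f := (armEquiv θ σ hσ : (ℝ × ℝ) →ₗ[ℝ] (ℝ × ℝ))) (fun h => by simp [h] at hdet)
  rw [abs_inv, hdet] at this
  simpa using this

theorem measurableEmbedding_armEquiv (θ σ : ℝ) (hσ : σ ^ 2 = 1) :
    MeasurableEmbedding (armEquiv θ σ hσ) :=
  (armEquiv θ σ hσ).toContinuousLinearEquiv.toHomeomorph.measurableEmbedding

/-- The half-strip which forms an arm of the guide. -/
def arm (θ σ : ℝ) : Set (ℝ × ℝ) :=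
  {x | 0 ≤ x.1 * Real.cos θ + σ * x.2 * Real.sin θ ∧
    σ * x.2 * Real.cos θ - x.1 * Real.sin θ ∈ Set.Ioo 0 Real.pi}

theorem armEquiv_preimage_arm (θ σ : ℝ) (hσ : σ ^ 2 = 1) :
    armEquiv θ σ hσ ⁻¹' arm θ σ = Set.Ici 0 ×ˢ Set.Ioo 0 Real.pi := by
  ext p
  have h := (armEquiv θ σ hσ).left_inv p
  have h1 := congrArg Prod.fst h
  have h2 := congrArg Prod.snd h
  simp only [armEquiv] at h1 h2
  simp only [arm, armEquiv, Set.mem_preimage, Set.mem_ofPred_eq, LinearEquiv.coe_mk,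
    LinearMap.coe_mk, AddHom.coe_mk, Set.mem_prod, Set.mem_Ici]
  rw [h1, h2]

theorem measurableSet_arm (θ σ : ℝ) : MeasurableSet (arm θ σ) := by
  unfold arm
  measurability

variable {φ : ℝ × ℝ → ℂ}

/-- A perpendicular cross-section of an arm is a segment of length `π` with both endpoints outside
the open guide, so `φ` vanishes near them and `wirtinger` applies. -/
theorem arm_wirtinger (hθ : θ ∈ Set.Ioo 0 (Real.pi / 2)) (hφ : IsTest (brokenGuide θ) φ)
    {σ : ℝ} (hσ : σ ^ 2 = 1) {s : ℝ} (hs : 0 ≤ s) :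
    ∫ t in Set.Ioo 0 Real.pi, ‖φ (armEquiv θ σ hσ (s, t))‖ ^ 2 ≤
      ∫ t in Set.Ioo 0 Real.pi, gradSq φ (armEquiv θ σ hσ (s, t)) := by
  set L := (armEquiv θ σ hσ).toContinuousLinearEquiv with hL
  have hφ1 : ContDiff ℝ 1 φ := hφ.smooth.of_le (by simp)
  have hcl : Continuous fun t : ℝ => L (s, t) := L.continuous.comp (by fun_prop)
  have hline : ∀ t : ℝ, HasDerivAt (fun t : ℝ => L (s, t)) (L (0, 1)) t := fun t =>
    (L : (ℝ × ℝ) →L[ℝ] (ℝ × ℝ)).hasFDerivAt.comp_hasDerivAt t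
      ((hasDerivAt_const t s).prodMk (hasDerivAt_id t))
  have hder : ∀ t : ℝ, HasDerivAt (fun t => φ (L (s, t))) (fderiv ℝ φ (L (s, t)) (L (0, 1))) t :=
    fun t => (hφ1.differentiable (by simp) _).hasFDerivAt.comp_hasDerivAt t (hline t)
  have hσ1 : |σ| = 1 := by
    rw [← sq_eq_sq₀ (abs_nonneg _) zero_le_one, sq_abs, hσ, one_pow]
  have hsc := Real.sin_sq_add_cos_sq θ
  have hL2 : ∀ t, L (s, t) = (s * Real.cos θ - t * Real.sin θ,
      σ * (s * Real.sin θ + t * Real.cos θ)) := fun t => rfl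
  have htr : ∀ t, 0 ≤ t → transverse θ (L (s, t)) = t := fun t ht => by
    rw [hL2, transverse, abs_mul, hσ1, one_mul, abs_of_nonneg (add_nonneg
      (mul_nonneg hs (sin_pos_of_mem hθ).le) (mul_nonneg ht (cos_pos_of_mem hθ).le))]
    linear_combination t * hsc
  have hzero : ∀ t, 0 ≤ t → L (s, t) ∉ (brokenGuide θ : Set (ℝ × ℝ)) →
      (fun t => φ (L (s, t))) =ᶠ[𝓝 t] 0 := fun t ht hn => by
    have h1 : φ =ᶠ[𝓝 (L (s, t))] 0 :=
      notMem_tsupport_iff_eventuallyEq.1 fun h => hn (hφ.support h)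
    exact hcl.continuousAt.eventually h1
  have hc' : Continuous fun t => fderiv ℝ φ (L (s, t)) (L (0, 1)) :=
    ((hφ1.continuous_fderiv (by simp)).comp hcl).clm_apply continuous_const
  refine (wirtinger hder hc' (hzero 0 le_rfl fun h => ?_)
    (hzero _ Real.pi_pos.le fun h => ?_)).trans ?_
  · rw [mem_brokenGuide_iff hθ, htr 0 le_rfl] at h
    exact lt_irrefl _ h.1
  · rw [mem_brokenGuide_iff hθ, htr _ Real.pi_pos.le] at h
    exact lt_irrefl _ h.2
  · refine setIntegral_mono_on ?_ ?_ measurableSet_Ioo fun t _ => ?_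
    · exact (hc'.norm.pow 2).integrableOn_Icc.mono_set Set.Ioo_subset_Icc_self
    · exact ((continuous_gradSq hφ1).comp hcl).integrableOn_Icc.mono_set Set.Ioo_subset_Icc_self
    · refine (norm_sq_fderiv_le φ _ _).trans_eq ?_
      have h1 : L (0, 1) = (0 * Real.cos θ - 1 * Real.sin θ,
        σ * (0 * Real.sin θ + 1 * Real.cos θ)) := rfl
      have h2 : (L (0, 1)).1 ^ 2 + (L (0, 1)).2 ^ 2 = 1 := by
        rw [h1]
        simp only []
        linear_combination hsc + Real.cos θ ^ 2 * hσ
      rw [h2, one_mul]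
      rfl

theorem hasCompactSupport_gradSq (hc : HasCompactSupport φ) : HasCompactSupport (gradSq φ) := by
  have h : ∀ v : ℝ × ℝ, HasCompactSupport (dirDeriv v φ) := fun v => hc.fderiv_apply ℝ v
  exact ((h _).comp_left (g := fun z : ℂ => ‖z‖ ^ 2) (by simp)).add
    ((h _).comp_left (g := fun z : ℂ => ‖z‖ ^ 2) (by simp))

variable {Ω : TopologicalSpace.Opens (ℝ × ℝ)}

theorem IsTest.integrable_gradSq (hφ : IsTest Ω φ) : Integrable (gradSq φ) :=
  (continuous_gradSq (hφ.smooth.of_le (by simp))).integrable_of_hasCompactSupport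
    (hasCompactSupport_gradSq hφ.compact)

theorem IsTest.integrable_norm_sq (hφ : IsTest Ω φ) : Integrable fun x => ‖φ x‖ ^ 2 := by
  have h1 : Continuous fun x => ‖φ x‖ ^ 2 := hφ.smooth.continuous.norm.pow 2
  have h2 : HasCompactSupport fun x => ‖φ x‖ ^ 2 :=
    hφ.compact.comp_left (g := fun z : ℂ => ‖z‖ ^ 2) (by simp)
  exact h1.integrable_of_hasCompactSupport h2

theorem integral_arm_le (hθ : θ ∈ Set.Ioo 0 (Real.pi / 2)) (hφ : IsTest (brokenGuide θ) φ)
    {σ : ℝ} (hσ : σ ^ 2 = 1) : ∫ x in arm θ σ, ‖φ x‖ ^ 2 ≤ ∫ x in arm θ σ, gradSq φ x := by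
  have hmp := measurePreserving_armEquiv θ σ hσ
  have hme := measurableEmbedding_armEquiv θ σ hσ
  have hi1 : IntegrableOn (fun p => ‖φ (armEquiv θ σ hσ p)‖ ^ 2)
      (Set.Ici (0 : ℝ) ×ˢ Set.Ioo 0 Real.pi) (volume.prod volume) :=
    ((hmp.integrable_comp_emb hme).2 hφ.integrable_norm_sq).integrableOn
  have hi2 : IntegrableOn (fun p => gradSq φ (armEquiv θ σ hσ p))
      (Set.Ici (0 : ℝ) ×ˢ Set.Ioo 0 Real.pi) (volume.prod volume) :=
    ((hmp.integrable_comp_emb hme).2 hφ.integrable_gradSq).integrableOn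
  rw [← hmp.setIntegral_preimage_emb hme (fun x => ‖φ x‖ ^ 2) (arm θ σ),
    ← hmp.setIntegral_preimage_emb hme (gradSq φ) (arm θ σ),
    armEquiv_preimage_arm, Measure.volume_eq_prod, setIntegral_prod _ hi1, setIntegral_prod _ hi2]
  refine setIntegral_mono_on ?_ ?_ measurableSet_Ici fun s hs => arm_wirtinger hθ hφ hσ hs
  · rw [IntegrableOn, ← Measure.prod_restrict] at hi1
    exact hi1.integral_prod_left
  · rw [IntegrableOn, ← Measure.prod_restrict] at hi2
    exact hi2.integral_prod_left

/-- The part of the guide which is left when the arms are removed. -/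
def kite (θ : ℝ) : Set (ℝ × ℝ) :=
  {x | x.1 * Real.cos θ + |x.2| * Real.sin θ < 0 ∧ transverse θ x < Real.pi}

/-- The intersection of the kite with a cell of the grid of mesh `1 / 2`. -/
def cell (θ : ℝ) (p : ℤ × ℤ) : Set (ℝ × ℝ) :=
  kite θ ∩ {x | ⌊2 * x.1⌋ = p.1 ∧ ⌊2 * x.2⌋ = p.2}

theorem convex_kite (hθ : θ ∈ Set.Ioo 0 (Real.pi / 2)) : Convex ℝ (kite θ) := by
  have hc := cos_pos_of_mem hθ
  have hs := sin_pos_of_mem hθ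
  rintro x ⟨hx1, hx2⟩ y ⟨hy1, hy2⟩ a b ha hb hab
  have habs : |a * x.2 + b * y.2| ≤ a * |x.2| + b * |y.2| :=
    (abs_add_le _ _).trans_eq (by rw [abs_mul, abs_mul, abs_of_nonneg ha, abs_of_nonneg hb])
  simp only [kite, transverse, Set.mem_ofPred_eq, Prod.fst_add, Prod.snd_add, Prod.smul_fst,
    Prod.smul_snd, smul_eq_mul] at *
  have hab' : 0 < a ∨ 0 < b := by
    by_contra! h
    linarith
  have key : ∀ {u v w : ℝ}, u < w → v < w → a * u + b * v < w := fun {u v w} hu hv => by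
    have : w = a * w + b * w := by rw [← add_mul, hab, one_mul]
    rcases hab' with h | h
    · linarith [mul_lt_mul_of_pos_left hu h, mul_le_mul_of_nonneg_left hv.le hb]
    · linarith [mul_lt_mul_of_pos_left hv h, mul_le_mul_of_nonneg_left hu.le ha]
  have k1 := key hx1 hy1
  have k2 := key hx2 hy2
  exact ⟨by linarith [mul_le_mul_of_nonneg_right habs hs.le],
    by linarith [mul_le_mul_of_nonneg_right habs hc.le]⟩

theorem convex_cell (hθ : θ ∈ Set.Ioo 0 (Real.pi / 2)) (p : ℤ × ℤ) : Convex ℝ (cell θ p) := by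
  refine (convex_kite hθ).inter ?_
  have : {x : ℝ × ℝ | ⌊2 * x.1⌋ = p.1 ∧ ⌊2 * x.2⌋ = p.2} =
      Set.Ico ((p.1 : ℝ) / 2) ((p.1 + 1) / 2) ×ˢ Set.Ico ((p.2 : ℝ) / 2) ((p.2 + 1) / 2) := by
    ext x
    simp only [Set.mem_ofPred_eq, Set.mem_prod, Set.mem_Ico, Int.floor_eq_iff,
      div_le_iff₀ (zero_lt_two' ℝ), lt_div_iff₀ (zero_lt_two' ℝ), mul_comm (2 : ℝ)]
  rw [this]
  exact (convex_Ico _ _).prod (convex_Ico _ _)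

theorem measurableSet_kite (θ : ℝ) : MeasurableSet (kite θ) := by
  have h1 : IsOpen {x : ℝ × ℝ | x.1 * Real.cos θ + |x.2| * Real.sin θ < 0} :=
    isOpen_lt (by fun_prop) (by fun_prop)
  have h2 : IsOpen {x : ℝ × ℝ | |x.2| * Real.cos θ - x.1 * Real.sin θ < Real.pi} :=
    isOpen_lt (by fun_prop) (by fun_prop)
  exact (h1.inter h2).measurableSet

theorem measurableSet_cell (θ : ℝ) (p : ℤ × ℤ) : MeasurableSet (cell θ p) := by
  refine (measurableSet_kite θ).inter (MeasurableSet.inter ?_ ?_)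
  · exact measurableSet_eq_fun (by fun_prop) measurable_const
  · exact measurableSet_eq_fun (by fun_prop) measurable_const

theorem cell_diam {p : ℤ × ℤ} {x y : ℝ × ℝ} (hx : x ∈ cell θ p) (hy : y ∈ cell θ p) :
    |y.1 - x.1| ≤ 1 / 2 ∧ |y.2 - x.2| ≤ 1 / 2 := by
  have h1 := Int.floor_eq_iff.1 hx.2.1
  have h2 := Int.floor_eq_iff.1 hx.2.2
  have h3 := Int.floor_eq_iff.1 hy.2.1
  have h4 := Int.floor_eq_iff.1 hy.2.2
  exact ⟨abs_le.2 ⟨by linarith, by linarith⟩, abs_le.2 ⟨by linarith, by linarith⟩⟩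

theorem kite_bound (hθ : θ ∈ Set.Ioo 0 (Real.pi / 2)) {x : ℝ × ℝ} (hx : x ∈ kite θ) :
    x.1 < 0 ∧ -(Real.pi / Real.sin θ) ≤ x.1 ∧ |x.2| ≤ Real.pi / Real.cos θ := by
  have hc := cos_pos_of_mem hθ
  have hs := sin_pos_of_mem hθ
  obtain ⟨h1, h2⟩ := hx
  rw [transverse] at h2
  have h3 := mul_nonneg (abs_nonneg x.2) hs.le
  have h4 := mul_nonneg (abs_nonneg x.2) hc.le
  have hx0 : x.1 < 0 := by
    by_contra! h
    linarith [mul_nonneg h hc.le]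
  refine ⟨hx0, ?_, ?_⟩
  · rw [← neg_div, div_le_iff₀ hs]
    linarith
  · rw [le_div_iff₀ hc]
    nlinarith

theorem kite_subset (hθ : θ ∈ Set.Ioo 0 (Real.pi / 2)) :
    kite θ ⊆ (brokenGuide θ : Set (ℝ × ℝ)) := by
  intro x hx
  rw [mem_brokenGuide_iff hθ]
  refine ⟨?_, hx.2⟩
  have := mul_nonneg (abs_nonneg x.2) (cos_pos_of_mem hθ).le
  have := mul_pos (neg_pos.2 (kite_bound hθ hx).1) (sin_pos_of_mem hθ)
  rw [transverse]
  linarith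

theorem volume_kite_lt_top (hθ : θ ∈ Set.Ioo 0 (Real.pi / 2)) : volume (kite θ) < ⊤ := by
  have hsub : kite θ ⊆ Set.Icc (-(Real.pi / Real.sin θ)) 0 ×ˢ
      Set.Icc (-(Real.pi / Real.cos θ)) (Real.pi / Real.cos θ) := fun x hx => by
    obtain ⟨h1, h2, h3⟩ := kite_bound hθ hx
    exact ⟨⟨h2, h1.le⟩, abs_le.1 h3⟩
  exact (measure_mono hsub).trans_lt (isCompact_Icc.prod isCompact_Icc).measure_lt_top

theorem exists_grid (hθ : θ ∈ Set.Ioo 0 (Real.pi / 2)) :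
    ∃ I : Finset (ℤ × ℤ), kite θ = ⋃ p ∈ I, cell θ p := by
  have hbd : ∀ B : ℝ, ∀ a : ℝ, |a| ≤ B → ⌊2 * a⌋ ∈ Finset.Icc ⌊-(2 * B)⌋ ⌊2 * B⌋ :=
    fun B a ha => by
      have := abs_le.1 ha
      exact Finset.mem_Icc.2 ⟨Int.floor_le_floor (by linarith), Int.floor_le_floor (by linarith)⟩
  refine ⟨Finset.Icc ⌊-(2 * (Real.pi / Real.sin θ))⌋ ⌊2 * (Real.pi / Real.sin θ)⌋ ×ˢ
    Finset.Icc ⌊-(2 * (Real.pi / Real.cos θ))⌋ ⌊2 * (Real.pi / Real.cos θ)⌋,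
    Set.Subset.antisymm (fun x hx => ?_) (Set.iUnion₂_subset fun p _ => Set.inter_subset_left)⟩
  obtain ⟨h1, h2, h3⟩ := kite_bound hθ hx
  refine Set.mem_iUnion₂.2 ⟨(⌊2 * x.1⌋, ⌊2 * x.2⌋), Finset.mem_product.2 ⟨hbd _ _ ?_, hbd _ _ h3⟩,
    hx, rfl, rfl⟩
  exact abs_le.2 ⟨h2, by linarith⟩

theorem integral_kite_le (hθ : θ ∈ Set.Ioo 0 (Real.pi / 2)) (hφ : IsTest (brokenGuide θ) φ)
    {I : Finset (ℤ × ℤ)} (hI : kite θ = ⋃ p ∈ I, cell θ p) :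
    ∫ x in kite θ, ‖φ x‖ ^ 2 ≤ (∫ x in kite θ, gradSq φ x) +
      ∑ p ∈ I, (volume.real (cell θ p))⁻¹ * ‖∫ x in cell θ p, φ x‖ ^ 2 := by
  have hdisj : Set.Pairwise (I : Set (ℤ × ℤ)) (Function.onFun Disjoint (cell θ)) := by
    intro p _ q _ hpq
    refine Set.disjoint_left.2 fun x hx hx' => hpq ?_
    exact Prod.ext (hx.2.1.symm.trans hx'.2.1) (hx.2.2.symm.trans hx'.2.2)
  rw [hI, integral_biUnion_finset I (fun p _ => measurableSet_cell θ p) hdisj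
      (fun p _ => hφ.integrable_norm_sq.integrableOn),
    integral_biUnion_finset I (fun p _ => measurableSet_cell θ p) hdisj
      (fun p _ => hφ.integrable_gradSq.integrableOn), ← Finset.sum_add_distrib]
  exact Finset.sum_le_sum fun p _ => poincare_convex (hφ.smooth.of_le (by simp)) hφ.compact
    (convex_cell hθ p) (measurableSet_cell θ p)
    ((measure_mono Set.inter_subset_left).trans_lt (volume_kite_lt_top hθ)).ne
    fun x hx y hy => cell_diam hx hy

theorem arm_pos (hθ : θ ∈ Set.Ioo 0 (Real.pi / 2)) {σ : ℝ} {x : ℝ × ℝ}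
    (hx : x ∈ arm θ σ) : 0 < σ * x.2 := by
  have hc := cos_pos_of_mem hθ
  have hs := sin_pos_of_mem hθ
  have h := Real.sin_sq_add_cos_sq θ
  have e : σ * x.2 = (x.1 * Real.cos θ + σ * x.2 * Real.sin θ) * Real.sin θ +
      (σ * x.2 * Real.cos θ - x.1 * Real.sin θ) * Real.cos θ := by
    linear_combination (-σ * x.2) * h
  rw [e]
  exact add_pos_of_nonneg_of_pos (mul_nonneg hx.1 hs.le) (mul_pos hx.2.1 hc)

theorem disjoint_arm (hθ : θ ∈ Set.Ioo 0 (Real.pi / 2)) : Disjoint (arm θ 1) (arm θ (-1)) :=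
  Set.disjoint_left.2 fun x hx hx' => by
    have h1 := arm_pos hθ hx
    have h2 := arm_pos hθ hx'
    linarith

theorem disjoint_arm_kite (hθ : θ ∈ Set.Ioo 0 (Real.pi / 2)) :
    Disjoint (arm θ 1 ∪ arm θ (-1)) (kite θ) :=
  Set.disjoint_left.2 fun x hx hx' => by
    have hs := sin_pos_of_mem hθ
    have h1 := mul_le_mul_of_nonneg_right (le_abs_self x.2) hs.le
    have h2 := mul_le_mul_of_nonneg_right (neg_abs_le x.2) hs.le
    have h3 := hx'.1
    rcases hx with hx | hx
    · have := hx.1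
      linarith
    · have := hx.1
      linarith

theorem brokenGuide_subset (hθ : θ ∈ Set.Ioo 0 (Real.pi / 2)) :
    (brokenGuide θ : Set (ℝ × ℝ)) ⊆ (arm θ 1 ∪ arm θ (-1)) ∪ kite θ := by
  intro x hx
  rw [mem_brokenGuide_iff hθ] at hx
  rcases lt_or_ge (x.1 * Real.cos θ + |x.2| * Real.sin θ) 0 with h | h
  · exact Or.inr ⟨h, hx.2⟩
  · left
    rw [transverse] at hx
    rcases le_total 0 x.2 with h2 | h2
    · left
      rw [abs_of_nonneg h2] at h hx
      exact ⟨by linarith, by linarith, by linarith⟩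
    · right
      rw [abs_of_nonpos h2] at h hx
      exact ⟨by linarith, by linarith, by linarith⟩

/-- The constant is 1 on each of the three pieces; only the kite, where the Dirichlet condition is
not used, contributes a finite rank correction. -/
theorem integral_norm_sq_le (hθ : θ ∈ Set.Ioo 0 (Real.pi / 2)) (hφ : IsTest (brokenGuide θ) φ)
    {I : Finset (ℤ × ℤ)} (hI : kite θ = ⋃ p ∈ I, cell θ p) :
    ∫ x, ‖φ x‖ ^ 2 ≤ (∫ x, gradSq φ x) +
      ∑ p ∈ I, (volume.real (cell θ p))⁻¹ * ‖∫ x in cell θ p, φ x‖ ^ 2 := by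
  have hU : ∫ x, ‖φ x‖ ^ 2 = ∫ x in (arm θ 1 ∪ arm θ (-1)) ∪ kite θ, ‖φ x‖ ^ 2 :=
    (setIntegral_eq_integral_of_forall_compl_eq_zero fun x hx => by
      rw [hφ.eq_zero_of_notMem fun h => hx (brokenGuide_subset hθ h)]
      simp).symm
  have hsplit : ∀ f : ℝ × ℝ → ℝ, Integrable f →
      ∫ x in (arm θ 1 ∪ arm θ (-1)) ∪ kite θ, f x =
        (∫ x in arm θ 1, f x) + (∫ x in arm θ (-1), f x) + ∫ x in kite θ, f x := fun f hf => by
    rw [setIntegral_union (disjoint_arm_kite hθ) (measurableSet_kite θ) hf.integrableOn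
      hf.integrableOn, setIntegral_union (disjoint_arm hθ) (measurableSet_arm θ _)
      hf.integrableOn hf.integrableOn]
  have hle : ∫ x in (arm θ 1 ∪ arm θ (-1)) ∪ kite θ, gradSq φ x ≤ ∫ x, gradSq φ x :=
    setIntegral_le_integral hφ.integrable_gradSq (ae_of_all _ fun x => gradSq_nonneg φ x)
  rw [hU, hsplit _ hφ.integrable_norm_sq]
  rw [hsplit _ hφ.integrable_gradSq] at hle
  linarith [integral_arm_le hθ hφ (σ := 1) (by norm_num),
    integral_arm_le hθ hφ (σ := -1) (by norm_num), integral_kite_le hθ hφ hI]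

theorem IsTest.integral_gradSq (hφ : IsTest Ω φ) :
    ∫ x, gradSq φ x = ‖(hφ.dirDeriv (1, 0)).toL2‖ ^ 2 + ‖(hφ.dirDeriv (0, 1)).toL2‖ ^ 2 := by
  rw [(hφ.dirDeriv _).norm_toL2_sq, (hφ.dirDeriv _).norm_toL2_sq,
    ← integral_add (hφ.dirDeriv _).integrable_norm_sq (hφ.dirDeriv _).integrable_norm_sq]
  rfl

theorem exists_boundedBelowOn (hθ : θ ∈ Set.Ioo 0 (Real.pi / 2)) :
    ∃ F : Submodule ℂ (L2 (brokenGuide θ)), FiniteDimensional ℂ F ∧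
      BoundedBelowOn (dirichletLaplacian (brokenGuide θ)) F := by
  obtain ⟨I, hI⟩ := exists_grid hθ
  have hsub : ∀ p, cell θ p ⊆ (brokenGuide θ : Set (ℝ × ℝ)) := fun p =>
    Set.inter_subset_left.trans (kite_subset hθ)
  have hfin : ∀ p, (volume.restrict (brokenGuide θ : Set (ℝ × ℝ))) (cell θ p) ≠ ⊤ := fun p =>
    ((Measure.restrict_apply_le _ _).trans_lt ((measure_mono Set.inter_subset_left).trans_lt
      (volume_kite_lt_top hθ))).ne
  -- The square root normalises the indicator so that `‖⟨f p, φ⟩‖²` is exactly the mean value term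
  -- of the cell; on a null cell the inverse is 0 and so is `f p`.
  let f : I → L2 (brokenGuide θ) := fun p =>
    indicatorConstLp 2 (measurableSet_cell θ p) (hfin p)
      ((Real.sqrt (volume.real (cell θ p))⁻¹ : ℝ) : ℂ)
  refine ⟨Submodule.span ℂ (Set.range f), FiniteDimensional.span_of_finite ℂ (Set.finite_range f),
    boundedBelowOn_of_test f fun φ hφ => ?_⟩
  have hf : ∀ p : I, ‖inner ℂ (f p) hφ.toL2‖ ^ 2 =
      (volume.real (cell θ p))⁻¹ * ‖∫ x in cell θ p, φ x‖ ^ 2 := fun p => by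
    have h1 : ∫ x in cell θ p, hφ.toL2 x ∂(volume.restrict (brokenGuide θ : Set (ℝ × ℝ))) =
        ∫ x in cell θ p, φ x := by
      rw [integral_congr_ae (ae_restrict_of_ae hφ.coeFn_toL2),
        Measure.restrict_restrict (measurableSet_cell θ p), Set.inter_eq_left.2 (hsub p)]
    rw [L2.inner_indicatorConstLp_eq_inner_setIntegral, h1, RCLike.inner_apply, norm_mul,
      mul_pow, RCLike.norm_conj, Complex.norm_real, Real.norm_eq_abs, sq_abs,
      Real.sq_sqrt (by positivity), mul_comm]
  rw [hφ.norm_toL2_sq, ← hφ.integral_gradSq, Finset.sum_congr rfl fun p _ => hf p,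
    Finset.sum_coe_sort I fun p => (volume.real (cell θ p))⁻¹ * ‖∫ x in cell θ p, φ x‖ ^ 2]
  exact integral_norm_sq_le hθ hφ hI

end Guide

/-! ### A compactly supported approximation of the transverse ground state -/

section CutSin

open Real

/-- The function `sin`, smoothly cut off outside `[1 / N, π - 1 / N]`. -/
def cutSin (N t : ℝ) : ℝ :=
  smoothTransition (N * t - 1) * smoothTransition (N * (π - t) - 1) * sin t

theorem contDiff_cutSin (N : ℝ) : ContDiff ℝ ∞ (cutSin N) :=
  ((smoothTransition.contDiff.comp (by fun_prop)).mul
    (smoothTransition.contDiff.comp (by fun_prop))).mul contDiff_sin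

theorem abs_cutSin_le (N t : ℝ) : |cutSin N t| ≤ 1 := by
  rw [cutSin, abs_mul, abs_mul, abs_of_nonneg (smoothTransition.nonneg _),
    abs_of_nonneg (smoothTransition.nonneg _)]
  exact mul_le_one₀ (mul_le_one₀ (smoothTransition.le_one _) (smoothTransition.nonneg _)
    (smoothTransition.le_one _)) (abs_nonneg _) (abs_sin_le_one _)

theorem mem_Icc_of_cutSin_ne_zero {N t : ℝ} (hN : 0 < N) (h : cutSin N t ≠ 0) :
    t ∈ Set.Icc (1 / N) (π - 1 / N) := by
  have h1 : 0 < N * t - 1 := by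
    by_contra! h'
    exact h (by rw [cutSin, smoothTransition.zero_of_nonpos h']; ring)
  have h2 : 0 < N * (π - t) - 1 := by
    by_contra! h'
    exact h (by rw [cutSin, smoothTransition.zero_of_nonpos h']; ring)
  have e1 : 1 / N ≤ t := by rw [div_le_iff₀ hN]; linarith
  have e2 : 1 / N ≤ π - t := by rw [div_le_iff₀ hN]; linarith
  exact ⟨e1, by linarith⟩

theorem deriv_smoothTransition_eq_zero {x : ℝ} (hx : x ∉ Set.Icc (0 : ℝ) 1) :
    deriv smoothTransition x = 0 := by
  rw [Set.mem_Icc, not_and_or, not_le, not_le] at hx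
  rcases hx with h | h
  · have : smoothTransition =ᶠ[𝓝 x] fun _ => 0 := by
      filter_upwards [Iio_mem_nhds h] with y hy
      exact smoothTransition.zero_of_nonpos (le_of_lt hy)
    rw [this.deriv_eq, deriv_const]
  · have : smoothTransition =ᶠ[𝓝 x] fun _ => 1 := by
      filter_upwards [Ioi_mem_nhds h] with y hy
      exact smoothTransition.one_of_one_le (le_of_lt hy)
    rw [this.deriv_eq, deriv_const]

theorem hasDerivAt_smoothTransition (x : ℝ) :
    HasDerivAt smoothTransition (deriv smoothTransition x) x :=
  ((smoothTransition.contDiff (n := 1)).differentiable (by simp) x).hasDerivAt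

theorem exists_deriv_smoothTransition_le :
    ∃ M : ℝ, 0 ≤ M ∧ ∀ x, |deriv smoothTransition x| ≤ M := by
  have hc : Continuous (deriv smoothTransition) :=
    (smoothTransition.contDiff (n := 1)).continuous_deriv (by simp)
  obtain ⟨M, hM⟩ := isCompact_Icc.exists_bound_of_continuousOn (s := Set.Icc (0 : ℝ) 1)
    hc.continuousOn
  refine ⟨max M 0, le_max_right _ _, fun x => ?_⟩
  by_cases hx : x ∈ Set.Icc (0 : ℝ) 1
  · exact (hM x hx).trans (le_max_left _ _)
  · rw [deriv_smoothTransition_eq_zero hx, abs_zero]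
    exact le_max_right _ _

theorem hasDerivAt_cutSin (N t : ℝ) : HasDerivAt (cutSin N)
    ((deriv smoothTransition (N * t - 1) * N * smoothTransition (N * (π - t) - 1) +
      smoothTransition (N * t - 1) * (deriv smoothTransition (N * (π - t) - 1) * -N)) * sin t +
      smoothTransition (N * t - 1) * smoothTransition (N * (π - t) - 1) * cos t) t := by
  have h1 : HasDerivAt (fun t => N * t - 1) N t := by
    simpa using ((hasDerivAt_id t).const_mul N).sub_const 1
  have h2 : HasDerivAt (fun t => N * (π - t) - 1) (-N) t := by
    simpa using (((hasDerivAt_id t).const_sub π).const_mul N).sub_const 1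
  exact (((hasDerivAt_smoothTransition _).comp t h1).mul
    ((hasDerivAt_smoothTransition _).comp t h2)).mul (hasDerivAt_sin t)

/-- Differentiating the cutoffs produces a factor `N`, but only within `2 / N` of an endpoint, where
`sin` is at most `2 / N`. The bound is therefore uniform in `N`, as dominated convergence requires.
-/
theorem exists_deriv_cutSin_le :
    ∃ B : ℝ, 0 ≤ B ∧ ∀ N t : ℝ, 0 < N → |deriv (cutSin N) t| ≤ B := by
  obtain ⟨M, hM0, hM⟩ := exists_deriv_smoothTransition_le
  refine ⟨2 * M + 2 * M + 1, by positivity, fun N t hN => ?_⟩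
  have key : ∀ u v : ℝ, |v| ≤ |u| → |deriv smoothTransition (N * u - 1) * N * v| ≤ 2 * M := by
    intro u v huv
    by_cases hu : N * u - 1 ∈ Set.Icc (0 : ℝ) 1
    · have h1 : N * |u| ≤ 2 := by
        rw [← abs_of_pos hN, ← abs_mul, abs_le]
        exact ⟨by linarith [hu.1], by linarith [hu.2]⟩
      rw [abs_mul, abs_mul, abs_of_pos hN, mul_assoc, mul_comm]
      exact mul_le_mul ((mul_le_mul_of_nonneg_left huv hN.le).trans h1) (hM _) (abs_nonneg _)
        (by norm_num)
    · rw [deriv_smoothTransition_eq_zero hu]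
      simpa using hM0
  have hS : ∀ u, |smoothTransition u| ≤ 1 := fun u => by
    rw [abs_of_nonneg (smoothTransition.nonneg _)]
    exact smoothTransition.le_one _
  have hsin : |sin t| ≤ |π - t| := by
    rw [← sin_pi_sub]
    exact abs_sin_le_abs
  rw [(hasDerivAt_cutSin N t).deriv]
  have e1 := key t (sin t) abs_sin_le_abs
  have e2 := key (π - t) (sin t) hsin
  set a := deriv smoothTransition (N * t - 1) * N * sin t with ha
  set b := deriv smoothTransition (N * (π - t) - 1) * N * sin t with hb
  have h3 : |a * smoothTransition (N * (π - t) - 1)| ≤ 2 * M := by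
    rw [abs_mul]
    exact (mul_le_of_le_one_right (abs_nonneg _) (hS _)).trans e1
  have h4 : |b * smoothTransition (N * t - 1)| ≤ 2 * M := by
    rw [abs_mul]
    exact (mul_le_of_le_one_right (abs_nonneg _) (hS _)).trans e2
  have h5 : |smoothTransition (N * t - 1) * smoothTransition (N * (π - t) - 1) * cos t| ≤ 1 := by
    rw [abs_mul, abs_mul]
    exact mul_le_one₀ (mul_le_one₀ (hS _) (abs_nonneg _) (hS _)) (abs_nonneg _)
      (abs_cos_le_one _)
  rw [abs_le] at *
  constructor <;> nlinarith

theorem eventually_cutSin {t : ℝ} (ht : t ∈ Set.Ioo 0 π) {T : ℕ → ℝ}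
    (hT : Tendsto T atTop (𝓝 t)) :
    ∀ᶠ n : ℕ in atTop, cutSin (n + 1) =ᶠ[𝓝 (T n)] sin := by
  obtain ⟨δ, hδ, hδt⟩ : ∃ δ > 0, t ∈ Set.Ioo δ (π - δ) := by
    refine ⟨min t (π - t) / 2, half_pos (lt_min ht.1 (sub_pos.2 ht.2)), ?_⟩
    have h1 := min_le_left t (π - t)
    have h2 := min_le_right t (π - t)
    have h3 := lt_min ht.1 (sub_pos.2 ht.2)
    exact ⟨by linarith, by linarith⟩
  have hN : ∀ᶠ n : ℕ in atTop, 2 / δ ≤ (n : ℝ) + 1 :=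
    (tendsto_natCast_atTop_atTop.atTop_add tendsto_const_nhds).eventually_ge_atTop _
  filter_upwards [hN, hT.eventually (Ioo_mem_nhds hδt.1 hδt.2)] with n hn hTn
  rw [div_le_iff₀ hδ] at hn
  filter_upwards [Ioo_mem_nhds hTn.1 hTn.2] with u hu
  have hn0 : (0 : ℝ) < n + 1 := by positivity
  rw [cutSin, smoothTransition.one_of_one_le, smoothTransition.one_of_one_le, one_mul, one_mul]
  · nlinarith [hu.2]
  · nlinarith [hu.1]

theorem tendsto_cutSin {t : ℝ} (ht : t ∈ Set.Ioo 0 π) {T : ℕ → ℝ}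
    (hT : Tendsto T atTop (𝓝 t)) :
    Tendsto (fun n : ℕ => cutSin (n + 1) (T n)) atTop (𝓝 (sin t)) :=
  ((continuous_sin.tendsto t).comp hT).congr'
    ((eventually_cutSin ht hT).mono fun _ h => h.eq_of_nhds.symm)

theorem tendsto_deriv_cutSin {t : ℝ} (ht : t ∈ Set.Ioo 0 π) {T : ℕ → ℝ}
    (hT : Tendsto T atTop (𝓝 t)) :
    Tendsto (fun n : ℕ => deriv (cutSin (n + 1)) (T n)) atTop (𝓝 (cos t)) :=
  ((continuous_cos.tendsto t).comp hT).congr'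
    ((eventually_cutSin ht hT).mono fun n h =>
      (h.deriv_eq.trans (by rw [Real.deriv_sin]; rfl)).symm)

end CutSin

/-! ### Test functions with a longitudinal profile and their limiting energy -/

section Trial

open Real

variable {θ : ℝ} {κ : ℝ → ℝ} {R : ℝ}

/-- A smooth approximation of `transverse`. -/
def smoothTransverse (θ : ℝ) (n : ℕ) (x : ℝ × ℝ) : ℝ :=
  √(x.2 ^ 2 + (1 / (2 * (n + 1))) ^ 2) * cos θ - x.1 * sin θ

theorem smoothing_pos (n : ℕ) (y : ℝ) : 0 < y ^ 2 + (1 / (2 * ((n : ℝ) + 1))) ^ 2 := by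
  positivity

/-- Test functions approximating `κ x₁ * sin (transverse θ x)`. -/
def trialFun (θ : ℝ) (κ : ℝ → ℝ) (n : ℕ) (x : ℝ × ℝ) : ℝ :=
  κ x.1 * cutSin (n + 1) (smoothTransverse θ n x)

theorem contDiff_smoothTransverse (θ : ℝ) (n : ℕ) : ContDiff ℝ ∞ (smoothTransverse θ n) := by
  have h : ContDiff ℝ ∞ fun x : ℝ × ℝ => √(x.2 ^ 2 + (1 / (2 * ((n : ℝ) + 1))) ^ 2) :=
    ContDiff.sqrt (by fun_prop) fun x => (smoothing_pos n x.2).ne'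
  exact (h.mul contDiff_const).sub (contDiff_fst.mul contDiff_const)

theorem contDiff_trialFun (hκ : ContDiff ℝ ∞ κ) (n : ℕ) : ContDiff ℝ ∞ (trialFun θ κ n) :=
  (hκ.comp contDiff_fst).mul ((contDiff_cutSin _).comp (contDiff_smoothTransverse θ n))

theorem smoothTransverse_bounds (hθ : θ ∈ Set.Ioo 0 (π / 2)) (n : ℕ) (x : ℝ × ℝ) :
    transverse θ x ≤ smoothTransverse θ n x ∧
      smoothTransverse θ n x ≤ transverse θ x + 1 / (2 * (n + 1)) := by
  have hc := cos_pos_of_mem hθ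
  have hε : (0 : ℝ) < 1 / (2 * (n + 1)) := by positivity
  have h1 : |x.2| ≤ √(x.2 ^ 2 + (1 / (2 * ((n : ℝ) + 1))) ^ 2) :=
    abs_le_sqrt (by linarith [sq_nonneg (1 / (2 * ((n : ℝ) + 1)))])
  have h2 : √(x.2 ^ 2 + (1 / (2 * ((n : ℝ) + 1))) ^ 2) ≤ |x.2| + 1 / (2 * (n + 1)) := by
    rw [sqrt_le_left (by positivity), ← sq_abs x.2]
    nlinarith [mul_nonneg (abs_nonneg x.2) hε.le]
  have h3 := cos_le_one θ
  unfold smoothTransverse transverse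
  constructor
  · linarith [mul_le_mul_of_nonneg_right h1 hc.le]
  · nlinarith [mul_le_mul_of_nonneg_right h2 hc.le]

theorem tendsto_smoothTransverse (hθ : θ ∈ Set.Ioo 0 (π / 2)) (x : ℝ × ℝ) :
    Tendsto (fun n => smoothTransverse θ n x) atTop (𝓝 (transverse θ x)) := by
  have h : Tendsto (fun n : ℕ => transverse θ x + 1 / (2 * ((n : ℝ) + 1))) atTop
      (𝓝 (transverse θ x)) := by
    have := (tendsto_one_div_add_atTop_nhds_zero_nat (𝕜 := ℝ)).const_mul (1 / 2)
    have h2 := this.const_add (transverse θ x)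
    simp only [mul_zero, add_zero] at h2
    refine h2.congr fun n => ?_
    field_simp
  exact tendsto_of_tendsto_of_tendsto_of_le_of_le tendsto_const_nhds h
    (fun n => (smoothTransverse_bounds hθ n x).1) (fun n => (smoothTransverse_bounds hθ n x).2)

/-- The rectangle containing the part of the guide with `x₁ ≤ R`. -/
def box (θ R : ℝ) : Set (ℝ × ℝ) :=
  Set.Icc (-(π / sin θ)) R ×ˢ Set.Icc (-((π + R * sin θ) / cos θ)) ((π + R * sin θ) / cos θ)

theorem mem_box_of_transverse_le (hθ : θ ∈ Set.Ioo 0 (π / 2)) {x : ℝ × ℝ}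
    (hx : transverse θ x ≤ π) (hR : x.1 ≤ R) : x ∈ box θ R := by
  have hc := cos_pos_of_mem hθ
  have hs := sin_pos_of_mem hθ
  rw [transverse] at hx
  have h1 := mul_nonneg (abs_nonneg x.2) hc.le
  have h2 := mul_le_mul_of_nonneg_right hR hs.le
  refine ⟨⟨?_, hR⟩, abs_le.1 ?_⟩
  · rw [← neg_div, div_le_iff₀ hs]
    linarith
  · rw [le_div_iff₀ hc]
    linarith

theorem tsupport_trialFun_subset (hR : ∀ x, R ≤ x → κ x = 0) (n : ℕ) :
    tsupport (trialFun θ κ n) ⊆ {x | x.1 ∈ tsupport κ ∧ x.1 ≤ R ∧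
      smoothTransverse θ n x ∈ Set.Icc (1 / ((n : ℝ) + 1)) (π - 1 / (n + 1))} := by
  refine closure_minimal (fun x hx => ?_) ?_
  · rw [Function.mem_support, trialFun, mul_ne_zero_iff] at hx
    refine ⟨subset_tsupport _ hx.1, ?_, mem_Icc_of_cutSin_ne_zero (by positivity) hx.2⟩
    by_contra! h
    exact hx.1 (hR _ h.le)
  · exact ((isClosed_tsupport κ).preimage continuous_fst).inter
      ((isClosed_Iic.preimage continuous_fst).inter
        (isClosed_Icc.preimage (contDiff_smoothTransverse θ n).continuous))

/-- Smoothing `|x₂|` raises the transverse coordinate by at most `1 / (2 (n + 1))`, half of the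
margin `1 / (n + 1)` left by `cutSin`, so the support stays away from the boundary of the guide. -/
theorem tsupport_trialFun_subset' (hθ : θ ∈ Set.Ioo 0 (π / 2)) (hR : ∀ x, R ≤ x → κ x = 0)
    (n : ℕ) : tsupport (trialFun θ κ n) ⊆ (brokenGuide θ : Set (ℝ × ℝ)) ∩ box θ R := by
  intro x hx
  obtain ⟨-, h1, h2, h3⟩ := tsupport_trialFun_subset hR n hx
  obtain ⟨h4, h5⟩ := smoothTransverse_bounds hθ n x
  have hε : (0 : ℝ) < 1 / (n + 1) := by positivity
  have hε' : (1 : ℝ) / (2 * (n + 1)) = 1 / (n + 1) / 2 := by field_simp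
  have h6 : transverse θ x < π := by linarith
  exact ⟨(mem_brokenGuide_iff hθ).2 ⟨by linarith, h6⟩, mem_box_of_transverse_le hθ h6.le h1⟩

theorem isCompact_box (θ R : ℝ) : IsCompact (box θ R) := isCompact_Icc.prod isCompact_Icc

theorem tsupport_ofReal_trialFun_subset (n : ℕ) :
    tsupport (fun x => (trialFun θ κ n x : ℂ)) ⊆ tsupport (trialFun θ κ n) :=
  tsupport_comp_subset (g := fun r : ℝ => (r : ℂ)) rfl _

theorem isTest_trialFun (hθ : θ ∈ Set.Ioo 0 (π / 2)) (hκ : ContDiff ℝ ∞ κ)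
    (hR : ∀ x, R ≤ x → κ x = 0) (n : ℕ) :
    IsTest (brokenGuide θ) (fun x => (trialFun θ κ n x : ℂ)) where
  smooth := Complex.ofRealCLM.contDiff.comp (contDiff_trialFun hκ n)
  compact := (isCompact_box θ R).of_isClosed_subset (isClosed_tsupport _)
    ((tsupport_ofReal_trialFun_subset n).trans
      ((tsupport_trialFun_subset' hθ hR n).trans Set.inter_subset_right))
  support := (tsupport_ofReal_trialFun_subset n).trans
    ((tsupport_trialFun_subset' hθ hR n).trans Set.inter_subset_left)

theorem hasFDerivAt_smoothTransverse (n : ℕ) (x : ℝ × ℝ) :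
    HasFDerivAt (smoothTransverse θ n)
      ((x.2 / √(x.2 ^ 2 + (1 / (2 * ((n : ℝ) + 1))) ^ 2) * cos θ) •
        ContinuousLinearMap.snd ℝ ℝ ℝ - sin θ • ContinuousLinearMap.fst ℝ ℝ ℝ) x := by
  have h1 : HasDerivAt (fun y : ℝ => √(y ^ 2 + (1 / (2 * ((n : ℝ) + 1))) ^ 2) * cos θ)
      (x.2 / √(x.2 ^ 2 + (1 / (2 * ((n : ℝ) + 1))) ^ 2) * cos θ) x.2 := by
    have h2 : HasDerivAt (fun y : ℝ => y ^ 2 + (1 / (2 * ((n : ℝ) + 1))) ^ 2) (2 * x.2) x.2 := by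
      simpa using (hasDerivAt_pow 2 x.2).add_const ((1 / (2 * ((n : ℝ) + 1))) ^ 2)
    have h3 := (h2.sqrt (smoothing_pos n x.2).ne').mul_const (cos θ)
    rwa [mul_div_mul_left _ _ two_ne_zero] at h3
  have h2 : HasDerivAt (fun y : ℝ => y * sin θ) (sin θ) x.1 := by
    simpa using (hasDerivAt_id x.1).mul_const (sin θ)
  exact (h1.comp_hasFDerivAt x hasFDerivAt_snd).sub (h2.comp_hasFDerivAt x hasFDerivAt_fst)

theorem dirDeriv_trialFun (hκ : ContDiff ℝ ∞ κ) (n : ℕ) (x v : ℝ × ℝ) :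
    dirDeriv v (fun x => (trialFun θ κ n x : ℂ)) x =
      ((κ x.1 * (deriv (cutSin (n + 1)) (smoothTransverse θ n x) *
          (x.2 / √(x.2 ^ 2 + (1 / (2 * ((n : ℝ) + 1))) ^ 2) * cos θ * v.2 - sin θ * v.1)) +
        cutSin (n + 1) (smoothTransverse θ n x) * (deriv κ x.1 * v.1) : ℝ) : ℂ) := by
  have h1 : HasFDerivAt (fun x : ℝ × ℝ => κ x.1) (deriv κ x.1 • ContinuousLinearMap.fst ℝ ℝ ℝ) x :=
    (hκ.differentiable (by simp) x.1).hasDerivAt.comp_hasFDerivAt x hasFDerivAt_fst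
  have h2 := ((contDiff_cutSin ((n : ℝ) + 1)).differentiable (by simp)
    (smoothTransverse θ n x)).hasDerivAt.comp_hasFDerivAt x (hasFDerivAt_smoothTransverse n x)
  have h3 := Complex.ofRealCLM.hasFDerivAt.comp x (h1.mul h2)
  have h4 : HasFDerivAt (fun x => (trialFun θ κ n x : ℂ)) _ x := h3
  rw [dirDeriv, h4.fderiv]
  simp

theorem gradSq_trialFun (hκ : ContDiff ℝ ∞ κ) (n : ℕ) (x : ℝ × ℝ) :
    gradSq (fun x => (trialFun θ κ n x : ℂ)) x =
      (deriv κ x.1 * cutSin (n + 1) (smoothTransverse θ n x) -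
        sin θ * κ x.1 * deriv (cutSin (n + 1)) (smoothTransverse θ n x)) ^ 2 +
      (κ x.1 * deriv (cutSin (n + 1)) (smoothTransverse θ n x) *
        (x.2 / √(x.2 ^ 2 + (1 / (2 * ((n : ℝ) + 1))) ^ 2) * cos θ)) ^ 2 := by
  rw [gradSq, dirDeriv_trialFun hκ, dirDeriv_trialFun hκ, Complex.norm_real, Complex.norm_real,
    Real.norm_eq_abs, Real.norm_eq_abs, sq_abs, sq_abs]
  simp only []
  ring

/-- The limit of the energy density of the test functions. -/
def limitDensity (θ : ℝ) (κ : ℝ → ℝ) (y t : ℝ) : ℝ :=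
  (deriv κ y * sin t - sin θ * κ y * cos t) ^ 2 + (κ y * cos t * cos θ) ^ 2

theorem tendsto_smoothing_ratio {y : ℝ} (hy : y ≠ 0) :
    Tendsto (fun n : ℕ => (y / √(y ^ 2 + (1 / (2 * ((n : ℝ) + 1))) ^ 2)) ^ 2) atTop (𝓝 1) := by
  have h0 : Tendsto (fun n : ℕ => (1 / (2 * ((n : ℝ) + 1)))) atTop (𝓝 0) := by
    have := (tendsto_one_div_add_atTop_nhds_zero_nat (𝕜 := ℝ)).const_mul (1 / 2)
    rw [mul_zero] at this
    refine this.congr fun n => ?_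
    field_simp
  have h1 : Tendsto (fun n : ℕ => y ^ 2 / (y ^ 2 + (1 / (2 * ((n : ℝ) + 1))) ^ 2)) atTop
      (𝓝 (y ^ 2 / (y ^ 2 + 0 ^ 2))) :=
    tendsto_const_nhds.div ((h0.pow 2).const_add (y ^ 2)) (by positivity)
  have h2 : y ^ 2 / (y ^ 2 + 0 ^ 2) = 1 := by
    rw [zero_pow two_ne_zero, add_zero, div_self (by positivity)]
  rw [h2] at h1
  refine h1.congr fun n => ?_
  rw [div_pow y, sq_sqrt (smoothing_pos n y).le]

theorem tendsto_gradSq_trialFun (hθ : θ ∈ Set.Ioo 0 (π / 2)) (hκ : ContDiff ℝ ∞ κ) {x : ℝ × ℝ}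
    (hx : x ∈ (brokenGuide θ : Set (ℝ × ℝ))) (hx2 : x.2 ≠ 0) :
    Tendsto (fun n => gradSq (fun x => (trialFun θ κ n x : ℂ)) x) atTop
      (𝓝 (limitDensity θ κ x.1 (transverse θ x))) := by
  have ht : transverse θ x ∈ Set.Ioo 0 π := (mem_brokenGuide_iff hθ).1 hx
  have hT := tendsto_smoothTransverse hθ x
  have hg := tendsto_cutSin ht hT
  have hg' := tendsto_deriv_cutSin ht hT
  have h := (((hg.const_mul (deriv κ x.1)).sub (hg'.const_mul (sin θ * κ x.1))).pow 2).add
    (((hg'.const_mul (κ x.1)).pow 2).mul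
      ((tendsto_smoothing_ratio hx2).mul_const (cos θ ^ 2)))
  rw [one_mul, ← mul_pow] at h
  refine h.congr fun n => ?_
  rw [gradSq_trialFun hκ]
  ring

theorem tendsto_norm_sq_trialFun (hθ : θ ∈ Set.Ioo 0 (π / 2)) {x : ℝ × ℝ}
    (hx : x ∈ (brokenGuide θ : Set (ℝ × ℝ))) :
    Tendsto (fun n => ‖(trialFun θ κ n x : ℂ)‖ ^ 2) atTop
      (𝓝 ((κ x.1 * sin (transverse θ x)) ^ 2)) := by
  have ht : transverse θ x ∈ Set.Ioo 0 π := (mem_brokenGuide_iff hθ).1 hx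
  have h := ((tendsto_cutSin ht (tendsto_smoothTransverse hθ x)).const_mul (κ x.1)).pow 2
  refine h.congr fun n => ?_
  rw [Complex.norm_real, Real.norm_eq_abs, sq_abs, trialFun]

theorem gradSq_eq_zero_of_notMem {φ : ℝ × ℝ → ℂ} {x : ℝ × ℝ} (hx : x ∉ tsupport φ) :
    gradSq φ x = 0 := by
  have h : ∀ v, dirDeriv v φ x = 0 := fun v => by
    rw [dirDeriv, fderiv_of_notMem_tsupport ℝ hx]
    rfl
  simp [gradSq, h]

theorem exists_bound_trialFun (hκ : ContDiff ℝ ∞ κ) (θ R : ℝ) :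
    ∃ C : ℝ, ∀ n : ℕ, ∀ x ∈ box θ R, |gradSq (fun x => (trialFun θ κ n x : ℂ)) x| ≤ C ∧
      |‖(trialFun θ κ n x : ℂ)‖ ^ 2| ≤ C := by
  obtain ⟨B, hB0, hB⟩ := exists_deriv_cutSin_le
  obtain ⟨K, hK⟩ := isCompact_Icc.exists_bound_of_continuousOn
    (s := Set.Icc (-(π / sin θ)) R) hκ.continuous.continuousOn
  obtain ⟨K', hK'⟩ := isCompact_Icc.exists_bound_of_continuousOn
    (s := Set.Icc (-(π / sin θ)) R) (hκ.continuous_deriv (by simp)).continuousOn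
  refine ⟨(K' * 1 + 1 * K * B) ^ 2 + (K * B * (1 * 1)) ^ 2 + (K * 1) ^ 2, fun n x hx => ?_⟩
  have h1 : |κ x.1| ≤ K := hK _ hx.1
  have h2 : |deriv κ x.1| ≤ K' := hK' _ hx.1
  have hK0 : 0 ≤ K := (abs_nonneg _).trans h1
  have hK0' : 0 ≤ K' := (abs_nonneg _).trans h2
  have h3 := abs_cutSin_le (n + 1) (smoothTransverse θ n x)
  have h4 := hB (n + 1) (smoothTransverse θ n x) (by positivity)
  have h5 : |x.2 / √(x.2 ^ 2 + (1 / (2 * ((n : ℝ) + 1))) ^ 2)| ≤ 1 := by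
    rw [abs_div, abs_of_nonneg (sqrt_nonneg _), div_le_one (sqrt_pos.2 (smoothing_pos n x.2))]
    exact abs_le_sqrt (by linarith [sq_nonneg (1 / (2 * ((n : ℝ) + 1)))])
  have h6 := abs_sin_le_one θ
  have h7 := abs_cos_le_one θ
  have e1 : |κ x.1 * cutSin (n + 1) (smoothTransverse θ n x)| ≤ K * 1 := by
    rw [abs_mul]
    gcongr
  have e2 : |deriv κ x.1 * cutSin (n + 1) (smoothTransverse θ n x) -
      sin θ * κ x.1 * deriv (cutSin (n + 1)) (smoothTransverse θ n x)| ≤ K' * 1 + 1 * K * B := by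
    refine (abs_sub _ _).trans ?_
    rw [abs_mul, abs_mul, abs_mul]
    gcongr
  have e3 : |κ x.1 * deriv (cutSin (n + 1)) (smoothTransverse θ n x) *
      (x.2 / √(x.2 ^ 2 + (1 / (2 * ((n : ℝ) + 1))) ^ 2) * cos θ)| ≤ K * B * (1 * 1) := by
    rw [abs_mul, abs_mul, abs_mul _ (cos θ)]
    gcongr
  have f1 := pow_le_pow_left₀ (abs_nonneg _) e1 2
  have f2 := pow_le_pow_left₀ (abs_nonneg _) e2 2
  have f3 := pow_le_pow_left₀ (abs_nonneg _) e3 2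
  rw [sq_abs] at f1 f2 f3
  constructor
  · rw [abs_of_nonneg (gradSq_nonneg _ _), gradSq_trialFun hκ]
    linarith [sq_nonneg (K * 1)]
  · rw [abs_of_nonneg (sq_nonneg _), Complex.norm_real, Real.norm_eq_abs, sq_abs, trialFun]
    linarith [sq_nonneg (K' * 1 + 1 * K * B), sq_nonneg (K * B * (1 * 1))]

/-- Pointwise convergence of the gradients is proved off the axis `x₂ = 0`, where `|x₂|` is smooth.
-/
theorem ae_snd_ne_zero : ∀ᵐ x : ℝ × ℝ, x.2 ≠ 0 := by
  have h : (Set.univ : Set ℝ) ×ˢ ({0} : Set ℝ) = {x : ℝ × ℝ | ¬ x.2 ≠ 0} := by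
    ext x
    simp
  rw [ae_iff, ← h, Measure.volume_eq_prod, Measure.prod_prod]
  simp

theorem tendsto_integral_trialFun {f : ℕ → ℝ × ℝ → ℝ} {F : ℝ × ℝ → ℝ} {C : ℝ}
    (hf : ∀ n, Continuous (f n)) (hsupp : ∀ n, ∀ x, f n x ≠ 0 →
      x ∈ (brokenGuide θ : Set (ℝ × ℝ)) ∩ box θ R)
    (hC : ∀ n, ∀ x ∈ box θ R, |f n x| ≤ C)
    (hlim : ∀ x ∈ (brokenGuide θ : Set (ℝ × ℝ)), x.2 ≠ 0 →
      Tendsto (fun n => f n x) atTop (𝓝 (F x))) :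
    Tendsto (fun n => ∫ x, f n x) atTop
      (𝓝 (∫ x in box θ R, (brokenGuide θ : Set (ℝ × ℝ)).indicator F x)) := by
  have hbox : ∀ n, ∫ x, f n x = ∫ x in box θ R, f n x := fun n =>
    (setIntegral_eq_integral_of_forall_compl_eq_zero fun x hx => by
      by_contra h
      exact hx (hsupp n x h).2).symm
  simp only [hbox]
  refine tendsto_integral_of_dominated_convergence (fun _ => C)
    (fun n => (hf n).aestronglyMeasurable) ?_ (fun n => ?_) ?_
  · exact integrableOn_const (isCompact_box θ R).measure_lt_top.ne
  · exact (ae_restrict_iff' (isCompact_box θ R).measurableSet).2 (ae_of_all _ fun x hx => hC n x hx)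
  · refine ae_restrict_of_ae ?_
    filter_upwards [ae_snd_ne_zero] with x hx
    by_cases hΩ : x ∈ (brokenGuide θ : Set (ℝ × ℝ))
    · rw [Set.indicator_of_mem hΩ]
      exact hlim x hΩ hx
    · rw [Set.indicator_of_notMem hΩ]
      refine tendsto_const_nhds.congr fun n => ?_
      by_contra h
      exact hΩ (hsupp n x (Ne.symm h)).1

theorem integral_Ioi_indicator_comp {c d : ℝ} (hc : 0 < c) (hd : -d ≤ π) (h : ℝ → ℝ) :
    ∫ y in Set.Ioi 0, (Set.Ioo 0 π).indicator h (y * c - d) =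
      c⁻¹ * ∫ t in (max 0 (-d))..π, h t := by
  set F := (Set.Ioo 0 π).indicator h with hF
  have h1 := integral_comp_mul_left_Ioi (fun u => F (u - d)) 0 hc
  rw [mul_zero, smul_eq_mul] at h1
  simp only [mul_comm c] at h1
  rw [h1]
  have h2 := (measurePreserving_sub_right (volume : Measure ℝ) d).setIntegral_preimage_emb
    (MeasurableEquiv.subRight d).measurableEmbedding F (Set.Ioi (-d))
  have h3 : (fun u : ℝ => u - d) ⁻¹' Set.Ioi (-d) = Set.Ioi 0 := by
    ext u
    simp
  rw [h3] at h2
  have h4 : Set.Ioi (-d) ∩ Set.Ioo 0 π = Set.Ioo (max 0 (-d)) π := by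
    ext t
    simp only [Set.mem_inter_iff, Set.mem_Ioi, Set.mem_Ioo, max_lt_iff]
    tauto
  rw [h2, hF, setIntegral_indicator measurableSet_Ioo, h4,
    intervalIntegral.integral_of_le (max_le pi_pos.le hd), integral_Ioc_eq_integral_Ioo]

/-- On a vertical line the integrand is even in `x₂`, whence the factor 2, and the substitution `t =
x₂ cos θ - y sin θ` gives `1 / cos θ`. In the corner, where `y < 0`, the coordinate `t` starts at
`-y sin θ` instead of 0. -/
theorem integral_box_indicator (hθ : θ ∈ Set.Ioo 0 (π / 2)) {h : ℝ → ℝ → ℝ}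
    (hh : Continuous (Function.uncurry h)) :
    ∫ x in box θ R, (brokenGuide θ : Set (ℝ × ℝ)).indicator
        (fun x => h x.1 (transverse θ x)) x =
      2 / cos θ * ∫ y in Set.Icc (-(π / sin θ)) R, ∫ t in (max 0 (-(y * sin θ)))..π, h y t := by
  have hc := cos_pos_of_mem hθ
  have hs := sin_pos_of_mem hθ
  have htr : Continuous (transverse θ) :=
    (continuous_snd.abs.mul continuous_const).sub (continuous_fst.mul continuous_const)
  have hcont : Continuous fun x : ℝ × ℝ => h x.1 (transverse θ x) :=
    hh.comp (continuous_fst.prodMk htr)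
  have hint : IntegrableOn ((brokenGuide θ : Set (ℝ × ℝ)).indicator
      (fun x => h x.1 (transverse θ x))) (box θ R) (volume.prod volume) :=
    IntegrableOn.indicator (hcont.continuousOn.integrableOn_compact (isCompact_box θ R))
      (brokenGuide θ).isOpen.measurableSet
  rw [Measure.volume_eq_prod, box, setIntegral_prod _ hint, ← integral_const_mul]
  refine setIntegral_congr_fun measurableSet_Icc fun y hy => ?_
  have hyd : -(y * sin θ) ≤ π := by
    have := hy.1
    rw [← neg_div, div_le_iff₀ hs] at this
    linarith
  have e1 : ∀ z : ℝ, (brokenGuide θ : Set (ℝ × ℝ)).indicator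
      (fun x => h x.1 (transverse θ x)) (y, z) =
      (Set.Ioo 0 π).indicator (h y) (|z| * cos θ - y * sin θ) := fun z => by
    by_cases hm : (y, z) ∈ (brokenGuide θ : Set (ℝ × ℝ))
    · have hm' : |z| * cos θ - y * sin θ ∈ Set.Ioo 0 π := (mem_brokenGuide_iff hθ).1 hm
      rw [Set.indicator_of_mem hm, Set.indicator_of_mem hm']
      rfl
    · have hm' : |z| * cos θ - y * sin θ ∉ Set.Ioo 0 π :=
        fun h' => hm ((mem_brokenGuide_iff hθ).2 h')
      rw [Set.indicator_of_notMem hm, Set.indicator_of_notMem hm']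
  simp only [e1]
  rw [setIntegral_eq_integral_of_forall_compl_eq_zero (fun z hz => ?_),
    integral_comp_abs (f := fun z => (Set.Ioo 0 π).indicator (h y) (z * cos θ - y * sin θ)),
    integral_Ioi_indicator_comp hc hyd, div_eq_mul_inv, mul_assoc]
  refine Set.indicator_of_notMem (fun hm => hz ?_) _
  exact (mem_box_of_transverse_le (x := (y, z)) hθ (le_of_lt hm.2) hy.2).2

end Trial

/-! ### Reduction to one-dimensional profiles, and bumps along the arms -/

section Rayleigh

open Real

variable {θ : ℝ} {κ : ℝ → ℝ} {R : ℝ}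

/-- The smallest transverse coordinate of the points of the guide with first coordinate `y`. -/
def lowestTransverse (θ y : ℝ) : ℝ := max 0 (-(y * sin θ))

/-- The integral of `sin ^ 2` over the transverse coordinates above `lowestTransverse θ y`. -/
def sliceMass (θ y : ℝ) : ℝ :=
  (π - lowestTransverse θ y + sin (lowestTransverse θ y) * cos (lowestTransverse θ y)) / 2

/-- The integral of the limit energy density over a vertical slice. -/
def sliceEnergy (θ : ℝ) (κ : ℝ → ℝ) (y : ℝ) : ℝ :=
  deriv κ y ^ 2 * sliceMass θ y +
    sin θ * (κ y * deriv κ y) * sin (lowestTransverse θ y) ^ 2 +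
    κ y ^ 2 * (sliceMass θ y - sin (lowestTransverse θ y) * cos (lowestTransverse θ y))

theorem continuous_lowestTransverse (θ : ℝ) : Continuous (lowestTransverse θ) := by
  unfold lowestTransverse
  fun_prop

theorem continuous_sliceMass (θ : ℝ) : Continuous (sliceMass θ) := by
  have := continuous_lowestTransverse θ
  unfold sliceMass
  fun_prop

theorem continuous_sliceEnergy (hκ : ContDiff ℝ ∞ κ) : Continuous (sliceEnergy θ κ) := by
  have h1 := continuous_lowestTransverse θ
  have h2 := continuous_sliceMass θ
  have h3 := hκ.continuous
  have h4 : Continuous (deriv κ) := hκ.continuous_deriv (by simp)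
  unfold sliceEnergy
  fun_prop

theorem integral_limitDensity (y : ℝ) :
    ∫ t in (max 0 (-(y * sin θ)))..π, limitDensity θ κ y t = sliceEnergy θ κ y := by
  have e : ∀ t, limitDensity θ κ y t = deriv κ y ^ 2 * sin t ^ 2 +
      (-2 * sin θ * (κ y * deriv κ y)) * (sin t * cos t) + κ y ^ 2 * cos t ^ 2 := fun t => by
    unfold limitDensity
    linear_combination κ y ^ 2 * cos t ^ 2 * sin_sq_add_cos_sq θ
  simp only [e]
  rw [intervalIntegral.integral_add, intervalIntegral.integral_add,
    intervalIntegral.integral_const_mul, intervalIntegral.integral_const_mul,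
    intervalIntegral.integral_const_mul, integral_sin_sq, integral_cos_sq,
    integral_sin_mul_cos₁]
  · simp only [sliceEnergy, sliceMass, lowestTransverse, sin_pi]
    ring
  all_goals exact Continuous.intervalIntegrable (by fun_prop) _ _

theorem integral_sq_mul_sin (y : ℝ) :
    ∫ t in (max 0 (-(y * sin θ)))..π, (κ y * sin t) ^ 2 = κ y ^ 2 * sliceMass θ y := by
  simp only [mul_pow]
  rw [intervalIntegral.integral_const_mul, integral_sin_sq]
  simp only [sliceMass, lowestTransverse, sin_pi]
  ring

theorem tendsto_integral_gradSq_trialFun (hθ : θ ∈ Set.Ioo 0 (π / 2)) (hκ : ContDiff ℝ ∞ κ)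
    (hR : ∀ x, R ≤ x → κ x = 0) :
    Tendsto (fun n => ∫ x, gradSq (fun x => (trialFun θ κ n x : ℂ)) x) atTop
      (𝓝 (2 / cos θ * ∫ y in Set.Icc (-(π / sin θ)) R, sliceEnergy θ κ y)) := by
  obtain ⟨C, hC⟩ := exists_bound_trialFun hκ θ R
  have hcont : Continuous (Function.uncurry (limitDensity θ κ)) := by
    have h3 := hκ.continuous
    have h4 : Continuous (deriv κ) := hκ.continuous_deriv (by simp)
    unfold limitDensity Function.uncurry
    fun_prop
  have h := tendsto_integral_trialFun (θ := θ) (R := R)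
    (f := fun n => gradSq (fun x => (trialFun θ κ n x : ℂ)))
    (F := fun x => limitDensity θ κ x.1 (transverse θ x))
    (fun n => continuous_gradSq ((isTest_trialFun hθ hκ hR n).smooth.of_le (by simp)))
    (fun n x hx => tsupport_trialFun_subset' hθ hR n (tsupport_ofReal_trialFun_subset n (by
      by_contra h
      exact hx (gradSq_eq_zero_of_notMem h))))
    (fun n x hx => (hC n x hx).1) (fun x hx hx2 => tendsto_gradSq_trialFun hθ hκ hx hx2)
  rw [integral_box_indicator hθ hcont] at h
  simpa only [integral_limitDensity] using h

theorem tendsto_integral_norm_sq_trialFun (hθ : θ ∈ Set.Ioo 0 (π / 2)) (hκ : ContDiff ℝ ∞ κ)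
    (hR : ∀ x, R ≤ x → κ x = 0) :
    Tendsto (fun n => ∫ x, ‖(trialFun θ κ n x : ℂ)‖ ^ 2) atTop
      (𝓝 (2 / cos θ * ∫ y in Set.Icc (-(π / sin θ)) R, κ y ^ 2 * sliceMass θ y)) := by
  obtain ⟨C, hC⟩ := exists_bound_trialFun hκ θ R
  have hcont : Continuous (Function.uncurry fun y t : ℝ => (κ y * sin t) ^ 2) := by
    have h3 := hκ.continuous
    unfold Function.uncurry
    fun_prop
  have h := tendsto_integral_trialFun (θ := θ) (R := R)
    (f := fun n x => ‖(trialFun θ κ n x : ℂ)‖ ^ 2)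
    (F := fun x => (κ x.1 * sin (transverse θ x)) ^ 2)
    (fun n => (isTest_trialFun hθ hκ hR n).smooth.continuous.norm.pow 2)
    (fun n x hx => tsupport_trialFun_subset' hθ hR n (subset_tsupport _ (by
      intro h0
      simp [h0] at hx)))
    (fun n x hx => (hC n x hx).2) (fun x hx _ => tendsto_norm_sq_trialFun hθ hx)
  rw [integral_box_indicator hθ hcont] at h
  simpa only [integral_sq_mul_sin] using h

/-- Every later estimate of energy is reduced to a one-dimensional inequality for `κ`: a strict
inequality between the limits already holds for some test function of the sequence. -/
theorem exists_test_of_slice_lt (hθ : θ ∈ Set.Ioo 0 (π / 2)) (hκ : ContDiff ℝ ∞ κ)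
    (hR : ∀ x, R ≤ x → κ x = 0) {C : ℝ}
    (hlt : ∫ y in Set.Icc (-(π / sin θ)) R, sliceEnergy θ κ y <
      C * ∫ y in Set.Icc (-(π / sin θ)) R, κ y ^ 2 * sliceMass θ y) :
    ∃ φ, ∃ hφ : IsTest (brokenGuide θ) φ, tsupport φ ⊆ {x | x.1 ∈ tsupport κ} ∧
      quad (dirichletLaplacian (brokenGuide θ)) hφ.toDomain < C * ‖hφ.toL2‖ ^ 2 := by
  have hc : 0 < 2 / cos θ := div_pos two_pos (cos_pos_of_mem hθ)
  have h1 := tendsto_integral_gradSq_trialFun hθ hκ hR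
  have h2 := (tendsto_integral_norm_sq_trialFun hθ hκ hR).const_mul C
  have h3 := h1.eventually_lt h2 (by
    have := mul_lt_mul_of_pos_left hlt hc
    linarith)
  obtain ⟨n, hn⟩ := h3.exists
  refine ⟨_, isTest_trialFun hθ hκ hR n, fun x hx =>
    (tsupport_trialFun_subset hR n (tsupport_ofReal_trialFun_subset n hx)).1, ?_⟩
  rw [IsTest.quad_toDomain, ← (isTest_trialFun hθ hκ hR n).integral_gradSq, IsTest.norm_toL2_sq]
  exact hn

theorem sliceEnergy_of_nonneg {y : ℝ} (hθ : θ ∈ Set.Ioo 0 (π / 2)) (hy : 0 ≤ y) :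
    sliceEnergy θ κ y = (deriv κ y ^ 2 + κ y ^ 2) * (π / 2) ∧ sliceMass θ y = π / 2 := by
  have h0 : lowestTransverse θ y = 0 :=
    max_eq_left (neg_nonpos.2 (mul_nonneg hy (sin_pos_of_mem hθ).le))
  have h1 : sliceMass θ y = π / 2 := by simp [sliceMass, h0]
  refine ⟨?_, h1⟩
  rw [sliceEnergy, h1, h0, sin_zero]
  ring

theorem integral_comp_div_sub {L a : ℝ} (hL : 0 < L) (g : ℝ → ℝ) :
    ∫ y, g (y / L - a) = L * ∫ u, g u := by
  rw [Measure.integral_comp_div (fun u => g (u - a)) L, integral_sub_right_eq_self g a,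
    abs_of_pos hL, smul_eq_mul]

theorem exists_high_test (hθ : θ ∈ Set.Ioo 0 (π / 2)) {C : ℝ} (hC : 1 < C) :
    ∃ L > 0, ∀ i : ℕ, ∃ φ, ∃ hφ : IsTest (brokenGuide θ) φ,
      tsupport φ ⊆ {x | x.1 / L - i ∈ Set.Icc (1 / 4 : ℝ) (3 / 4)} ∧
      quad (dirichletLaplacian (brokenGuide θ)) hφ.toDomain < C * ‖hφ.toL2‖ ^ 2 := by
  -- The support `[1 / 4, 3 / 4]` has disjoint integer translates, and those by `i ≥ 0` stay in `y >
  -- 0`, away from the corner.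
  let k : ContDiffBump (1 / 2 : ℝ) := ⟨1 / 8, 1 / 4, by norm_num, by norm_num⟩
  have hk : ContDiff ℝ ∞ k := k.contDiff
  have hts : tsupport k = Set.Icc (1 / 4 : ℝ) (3 / 4) := by
    rw [k.tsupport_eq, Real.closedBall_eq_Icc]
    norm_num
  have hk0 : ∀ u, u ∉ Set.Icc (1 / 4 : ℝ) (3 / 4) → k u = 0 ∧ deriv k u = 0 := fun u hu => by
    rw [← hts] at hu
    exact ⟨image_eq_zero_of_notMem_tsupport hu, deriv_of_notMem_tsupport hu⟩
  set K0 := ∫ u, k u ^ 2 with hK0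
  set K1 := ∫ u, deriv k u ^ 2 with hK1
  have hK0pos : 0 < K0 := by
    have hcont : Continuous fun u => k u ^ 2 := hk.continuous.pow 2
    refine hcont.integral_pos_of_hasCompactSupport_nonneg_nonzero
      (k.hasCompactSupport.comp_left (g := fun r : ℝ => r ^ 2) (by simp)) (fun u => sq_nonneg _)
      (x := 1 / 2) ?_
    have : k (1 / 2) = 1 := k.one_of_mem_closedBall (by simp [k])
    rw [this]
    norm_num
  have hK1nn : 0 ≤ K1 := integral_nonneg fun u => sq_nonneg _
  -- Up to the factor `π / 2`, stretching by `L` gives energy `K1 / L + L * K0` and mass `L * K0`,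
  -- so `K1 / L < (C - 1) * K0 * L` is needed. The summand 1 gives `L ≥ 1` and makes the inequality
  -- strict.
  set L := 1 + K1 / ((C - 1) * K0) with hL
  have hCK : 0 < (C - 1) * K0 := mul_pos (by linarith) hK0pos
  have hL1 : 1 ≤ L := by
    rw [hL]
    linarith [div_nonneg hK1nn hCK.le]
  have hL0 : 0 < L := by linarith
  refine ⟨L, hL0, fun i => ?_⟩
  set κ : ℝ → ℝ := fun y => k (y / L - i) with hκdef
  have hκ : ContDiff ℝ ∞ κ := hk.comp ((contDiff_id.div_const L).sub contDiff_const)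
  have hderiv : ∀ y, deriv κ y = deriv k (y / L - i) * (1 / L) := fun y => by
    have h1 : HasDerivAt (fun y : ℝ => y / L - i) (1 / L) y :=
      ((hasDerivAt_id y).div_const L).sub_const _
    exact ((hk.differentiable (by simp) _).hasDerivAt.comp y h1).deriv
  have hi0 : (0 : ℝ) ≤ i := Nat.cast_nonneg i
  have hout : ∀ y, y / L - i ∈ Set.Icc (1 / 4 : ℝ) (3 / 4) → 0 < y ∧ y ≤ L * (i + 1) := by
    intro y hy
    have h1 : 0 < y / L := by linarith [hy.1]
    have h2 : y / L ≤ i + 1 := by linarith [hy.2]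
    rw [div_le_iff₀ hL0] at h2
    have h3 : 0 < y := by
      have := mul_pos h1 hL0
      rwa [div_mul_cancel₀ _ hL0.ne'] at this
    exact ⟨h3, by linarith⟩
  have hR : ∀ y, L * (i + 1) ≤ y → κ y = 0 := fun y hy => by
    refine (hk0 _ fun h => ?_).1
    have h1 : (i : ℝ) + 1 ≤ y / L := by
      rw [le_div_iff₀ hL0]
      linarith
    linarith [h.2]
  have hE : ∀ y, sliceEnergy θ κ y = (deriv κ y ^ 2 + κ y ^ 2) * (π / 2) ∧
      κ y ^ 2 * sliceMass θ y = κ y ^ 2 * (π / 2) := fun y => by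
    by_cases hy : y / L - i ∈ Set.Icc (1 / 4 : ℝ) (3 / 4)
    · have := sliceEnergy_of_nonneg (κ := κ) hθ (hout y hy).1.le
      exact ⟨this.1, by rw [this.2]⟩
    · have h1 : κ y = 0 := (hk0 _ hy).1
      have h2 : deriv κ y = 0 := by rw [hderiv, (hk0 _ hy).2, zero_mul]
      rw [sliceEnergy, h1, h2]
      constructor <;> ring
  have hpos := div_pos pi_pos (sin_pos_of_mem hθ)
  have hset : ∀ g : ℝ → ℝ, (∀ u, u ∉ Set.Icc (1 / 4 : ℝ) (3 / 4) → g u = 0) →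
      ∫ y in Set.Icc (-(π / sin θ)) (L * (i + 1)), g (y / L - i) = L * ∫ u, g u := fun g hg => by
    rw [← integral_comp_div_sub hL0 (a := i)]
    refine setIntegral_eq_integral_of_forall_compl_eq_zero fun y hy => hg _ fun h => hy ?_
    obtain ⟨h1, h2⟩ := hout y h
    exact ⟨by linarith, h2⟩
  have hIE : ∫ y in Set.Icc (-(π / sin θ)) (L * (i + 1)), sliceEnergy θ κ y =
      (K1 / L + L * K0) * (π / 2) := by
    have e : ∀ y, sliceEnergy θ κ y =
        (fun u => (deriv k u ^ 2 * (1 / L) ^ 2 + k u ^ 2) * (π / 2)) (y / L - i) := fun y => by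
      rw [(hE y).1, hderiv, mul_pow]
    have hi1 : Integrable fun u => deriv k u ^ 2 * (1 / L) ^ 2 := by
      refine Integrable.mul_const ?_ _
      refine Continuous.integrable_of_hasCompactSupport
        ((hk.continuous_deriv (by simp)).pow 2) ?_
      exact (k.hasCompactSupport.deriv).comp_left (g := fun r : ℝ => r ^ 2) (by simp)
    have hi2 : Integrable fun u => k u ^ 2 :=
      Continuous.integrable_of_hasCompactSupport (hk.continuous.pow 2)
        (k.hasCompactSupport.comp_left (g := fun r : ℝ => r ^ 2) (by simp))
    refine (setIntegral_congr_fun measurableSet_Icc fun y _ => e y).trans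
      ((hset (fun u => (deriv k u ^ 2 * (1 / L) ^ 2 + k u ^ 2) * (π / 2)) fun u hu => ?_).trans ?_)
    · simp only [(hk0 u hu).1, (hk0 u hu).2]
      ring
    rw [integral_mul_const, integral_add hi1 hi2, integral_mul_const, ← hK0, ← hK1]
    field_simp
  have hIM : ∫ y in Set.Icc (-(π / sin θ)) (L * (i + 1)), κ y ^ 2 * sliceMass θ y =
      L * K0 * (π / 2) := by
    have e : ∀ y, κ y ^ 2 * sliceMass θ y = (fun u => k u ^ 2 * (π / 2)) (y / L - i) :=
      fun y => (hE y).2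
    refine (setIntegral_congr_fun measurableSet_Icc fun y _ => e y).trans
      ((hset (fun u => k u ^ 2 * (π / 2)) fun u hu => ?_).trans ?_)
    · simp only [(hk0 u hu).1]
      ring
    rw [integral_mul_const]
    ring
  obtain ⟨φ, hφ, hsupp, hq⟩ := exists_test_of_slice_lt hθ hκ hR (C := C) (by
    rw [hIE, hIM, ← mul_assoc]
    refine mul_lt_mul_of_pos_right ?_ (by positivity)
    have h1 : K1 < (C - 1) * K0 * L := by
      rw [hL, mul_add, mul_div_cancel₀ _ hCK.ne']
      linarith
    have h2 : K1 / L ≤ K1 := div_le_self hK1nn hL1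
    linarith)
  refine ⟨φ, hφ, fun x hx => ?_, hq⟩
  have h1 : x.1 ∈ tsupport κ := hsupp hx
  have h2 := tsupport_comp_subset_preimage (f := fun y : ℝ => y / L - i) k (by fun_prop) h1
  rw [hts] at h2
  exact h2

theorem laplacian_eq_zero_of_notMem {φ : ℝ × ℝ → ℂ} {x : ℝ × ℝ} (hx : x ∉ tsupport φ) :
    laplacian φ x = 0 := by
  have h : ∀ v, dirDeriv v (dirDeriv v φ) x = 0 := fun v =>
    image_eq_zero_of_notMem_tsupport fun h =>
      hx (tsupport_fderiv_apply_subset ℝ v (tsupport_fderiv_apply_subset ℝ v h))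
  rw [laplacian, h, h, add_zero]

/-- Disjoint supports give orthogonality both in `L²` and for the form, because the Laplacian does
not enlarge supports. -/
theorem exists_high (hθ : θ ∈ Set.Ioo 0 (π / 2)) (C : ℝ) (hC : C > 1) (N : ℕ) :
    ∃ u : Fin N → (dirichletLaplacian (brokenGuide θ)).domain,
      (∀ i j, i ≠ j → inner ℂ (u i : L2 (brokenGuide θ)) (u j : L2 (brokenGuide θ)) = 0 ∧
        inner ℂ (dirichletLaplacian (brokenGuide θ) (u i)) (u j : L2 (brokenGuide θ)) = 0) ∧
      ∀ i, quad (dirichletLaplacian (brokenGuide θ)) (u i) <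
        C * ‖(u i : L2 (brokenGuide θ))‖ ^ 2 := by
  obtain ⟨L, hL, h⟩ := exists_high_test hθ hC
  choose φ hφ hsupp hq using h
  have hdisj : ∀ i j : Fin N, i ≠ j → ∀ x, x ∉ tsupport (φ i) ∨ x ∉ tsupport (φ j) := by
    intro i j hij x
    by_contra! hx
    have h1 := hsupp i hx.1
    have h2 := hsupp j hx.2
    simp only [Set.mem_ofPred_eq, Set.mem_Icc] at h1 h2
    have hij' : ((i : ℕ) : ℤ) ≠ ((j : ℕ) : ℤ) := by
      intro h
      exact hij (Fin.ext (by exact_mod_cast h))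
    rcases lt_or_gt_of_ne hij' with hlt | hlt
    · have : (((i : ℕ) : ℝ)) + 1 ≤ ((j : ℕ) : ℝ) := by exact_mod_cast hlt
      linarith [h1.1, h2.2]
    · have : (((j : ℕ) : ℝ)) + 1 ≤ ((i : ℕ) : ℝ) := by exact_mod_cast hlt
      linarith [h1.1, h2.2]
  refine ⟨fun i => (hφ i).toDomain, fun i j hij => ⟨?_, ?_⟩, fun i => hq i⟩
  · refine (hφ i).inner_toL2_eq_zero (hφ j) fun x => ?_
    exact (hdisj i j hij x).imp image_eq_zero_of_notMem_tsupport image_eq_zero_of_notMem_tsupport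
  · rw [(hφ i).apply_toDomain, inner_neg_left, neg_eq_zero]
    refine (hφ i).laplacian.inner_toL2_eq_zero (hφ j) fun x => ?_
    exact (hdisj i j hij x).imp laplacian_eq_zero_of_notMem image_eq_zero_of_notMem_tsupport

end Rayleigh

/-! ### A trial function below the threshold -/

section Trial

open Real

variable {θ : ℝ}

/-- A perturbation of the constant profile, supported in the corner of the guide. -/
def cornerProfile (s y : ℝ) : ℝ := smoothTransition (-y) * cos (y * s)

/-- The derivative of `cornerProfile s`. -/
def cornerSlope (s y : ℝ) : ℝ :=
  -deriv smoothTransition (-y) * cos (y * s) + smoothTransition (-y) * (-sin (y * s) * s)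

theorem hasDerivAt_cornerProfile (s y : ℝ) :
    HasDerivAt (cornerProfile s) (cornerSlope s y) y := by
  have h1 : HasDerivAt (fun y => smoothTransition (-y)) (-deriv smoothTransition (-y)) y := by
    exact ((hasDerivAt_smoothTransition (-y)).comp y (hasDerivAt_neg y)).congr_deriv (by simp)
  have h2 : HasDerivAt (fun y => cos (y * s)) (-sin (y * s) * s) y := by
    simpa using ((hasDerivAt_id y).mul_const s).cos
  exact h1.mul h2

theorem contDiff_cornerProfile (s : ℝ) : ContDiff ℝ ∞ (cornerProfile s) :=
  (smoothTransition.contDiff.comp contDiff_neg).mul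
    (contDiff_cos.comp (contDiff_id.mul contDiff_const))

theorem continuous_cornerSlope (s : ℝ) : Continuous (cornerSlope s) := by
  have h : cornerSlope s = deriv (cornerProfile s) :=
    funext fun y => (hasDerivAt_cornerProfile s y).deriv.symm
  rw [h]
  exact (contDiff_cornerProfile s).continuous_deriv (by simp)

/-- This is the energy excess of the constant profile in the corner. It vanishes, so the sign must
come from a first-order perturbation. -/
theorem integral_sin_mul_cos_corner {s : ℝ} (hs : 0 < s) :
    ∫ y in -(π / s)..0, sin (y * s) * cos (y * s) = 0 := by
  have h : ∀ y ∈ Set.uIcc (-(π / s)) 0,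
      HasDerivAt (fun y => sin (y * s) ^ 2 / (2 * s)) (sin (y * s) * cos (y * s)) y := by
    intro y _
    have h1 : HasDerivAt (fun y => sin (y * s)) (cos (y * s) * s) y := by
      simpa using ((hasDerivAt_id y).mul_const s).sin
    refine ((h1.fun_pow 2).div_const (2 * s)).congr_deriv ?_
    push_cast
    field_simp
  rw [intervalIntegral.integral_eq_sub_of_hasDerivAt h
    (Continuous.intervalIntegrable (by fun_prop) _ _)]
  simp [div_mul_cancel₀ _ hs.ne']

/-- Integrating the slope term by parts leaves no boundary contribution, as `sin (y * s)` vanishes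
at both ends. What remains is the pairing of the perturbation with the kink of the trial function on
the axis. -/
theorem integral_linear_corner {s : ℝ} (hs : 0 < s) :
    ∫ y in -(π / s)..0, (s * cornerSlope s y * sin (y * s) ^ 2 +
        2 * cornerProfile s y * (sin (y * s) * cos (y * s))) =
      2 * (1 - s ^ 2) * ∫ y in -(π / s)..0, cornerProfile s y * (sin (y * s) * cos (y * s)) := by
  have hk := (contDiff_cornerProfile s).continuous
  have hk' := continuous_cornerSlope s
  have h : ∀ y ∈ Set.uIcc (-(π / s)) 0,
      HasDerivAt (fun y => s * cornerProfile s y * sin (y * s) ^ 2)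
        (s * cornerSlope s y * sin (y * s) ^ 2 +
          2 * s ^ 2 * (cornerProfile s y * (sin (y * s) * cos (y * s)))) y := by
    intro y _
    have h1 : HasDerivAt (fun y => sin (y * s)) (cos (y * s) * s) y := by
      simpa using ((hasDerivAt_id y).mul_const s).sin
    refine (((hasDerivAt_cornerProfile s y).const_mul s).fun_mul (h1.fun_pow 2)).congr_deriv ?_
    push_cast
    ring
  have h0 := intervalIntegral.integral_eq_sub_of_hasDerivAt h
    (Continuous.intervalIntegrable (by fun_prop) _ _)
  have h1 : (∫ y in -(π / s)..0, (s * cornerSlope s y * sin (y * s) ^ 2 +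
      2 * s ^ 2 * (cornerProfile s y * (sin (y * s) * cos (y * s))))) = 0 := by
    rw [h0]
    simp [div_mul_cancel₀ _ hs.ne']
  refine (sub_eq_self.2 h1).symm.trans ?_
  rw [← intervalIntegral.integral_sub
    (Continuous.intervalIntegrable (by fun_prop) _ _)
    (Continuous.intervalIntegrable (by fun_prop) _ _), ← intervalIntegral.integral_const_mul]
  congr 1
  ext y
  ring

/-- The factor `cos` in `cornerProfile` is chosen for this: it turns `sin * cos`, which changes
sign, into `sin * cos²`, which is nonpositive on the corner. -/
theorem integral_cornerProfile_neg {s : ℝ} (hs : 0 < s) :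
    ∫ y in -(π / s)..0, cornerProfile s y * (sin (y * s) * cos (y * s)) < 0 := by
  have hk := (contDiff_cornerProfile s).continuous
  have hps : 0 < π / s := div_pos pi_pos hs
  have hmul : ∀ y, -(π / s) ≤ y → -π ≤ y * s := fun y hy => by
    have := mul_le_mul_of_nonneg_right hy hs.le
    rwa [neg_mul, div_mul_cancel₀ _ hs.ne'] at this
  have e : ∀ y, -(cornerProfile s y * (sin (y * s) * cos (y * s))) =
      smoothTransition (-y) * cos (y * s) ^ 2 * -sin (y * s) := fun y => by
    rw [cornerProfile]
    ring
  rw [← neg_pos, ← intervalIntegral.integral_neg]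
  refine intervalIntegral.integral_pos (by linarith) (by fun_prop) (fun y hy => ?_)
    ⟨-(π / (4 * s)), ⟨?_, ?_⟩, ?_⟩
  · rw [e]
    exact mul_nonneg (mul_nonneg (smoothTransition.nonneg _) (sq_nonneg _))
      (neg_nonneg.2 (sin_nonpos_of_nonpos_of_neg_pi_le
        (mul_nonpos_of_nonpos_of_nonneg hy.2 hs.le) (hmul y hy.1.le)))
  · rw [neg_le_neg_iff]
    exact div_le_div_of_nonneg_left pi_pos.le hs (by linarith)
  · exact neg_nonpos.2 (by positivity)
  · have h4 : -(π / (4 * s)) * s = -(π / 4) := by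
      field_simp
    rw [e, h4, sin_neg, cos_neg, neg_neg, neg_neg, sin_pi_div_four, cos_pi_div_four]
    have := smoothTransition.pos_of_pos (x := π / (4 * s)) (by positivity)
    positivity

/-- A plateau of length `r` with a small perturbation in the corner. -/
def plateau (s τ r y : ℝ) : ℝ := smoothTransition (2 - y / r) + τ * cornerProfile s y

theorem contDiff_plateau (s τ r : ℝ) : ContDiff ℝ ∞ (plateau s τ r) :=
  (smoothTransition.contDiff.comp (contDiff_const.sub (contDiff_id.div_const r))).add
    (contDiff_const.mul (contDiff_cornerProfile s))

theorem deriv_plateau (s τ r y : ℝ) : deriv (plateau s τ r) y =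
    deriv smoothTransition (2 - y / r) * -(1 / r) + τ * cornerSlope s y := by
  have h1 : HasDerivAt (fun y => 2 - y / r) (-(1 / r)) y :=
    ((hasDerivAt_id y).div_const r).const_sub 2
  exact (((hasDerivAt_smoothTransition _).comp y h1).add
    ((hasDerivAt_cornerProfile s y).const_mul τ)).deriv

theorem plateau_eq_zero {s τ r y : ℝ} (hr : 0 < r) (hy : 2 * r ≤ y) : plateau s τ r y = 0 := by
  have h1 : 2 ≤ y / r := (le_div_iff₀ hr).2 hy
  have h2 : 0 ≤ y := by linarith
  rw [plateau, cornerProfile, smoothTransition.zero_of_nonpos (by linarith),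
    smoothTransition.zero_of_nonpos (by linarith)]
  ring

/-- The coefficient of `τ ^ 2` in the energy excess of `plateau (sin θ) τ r` over a slice. -/
def cornerQuad (θ y : ℝ) : ℝ :=
  cornerSlope (sin θ) y ^ 2 * sliceMass θ y +
    sin θ * (cornerProfile (sin θ) y * cornerSlope (sin θ) y) * sin (y * sin θ) ^ 2 +
    cornerProfile (sin θ) y ^ 2 * (sin (y * sin θ) * cos (y * sin θ))

/-- In the corner the plateau is identically 1, so the excess is a polynomial in `τ` that does not
involve `r`; hence `τ` can be fixed before `r`. -/
theorem sliceEnergy_plateau_sub_of_nonpos {τ r y : ℝ} (hθ : θ ∈ Set.Ioo 0 (π / 2)) (hr : 0 < r)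
    (hy : y ≤ 0) :
    sliceEnergy θ (plateau (sin θ) τ r) y - plateau (sin θ) τ r y ^ 2 * sliceMass θ y =
      sin (y * sin θ) * cos (y * sin θ) +
        τ * (sin θ * cornerSlope (sin θ) y * sin (y * sin θ) ^ 2 +
          2 * cornerProfile (sin θ) y * (sin (y * sin θ) * cos (y * sin θ))) +
        τ ^ 2 * cornerQuad θ y := by
  have h1 : 2 ≤ 2 - y / r := by linarith [div_nonpos_of_nonpos_of_nonneg hy hr.le]
  have h2 : deriv smoothTransition (2 - y / r) = 0 :=
    deriv_smoothTransition_eq_zero fun h => by linarith [h.2]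
  have h3 : lowestTransverse θ y = -(y * sin θ) :=
    max_eq_right (neg_nonneg.2 (mul_nonpos_of_nonpos_of_nonneg hy (sin_pos_of_mem hθ).le))
  rw [sliceEnergy, deriv_plateau, h2, h3, plateau, smoothTransition.one_of_one_le (by linarith),
    sin_neg, cos_neg, cornerQuad]
  ring

theorem sliceEnergy_plateau_sub_of_pos {τ r y : ℝ} (hθ : θ ∈ Set.Ioo 0 (π / 2)) (hy : 0 < y) :
    sliceEnergy θ (plateau (sin θ) τ r) y - plateau (sin θ) τ r y ^ 2 * sliceMass θ y =
      (deriv smoothTransition (2 - y / r) / r) ^ 2 * (π / 2) := by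
  have h2 : deriv smoothTransition (-y) = 0 :=
    deriv_smoothTransition_eq_zero fun h => by linarith [h.1]
  obtain ⟨h3, h4⟩ := sliceEnergy_of_nonneg (κ := plateau (sin θ) τ r) hθ hy.le
  rw [h3, h4, deriv_plateau, cornerSlope, h2, smoothTransition.zero_of_nonpos (by linarith)]
  ring

/-- The corner contributes `-2 β τ + Γ τ²` with `β > 0`, and the end of the plateau at most `π M² /
r`. The choice of `τ` makes the first less than `-β τ`, and that of `r` makes the second less than
`β τ`. -/
theorem exists_plateau_integral_neg (hθ : θ ∈ Set.Ioo 0 (π / 2)) :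
    ∃ τ r, 0 < r ∧ ∫ y in -(π / sin θ)..(2 * r), (sliceEnergy θ (plateau (sin θ) τ r) y -
      plateau (sin θ) τ r y ^ 2 * sliceMass θ y) < 0 := by
  have hs := sin_pos_of_mem hθ
  have hc := cos_pos_of_mem hθ
  have hps := div_pos pi_pos hs
  have hk := (contDiff_cornerProfile (sin θ)).continuous
  have hk' := continuous_cornerSlope (sin θ)
  have hm := continuous_sliceMass θ
  have hQ : Continuous (cornerQuad θ) := by
    unfold cornerQuad
    fun_prop
  obtain ⟨M, hM0, hM⟩ := exists_deriv_smoothTransition_le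
  obtain ⟨β, hβ⟩ : ∃ β, -β = cos θ ^ 2 * ∫ y in -(π / sin θ)..0,
      cornerProfile (sin θ) y * (sin (y * sin θ) * cos (y * sin θ)) := ⟨_, neg_neg _⟩
  have hβ0 : 0 < β := by
    have := mul_neg_of_pos_of_neg (pow_pos hc 2) (integral_cornerProfile_neg hs)
    linarith
  set Γ := ∫ y in -(π / sin θ)..0, cornerQuad θ y with hΓ
  have hΓ1 : 0 < |Γ| + 1 := by positivity
  -- The sign of `Γ` is not known; adding 1 to its absolute value gives `τ Γ < β` and a nonzero
  -- denominator.
  set τ := β / (|Γ| + 1) with hτ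
  have hτ0 : 0 < τ := div_pos hβ0 hΓ1
  have hτΓ : τ * Γ < β := by
    have h1 : τ * (|Γ| + 1) = β := div_mul_cancel₀ _ hΓ1.ne'
    nlinarith [le_abs_self Γ]
  set r := π * M ^ 2 / (β * τ) + 1 with hr
  have hβτ : 0 < β * τ := mul_pos hβ0 hτ0
  have hr0 : 0 < r := by positivity
  have hcont : Continuous fun y => sliceEnergy θ (plateau (sin θ) τ r) y -
      plateau (sin θ) τ r y ^ 2 * sliceMass θ y :=
    (continuous_sliceEnergy (contDiff_plateau _ _ _)).sub
      (((contDiff_plateau _ _ _).continuous.pow 2).mul hm)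
  have h1 : ∫ y in -(π / sin θ)..0, (sliceEnergy θ (plateau (sin θ) τ r) y -
      plateau (sin θ) τ r y ^ 2 * sliceMass θ y) = -(2 * β * τ) + τ ^ 2 * Γ := by
    rw [intervalIntegral.integral_congr fun y hy => sliceEnergy_plateau_sub_of_nonpos hθ hr0
      (by rw [Set.uIcc_of_le (by linarith)] at hy; exact hy.2)]
    rw [intervalIntegral.integral_add (Continuous.intervalIntegrable (by fun_prop) _ _)
        (Continuous.intervalIntegrable (by fun_prop) _ _),
      intervalIntegral.integral_add (Continuous.intervalIntegrable (by fun_prop) _ _)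
        (Continuous.intervalIntegrable (by fun_prop) _ _),
      intervalIntegral.integral_const_mul, intervalIntegral.integral_const_mul,
      integral_sin_mul_cos_corner hs, integral_linear_corner hs, ← hΓ,
      ← cos_sq' θ, mul_assoc 2, ← hβ]
    ring
  -- Only the slope of the plateau is left here: at most `M / r`, squared, over a length `2 * r`.
  have h2 : ∫ y in 0..(2 * r), (sliceEnergy θ (plateau (sin θ) τ r) y -
      plateau (sin θ) τ r y ^ 2 * sliceMass θ y) ≤ (M / r) ^ 2 * (π / 2) * |2 * r - 0| := by
    refine (Real.le_norm_self _).trans (intervalIntegral.norm_integral_le_of_norm_le_const ?_)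
    intro y hy
    rw [Set.uIoc_of_le (by linarith)] at hy
    rw [sliceEnergy_plateau_sub_of_pos hθ hy.1, Real.norm_eq_abs, abs_of_nonneg (by positivity)]
    refine mul_le_mul_of_nonneg_right ?_ (by positivity)
    rw [← sq_abs, abs_div, abs_of_pos hr0]
    exact pow_le_pow_left₀ (by positivity) (div_le_div_of_nonneg_right (hM _) hr0.le) 2
  have h3 : (M / r) ^ 2 * (π / 2) * |2 * r - 0| < β * τ := by
    rw [sub_zero, abs_of_pos (by linarith)]
    have e1 : (M / r) ^ 2 * (π / 2) * (2 * r) = π * M ^ 2 / r := by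
      field_simp
    rw [e1, div_lt_iff₀ hr0, hr, mul_add, mul_div_cancel₀ _ hβτ.ne']
    linarith
  refine ⟨τ, r, hr0, ?_⟩
  rw [← intervalIntegral.integral_add_adjacent_intervals (b := 0)
    (hcont.intervalIntegrable _ _) (hcont.intervalIntegrable _ _), h1]
  nlinarith [mul_lt_mul_of_pos_left hτΓ hτ0]

theorem exists_trial (hθ : θ ∈ Set.Ioo 0 (π / 2)) :
    ∃ u : (dirichletLaplacian (brokenGuide θ)).domain,
      quad (dirichletLaplacian (brokenGuide θ)) u < ‖(u : L2 (brokenGuide θ))‖ ^ 2 := by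
  obtain ⟨τ, r, hr, hneg⟩ := exists_plateau_integral_neg hθ
  have hps := div_pos pi_pos (sin_pos_of_mem hθ)
  have h1 := continuous_sliceEnergy (θ := θ) (contDiff_plateau (sin θ) τ r)
  have h2 : Continuous fun y => plateau (sin θ) τ r y ^ 2 * sliceMass θ y :=
    ((contDiff_plateau _ _ _).continuous.pow 2).mul (continuous_sliceMass θ)
  obtain ⟨φ, hφ, -, hq⟩ := exists_test_of_slice_lt hθ (contDiff_plateau (sin θ) τ r)
    (fun y hy => plateau_eq_zero hr hy) (C := 1) (by
      rw [intervalIntegral.integral_sub (h1.intervalIntegrable _ _) (h2.intervalIntegrable _ _),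
        intervalIntegral.integral_of_le (by linarith),
        intervalIntegral.integral_of_le (by linarith), ← integral_Icc_eq_integral_Ioc,
        ← integral_Icc_eq_integral_Ioc] at hneg
      linarith)
  exact ⟨hφ.toDomain, by rwa [one_mul] at hq⟩

end Trial

end Waveguide

end

theorem proposition5p1 (θ : ℝ) (hθ : θ ∈ Set.Ioo 0 (Real.pi / 2)) :
    let A := Waveguide.dirichletLaplacian (Waveguide.brokenGuide θ)
    (0 < Waveguide.countBelow A 1 ∧ Waveguide.countBelow A 1 < ⊤) ∧
    (Waveguide.eigenvaluesBelowEss A).Finite ∧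
    (Waveguide.eigenvaluesBelowEss A).Nonempty ∧
    Waveguide.eigenvaluesBelowEss A =
      {r : ℝ | Waveguide.eigenspace A (r : ℂ) ≠ ⊥ ∧ r < 1} ∧
    (∀ r ∈ Waveguide.eigenvaluesBelowEss A,
      FiniteDimensional ℂ (Waveguide.eigenspace A (r : ℂ))) ∧
    Waveguide.countBelow A 1 =
      ((∑ᶠ r ∈ Waveguide.eigenvaluesBelowEss A,
        Module.finrank ℂ (Waveguide.eigenspace A (r : ℂ)) : ℕ) : ℕ∞) := by
  intro A
  obtain ⟨F, hF, hb⟩ := Waveguide.exists_boundedBelowOn hθ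
  exact Waveguide.spectral_conclusion (Waveguide.isNonnegSelfAdjoint_dirichletLaplacian _) hb
    (Waveguide.exists_high hθ) (Waveguide.exists_trial hθ)
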